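/- Let $k$ be a field and let $H$ be a finite-dimensional quasi-triangular Hopf algebra over $k$, with antipode $S$ and universal $R$-matrix $\mathcal R=\sum_a s_a\otimes t_a\in H\otimes H$, so that $\mathcal R$ is invertible, $\mathcal R\,\Delta(h)=\Delta^{\mathrm{op}}(h)\,\mathcal R$, $(\Delta\otimes\mathrm{id})\mathcal R=\mathcal R_{13}\mathcal R_{23}$ and $(\mathrm{id}\otimes\Delta)\mathcal R=\mathcal R_{13}\mathcal R_{12}$. Let $\mathcal C=H\text{-mod}$ be the category of finite-dimensional left $H$-modules, with the braiding $c_{A,B}:A\otimes B\to B\otimes A$ given by acting with $\mathcal R$ and then swapping the factors. *The elliptic Drinfeld center.* A half-braiding on $X\in\mathcal C$ is a natural isomorphism $\lambda:-\otimes X\to X\otimes-$ with $\lambda_{A\otimes B}=(\lambda_A\otimes\mathrm{id}_B)(\mathrm{id}_A\otimes\lambda_B)$. Objects of $\mathcal Z^{\mathrm{el}}(\mathcal C)$ are triples $(X,\lambda^1,\lambda^2)$ with $X\in\mathcal C$ and $\lambda^1,\lambda^2$ half-braidings on $X$ satisfying, for all $A,B$, as maps $A\otimes B\otimes X\to X\otimes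 B\otimes A$, $$\textbf{COMM:}\quad(\mathrm{id}_X\otimes c_{A,B})(\lambda^1_A\otimes\mathrm{id}_B)(\mathrm{id}_A\otimes\lambda^2_B)=(\lambda^2_B\otimes\mathrm{id}_A)(\mathrm{id}_B\otimes\lambda^1_A)(c_{B,A}^{-1}\otimes\mathrm{id}_X).$$ Morphisms are the morphisms of $\mathcal C$ that intertwine both half-braidings. *The elliptic Drinfeld double.* Give $H^*$ the product $(fg)(h)=f(h_1)g(h_2)$ with unit $\varepsilon$ (this is the algebra $H^{*,\mathrm{cop}}$) and write $f_1\otimes f_2\otimes f_3$ for the element with $f(xyz)=f_1(x)f_2(y)f_3(z)$. Then $\mathcal D^{\mathrm{el}}(H)$ is the algebra generated by $H$ and two copies $H_1^{*,\mathrm{cop}},H_2^{*,\mathrm{cop}}$ of $H^{*,\mathrm{cop}}$, each mapping in by an algebra map, with the relations $$fh=\langle f_3,S^{-1}(h_1)\rangle\langle f_1,h_3\rangle\,h_2f_2\qquad(h\in H,\ f\text{ in either copy}),$$ $$f^2f^1=\sum_{a,a'}\langle f^1_1,s_a\rangle\langle f^1_3,t_{a'}\rangle\langle f^2_1,t_a\rangle\langle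 f^2_3,s_{a'}\rangle\,f^1_2f^2_2\qquad(f^1\in H_1^{*,\mathrm{cop}},\ f^2\in H_2^{*,\mathrm{cop}}).$$ **Theorem.** 1. The linear map $H\otimes H_1^{*,\mathrm{cop}}\otimes H_2^{*,\mathrm{cop}}\to\mathcal D^{\mathrm{el}}(H)$, $h\otimes f^1\otimes f^2\mapsto hf^1f^2$, is bijective. 2. $\mathcal Z^{\mathrm{el}}(\mathcal C)$ and the category $\mathcal D^{\mathrm{el}}(H)\text{-mod}$ of finite-dimensional left $\mathcal D^{\mathrm{el}}(H)$-modules are abelian, and there is a $k$-linear equivalence $\mathcal Z^{\mathrm{el}}(\mathcal C)\simeq\mathcal D^{\mathrm{el}}(H)\text{-mod}$ (hence an equivalence of abelian categories). Up to natural isomorphism it preserves underlying $H$-modules, and under it $f\in H_i^{*,\mathrm{cop}}$ acts on $(X,\lambda^1,\lambda^2)$ by $f\cdot_{\lambda^i}x$, where $f\cdot_\lambda x=(\mathrm{id}_X\otimes f)\bigl(\lambda_H(1\otimes x)\bigr)$, for $i=1,2$. 3. For every $X\in\mathcal C$, sending $\lambda$ to the action $f\cdot_\lambda x$ is a bijection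 from the half-braidings on $X$ to the actions of the algebra $H^{*,\mathrm{cop}}$ on $X$ that satisfy the first relation above with the action of $H$. For every basis $(h_i)$ of $H$ with dual basis $(h_i^*)$ and all $A\in\mathcal C$, $a\in A$, $x\in X$, one has $\lambda_A(a\otimes x)=\sum_i (h_i^*\cdot_\lambda x)\otimes h_i a$. 4. Two half-braidings $\lambda^1,\lambda^2$ on $X$ satisfy COMM if and only if the actions $\cdot_{\lambda^1},\cdot_{\lambda^2}$ satisfy the second relation above. -/

import Mathlib

universe v u

open CategoryTheory MonoidalCategory
open scoped TensorProduct

noncomputable section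

namespace EllipticDrinfeld

/-! ## The elliptic Drinfeld center of a braided monoidal category -/

section Center

variable {C : Type u} [Category.{v} C] [MonoidalCategory C]

/-- A half-braiding on `X`: a natural isomorphism `- ⊗ X ≅ X ⊗ -` that respects tensor products.
(The structure `CategoryTheory.HalfBraiding` has `X` on the other side.) -/
@[ext]
structure LeftHalfBraiding (X : C) where
  β : ∀ A : C, A ⊗ X ≅ X ⊗ A
  naturality : ∀ {A B : C} (f : A ⟶ B), f ▷ X ≫ (β B).hom = (β A).hom ≫ X ◁ f
  monoidal : ∀ A B : C, (β (A ⊗ B)).hom =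
    (α_ A B X).hom ≫ A ◁ (β B).hom ≫ (α_ A X B).inv ≫ (β A).hom ▷ B ≫ (α_ X A B).hom

/-- `f` intertwines the half-braidings `l` and `m`. -/
def Intertwines {X Y : C} (l : LeftHalfBraiding X) (m : LeftHalfBraiding Y) (f : X ⟶ Y) : Prop :=
  ∀ A : C, (l.β A).hom ≫ f ▷ A = A ◁ f ≫ (m.β A).hom

theorem intertwines_id {X : C} (l : LeftHalfBraiding X) : Intertwines l l (𝟙 X) := by
  intro A; simp

theorem intertwines_comp {X Y Z : C} {l : LeftHalfBraiding X} {m : LeftHalfBraiding Y}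
    {n : LeftHalfBraiding Z} {f : X ⟶ Y} {g : Y ⟶ Z}
    (hf : Intertwines l m f) (hg : Intertwines m n g) : Intertwines l n (f ≫ g) := by
  intro A
  rw [comp_whiskerRight, MonoidalCategory.whiskerLeft_comp, ← Category.assoc, hf A, Category.assoc,
    hg A, Category.assoc]

section Linear

variable [Preadditive C] [MonoidalPreadditive C]

theorem intertwines_zero {X Y : C} (l : LeftHalfBraiding X) (m : LeftHalfBraiding Y) :
    Intertwines l m (0 : X ⟶ Y) := by
  intro A; simp

theorem intertwines_add {X Y : C} {l : LeftHalfBraiding X} {m : LeftHalfBraiding Y}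
    {f g : X ⟶ Y} (hf : Intertwines l m f) (hg : Intertwines l m g) :
    Intertwines l m (f + g) := by
  intro A; simp [hf A, hg A]

theorem intertwines_neg {X Y : C} {l : LeftHalfBraiding X} {m : LeftHalfBraiding Y}
    {f : X ⟶ Y} (hf : Intertwines l m f) : Intertwines l m (-f) := by
  intro A
  have h1 : (-f) ▷ A = -(f ▷ A) := (tensorRight A).map_neg (f := f)
  have h2 : A ◁ (-f) = -(A ◁ f) := (tensorLeft A).map_neg (f := f)
  rw [h1, h2, Preadditive.comp_neg, Preadditive.neg_comp, hf A]

variable {k : Type*} [CommRing k] [Linear k C] [MonoidalLinear k C]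

theorem intertwines_smul {X Y : C} {l : LeftHalfBraiding X} {m : LeftHalfBraiding Y}
    {f : X ⟶ Y} (hf : Intertwines l m f) (r : k) : Intertwines l m (r • f) := by
  intro A; simp [hf A]

end Linear

/-- The compatibility condition COMM for an ordered pair of half-braidings: for all `A`, `B`, the
composites `A B X → A X B → X A B → X B A` (ending with the braiding `c_{A,B}`) and
`A B X → B A X → B X A → X B A` (starting with the reverse braiding `c_{B,A}⁻¹`) coincide. -/
def Comm [BraidedCategory C] {X : C} (l₁ l₂ : LeftHalfBraiding X) : Prop :=
  ∀ A B : C,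
    (α_ A B X).hom ≫ A ◁ (l₂.β B).hom ≫ (α_ A X B).inv ≫ (l₁.β A).hom ▷ B ≫ (α_ X A B).hom ≫
        X ◁ (β_ A B).hom =
      (β_ B A).inv ▷ X ≫ (α_ B A X).hom ≫ B ◁ (l₁.β A).hom ≫ (α_ B X A).inv ≫
        (l₂.β B).hom ▷ A ≫ (α_ X B A).hom

variable (C) in
/-- The elliptic Drinfeld center: objects of `C` with two half-braidings satisfying COMM. -/
structure EllipticCenter [BraidedCategory C] where
  obj : C
  hb₁ : LeftHalfBraiding obj
  hb₂ : LeftHalfBraiding obj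
  comm : Comm hb₁ hb₂

namespace EllipticCenter

variable [BraidedCategory C]

/-- Morphisms: those of `C` that intertwine both half-braidings. -/
@[ext]
structure Hom (X Y : EllipticCenter C) where
  f : X.obj ⟶ Y.obj
  comm₁ : Intertwines X.hb₁ Y.hb₁ f
  comm₂ : Intertwines X.hb₂ Y.hb₂ f

instance : Category (EllipticCenter C) where
  Hom := Hom
  id X := ⟨𝟙 X.obj, intertwines_id _, intertwines_id _⟩
  comp f g := ⟨f.f ≫ g.f, intertwines_comp f.comm₁ g.comm₁, intertwines_comp f.comm₂ g.comm₂⟩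
  id_comp f := Hom.ext (Category.id_comp f.f)
  comp_id f := Hom.ext (Category.comp_id f.f)
  assoc f g h := Hom.ext (Category.assoc f.f g.f h.f)

variable (C) in
/-- The functor forgetting both half-braidings. -/
def forget : EllipticCenter C ⥤ C where
  obj X := X.obj
  map f := Hom.f f

section Linear

variable [Preadditive C] [MonoidalPreadditive C]

/-- The morphisms of the elliptic center, as a subgroup of the morphisms of `C`. -/
def homSubgroup (X Y : EllipticCenter C) : AddSubgroup (X.obj ⟶ Y.obj) where
  carrier := {f | Intertwines X.hb₁ Y.hb₁ f ∧ Intertwines X.hb₂ Y.hb₂ f}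
  zero_mem' := ⟨intertwines_zero _ _, intertwines_zero _ _⟩
  add_mem' hf hg := ⟨intertwines_add hf.1 hg.1, intertwines_add hf.2 hg.2⟩
  neg_mem' hf := ⟨intertwines_neg hf.1, intertwines_neg hf.2⟩

def homEquiv (X Y : EllipticCenter C) : (X ⟶ Y) ≃ homSubgroup X Y where
  toFun f := ⟨Hom.f f, Hom.comm₁ f, Hom.comm₂ f⟩
  invFun f := Hom.mk f.1 f.2.1 f.2.2
  left_inv _ := rfl
  right_inv _ := rfl

instance (X Y : EllipticCenter C) : AddCommGroup (X ⟶ Y) := (homEquiv X Y).addCommGroup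

instance : Preadditive (EllipticCenter C) where
  add_comp _ _ _ _ _ _ := Hom.ext (Preadditive.add_comp _ _ _ _ _ _)
  comp_add _ _ _ _ _ _ := Hom.ext (Preadditive.comp_add _ _ _ _ _ _)

variable {k : Type*} [CommRing k] [Linear k C] [MonoidalLinear k C]

instance (X Y : EllipticCenter C) : Module k (X ⟶ Y) :=
  letI : SMul k (X ⟶ Y) :=
    ⟨fun r f => Hom.mk (r • Hom.f f) (intertwines_smul (Hom.comm₁ f) r)
      (intertwines_smul (Hom.comm₂ f) r)⟩
  Function.Injective.module k
    (⟨⟨fun f => Hom.f f, rfl⟩, fun _ _ => rfl⟩ : (X ⟶ Y) →+ (X.obj ⟶ Y.obj))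
    (fun _ _ h => Hom.ext h) (fun _ _ => rfl)

instance : Linear k (EllipticCenter C) where
  smul_comp _ _ _ _ _ _ := Hom.ext (Linear.smul_comp _ _ _ _ _ _)
  comp_smul _ _ _ _ _ _ := Hom.ext (Linear.comp_smul _ _ _ _ _ _)

end Linear

end EllipticCenter

end Center

/-! ## Finite-dimensional modules over an algebra -/

/-- A finite-dimensional left `A`-module: a finite-dimensional vector space `V` with an action of
`A`, given as an algebra map to the endomorphisms of `V`. -/
structure FDMod (k A : Type u) [Field k] [Ring A] [Algebra k A] where
  V : Type u
  [addCommGroup : AddCommGroup V]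
  [module : Module k V]
  [finite : Module.Finite k V]
  ρ : A →ₐ[k] Module.End k V

attribute [instance] FDMod.addCommGroup FDMod.module FDMod.finite

namespace FDMod

section Category

variable {k A : Type u} [Field k] [Ring A] [Algebra k A]

/-- `A`-linear maps. -/
@[ext]
structure Hom (X Y : FDMod k A) where
  lin : X.V →ₗ[k] Y.V
  comm : ∀ a : A, lin ∘ₗ X.ρ a = Y.ρ a ∘ₗ lin

instance : Category (FDMod k A) where
  Hom := Hom
  id X := ⟨LinearMap.id, fun _ => rfl⟩
  comp f g := ⟨g.lin ∘ₗ f.lin, fun a => by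
    rw [LinearMap.comp_assoc, f.comm, ← LinearMap.comp_assoc, g.comm, LinearMap.comp_assoc]⟩

/-- The linear map underlying a morphism. -/
def toLin {X Y : FDMod k A} (f : X ⟶ Y) : X.V →ₗ[k] Y.V := Hom.lin f

theorem toLin_injective {X Y : FDMod k A} : Function.Injective (toLin : (X ⟶ Y) → _) :=
  fun _ _ h => Hom.ext h

/-- Isomorphisms from bijective `A`-linear maps. -/
def isoMk {X Y : FDMod k A} (e : X.V ≃ₗ[k] Y.V)
    (h : ∀ a : A, e.toLinearMap ∘ₗ X.ρ a = Y.ρ a ∘ₗ e.toLinearMap) : X ≅ Y where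
  hom := Hom.mk e.toLinearMap h
  inv := Hom.mk e.symm.toLinearMap fun a => by
    ext y
    apply e.injective
    have := LinearMap.congr_fun (h a) (e.symm y)
    simp only [LinearMap.comp_apply, LinearEquiv.coe_coe, LinearEquiv.apply_symm_apply] at this ⊢
    exact this.symm
  hom_inv_id := toLin_injective (LinearMap.ext fun x => e.symm_apply_apply x)
  inv_hom_id := toLin_injective (LinearMap.ext fun x => e.apply_symm_apply x)

/-- The `A`-linear maps form a subspace of the linear maps. -/
def homSubmodule (X Y : FDMod k A) : Submodule k (X.V →ₗ[k] Y.V) where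
  carrier := {f | ∀ a : A, f ∘ₗ X.ρ a = Y.ρ a ∘ₗ f}
  zero_mem' a := by simp
  add_mem' hf hg a := by rw [LinearMap.add_comp, LinearMap.comp_add, hf a, hg a]
  smul_mem' r f hf a := by rw [LinearMap.smul_comp, LinearMap.comp_smul, hf a]

def homEquiv (X Y : FDMod k A) : (X ⟶ Y) ≃ homSubmodule X Y where
  toFun f := ⟨Hom.lin f, Hom.comm f⟩
  invFun f := Hom.mk f.1 f.2
  left_inv _ := rfl
  right_inv _ := rfl

instance (X Y : FDMod k A) : AddCommGroup (X ⟶ Y) := (homEquiv X Y).addCommGroup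

instance : Preadditive (FDMod k A) where
  add_comp _ _ _ _ _ _ := toLin_injective (LinearMap.comp_add _ _ _)
  comp_add _ _ _ _ _ _ := toLin_injective (LinearMap.add_comp _ _ _)

instance (X Y : FDMod k A) : Module k (X ⟶ Y) := (homEquiv X Y).module k

instance : Linear k (FDMod k A) where
  smul_comp _ _ _ _ _ _ := toLin_injective (LinearMap.comp_smul _ _ _)
  comp_smul _ _ _ _ _ _ := toLin_injective (LinearMap.smul_comp _ _ _)

/-- Restriction of the action along an algebra map. -/
def restrict {B : Type u} [Ring B] [Algebra k B] (φ : A →ₐ[k] B) : FDMod k B ⥤ FDMod k A where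
  obj X := { V := X.V, ρ := X.ρ.comp φ }
  map {X Y} f :=
    show Hom { V := X.V, ρ := X.ρ.comp φ : FDMod k A } { V := Y.V, ρ := Y.ρ.comp φ } from
      { lin := toLin (X := X) (Y := Y) f, comm := fun a => Hom.comm f (φ a) }

variable (k A) in
/-- The left regular module. -/
def regular [Module.Finite k A] : FDMod k A where
  V := A
  ρ := Algebra.lmul k A

end Category

/-! ### The tensor product of modules over a Hopf algebra -/

section Reps

variable {k H : Type u} [Field k] [Ring H] [HopfAlgebra k H]
variable {U V W U' V' : Type u} [AddCommGroup U] [Module k U] [AddCommGroup V] [Module k V]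
  [AddCommGroup W] [Module k W] [AddCommGroup U'] [Module k U'] [AddCommGroup V'] [Module k V']

/-- The componentwise action of `H ⊗ H` on `U ⊗ V`. -/
def act₂ (ρ : H →ₐ[k] Module.End k U) (σ : H →ₐ[k] Module.End k V) :
    H ⊗[k] H →ₐ[k] Module.End k (U ⊗[k] V) :=
  (Module.endTensorEndAlgHom (R := k) (S := k) (A := k) (M := U) (N := V)).comp
    (Algebra.TensorProduct.map ρ σ)

/-- The componentwise action of `H ⊗ (H ⊗ H)` on `U ⊗ (V ⊗ W)`. -/
def act₃ (ρ : H →ₐ[k] Module.End k U) (σ : H →ₐ[k] Module.End k V)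
    (τ : H →ₐ[k] Module.End k W) :
    H ⊗[k] (H ⊗[k] H) →ₐ[k] Module.End k (U ⊗[k] (V ⊗[k] W)) :=
  (Module.endTensorEndAlgHom (R := k) (S := k) (A := k) (M := U) (N := V ⊗[k] W)).comp
    (Algebra.TensorProduct.map ρ (act₂ σ τ))

/-- The action of `H` on `U ⊗ V` through the comultiplication. -/
def tensorRep (ρ : H →ₐ[k] Module.End k U) (σ : H →ₐ[k] Module.End k V) :
    H →ₐ[k] Module.End k (U ⊗[k] V) :=
  (act₂ ρ σ).comp (Bialgebra.comulAlgHom k H)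

variable (k H) in
/-- The action of `H` on the ground field through the counit. -/
def unitRep : H →ₐ[k] Module.End k k :=
  (Algebra.lmul k k).comp (Bialgebra.counitAlgHom k H)

variable (ρ : H →ₐ[k] Module.End k U) (σ : H →ₐ[k] Module.End k V) (τ : H →ₐ[k] Module.End k W)

@[simp]
theorem act₂_tmul (a b : H) : act₂ ρ σ (a ⊗ₜ b) = TensorProduct.map (ρ a) (σ b) := by
  simp only [act₂, AlgHom.comp_apply, Algebra.TensorProduct.map_tmul]
  exact Module.endTensorEndAlgHom_apply _ _

@[simp]
theorem act₃_tmul (a : H) (r : H ⊗[k] H) :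
    act₃ ρ σ τ (a ⊗ₜ r) = TensorProduct.map (ρ a) (act₂ σ τ r) := by
  simp only [act₃, AlgHom.comp_apply, Algebra.TensorProduct.map_tmul]
  exact Module.endTensorEndAlgHom_apply _ _

@[simp]
theorem tensorRep_apply (h : H) :
    tensorRep ρ σ h = act₂ ρ σ (Coalgebra.comul (R := k) h) := rfl

@[simp]
theorem unitRep_apply (h : H) (c : k) : unitRep k H h c = Coalgebra.counit (R := k) h * c := rfl

theorem act₂_tensorRep_right (r : H ⊗[k] H) :
    act₂ ρ (tensorRep σ τ) r =
      act₃ ρ σ τ (Algebra.TensorProduct.map (AlgHom.id k H) (Bialgebra.comulAlgHom k H) r) := by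
  induction r with
  | zero => simp
  | add x y hx hy => simp only [map_add, hx, hy]
  | tmul a b => simp

theorem map_act₂_assoc (r : H ⊗[k] H) (c : H) (v : (U ⊗[k] V) ⊗[k] W) :
    TensorProduct.assoc k U V W (TensorProduct.map (act₂ ρ σ r) (τ c) v) =
      act₃ ρ σ τ (TensorProduct.assoc k H H H (r ⊗ₜ c)) (TensorProduct.assoc k U V W v) := by
  induction r with
  | zero => simp
  | add x y hx hy =>
    simp only [map_add, TensorProduct.map_add_left, LinearMap.add_apply, hx, hy,
      TensorProduct.add_tmul]
  | tmul a b =>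
    simp only [act₂_tmul, TensorProduct.assoc_tmul, act₃_tmul]
    exact (TensorProduct.map_map_assoc (ρ a) (σ b) (τ c) v).symm

theorem act₂_tensorRep_left (r : H ⊗[k] H) (v : (U ⊗[k] V) ⊗[k] W) :
    TensorProduct.assoc k U V W (act₂ (tensorRep ρ σ) τ r v) =
      act₃ ρ σ τ (TensorProduct.assoc k H H H
        (Algebra.TensorProduct.map (Bialgebra.comulAlgHom k H) (AlgHom.id k H) r))
        (TensorProduct.assoc k U V W v) := by
  induction r with
  | zero => simp
  | add x y hx hy => simp only [map_add, LinearMap.add_apply, hx, hy]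
  | tmul a b =>
    rw [Algebra.TensorProduct.map_tmul, AlgHom.id_apply, ← map_act₂_assoc, act₂_tmul]
    rfl

theorem map_comp_act₂ {ρ' : H →ₐ[k] Module.End k U'} {σ' : H →ₐ[k] Module.End k V'}
    {f : U →ₗ[k] U'} {g : V →ₗ[k] V'} (hf : ∀ a, f ∘ₗ ρ a = ρ' a ∘ₗ f)
    (hg : ∀ a, g ∘ₗ σ a = σ' a ∘ₗ g) (r : H ⊗[k] H) :
    TensorProduct.map f g ∘ₗ act₂ ρ σ r = act₂ ρ' σ' r ∘ₗ TensorProduct.map f g := by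
  induction r with
  | zero => simp
  | add x y hx hy => simp only [map_add, LinearMap.comp_add, LinearMap.add_comp, hx, hy]
  | tmul a b => simp only [act₂_tmul, ← TensorProduct.map_comp, hf, hg]

theorem act₂_unitRep_left (r : H ⊗[k] H) (v : k ⊗[k] U) :
    TensorProduct.lid k U (act₂ (unitRep k H) ρ r v) =
      ρ (TensorProduct.lid k H (Coalgebra.counit.rTensor H r)) (TensorProduct.lid k U v) := by
  induction r with
  | zero => simp
  | add x y hx hy => simp only [map_add, LinearMap.add_apply, hx, hy]
  | tmul a b =>
    induction v with
    | zero => simp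
    | add x y hx hy => simp only [map_add, hx, hy]
    | tmul c w => simp [mul_smul, smul_comm c]

theorem act₂_unitRep_right (r : H ⊗[k] H) (v : U ⊗[k] k) :
    TensorProduct.rid k U (act₂ ρ (unitRep k H) r v) =
      ρ (TensorProduct.rid k H (Coalgebra.counit.lTensor H r)) (TensorProduct.rid k U v) := by
  induction r with
  | zero => simp
  | add x y hx hy => simp only [map_add, LinearMap.add_apply, hx, hy]
  | tmul a b =>
    induction v with
    | zero => simp
    | add x y hx hy => simp only [map_add, hx, hy]
    | tmul w c => simp [mul_smul, smul_comm c]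

theorem comm_act₂ (r : H ⊗[k] H) (v : U ⊗[k] V) :
    TensorProduct.comm k U V (act₂ ρ σ r v) =
      act₂ σ ρ (TensorProduct.comm k H H r) (TensorProduct.comm k U V v) := by
  induction r with
  | zero => simp
  | add x y hx hy => simp only [map_add, LinearMap.add_apply, hx, hy]
  | tmul a b =>
    simp only [act₂_tmul, TensorProduct.comm_tmul]
    exact (TensorProduct.map_comm (σ b) (ρ a) v).symm

end Reps

section Monoidal

variable {k H : Type u} [Field k] [Ring H] [HopfAlgebra k H]

/-- The tensor product over `k`, where `H` acts through the comultiplication. -/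
def tensor (X Y : FDMod k H) : FDMod k H where
  V := X.V ⊗[k] Y.V
  ρ := tensorRep X.ρ Y.ρ

variable (k H) in
/-- The ground field, where `H` acts through the counit. -/
def unit : FDMod k H where
  V := k
  ρ := unitRep k H

/-- The tensor product of two morphisms. -/
def tensorMap {X X' Y Y' : FDMod k H} (f : X ⟶ X') (g : Y ⟶ Y') : tensor X Y ⟶ tensor X' Y' :=
  Hom.mk (X := tensor X Y) (Y := tensor X' Y') (TensorProduct.map (toLin f) (toLin g))
    fun _ => map_comp_act₂ X.ρ Y.ρ (Hom.comm f) (Hom.comm g) _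

def associator (X Y Z : FDMod k H) : tensor (tensor X Y) Z ≅ tensor X (tensor Y Z) :=
  isoMk (X := tensor (tensor X Y) Z) (Y := tensor X (tensor Y Z))
    (TensorProduct.assoc k X.V Y.V Z.V) fun h => LinearMap.ext fun v =>
      (act₂_tensorRep_left X.ρ Y.ρ Z.ρ (Coalgebra.comul (R := k) h) v).trans <|
        (congrArg (fun w => act₃ X.ρ Y.ρ Z.ρ w (TensorProduct.assoc k X.V Y.V Z.V v))
          (Coalgebra.coassoc_apply (R := k) h)).trans
        (LinearMap.congr_fun (act₂_tensorRep_right X.ρ Y.ρ Z.ρ (Coalgebra.comul (R := k) h))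
          (TensorProduct.assoc k X.V Y.V Z.V v)).symm

def leftUnitor (X : FDMod k H) : tensor (unit k H) X ≅ X :=
  isoMk (X := tensor (unit k H) X) (TensorProduct.lid k X.V) fun h => LinearMap.ext fun v =>
    (act₂_unitRep_left X.ρ (Coalgebra.comul (R := k) h) v).trans (by
      rw [Coalgebra.rTensor_counit_comul, TensorProduct.lid_tmul, one_smul]; rfl)

def rightUnitor (X : FDMod k H) : tensor X (unit k H) ≅ X :=
  isoMk (X := tensor X (unit k H)) (TensorProduct.rid k X.V) fun h => LinearMap.ext fun v =>
    (act₂_unitRep_right X.ρ (Coalgebra.comul (R := k) h) v).trans (by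
      rw [Coalgebra.lTensor_counit_comul, TensorProduct.rid_tmul, one_smul]; rfl)

instance : MonoidalCategoryStruct (FDMod k H) where
  tensorObj := tensor
  whiskerLeft X _ _ f := tensorMap (𝟙 X) f
  whiskerRight f Y := tensorMap f (𝟙 Y)
  tensorHom f g := tensorMap f g
  tensorUnit := unit k H
  associator := associator
  leftUnitor := leftUnitor
  rightUnitor := rightUnitor

theorem hom_ext₂ {X Y Z : FDMod k H} {f g : X ⊗ Y ⟶ Z}
    (h : ∀ (x : X.V) (y : Y.V), toLin f (x ⊗ₜ[k] y : X.V ⊗[k] Y.V) =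
      toLin g (x ⊗ₜ[k] y : X.V ⊗[k] Y.V)) : f = g :=
  toLin_injective (TensorProduct.ext' (M := X.V) (N := Y.V) (P₂ := Z.V) h)

theorem hom_ext₃ {X Y W Z : FDMod k H} {f g : (X ⊗ Y) ⊗ W ⟶ Z}
    (h : ∀ (x : X.V) (y : Y.V) (w : W.V),
      toLin f ((x ⊗ₜ[k] y : X.V ⊗[k] Y.V) ⊗ₜ[k] w : (X.V ⊗[k] Y.V) ⊗[k] W.V) =
      toLin g ((x ⊗ₜ[k] y : X.V ⊗[k] Y.V) ⊗ₜ[k] w : (X.V ⊗[k] Y.V) ⊗[k] W.V)) : f = g :=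
  toLin_injective (TensorProduct.ext_threefold (M := X.V) (N := Y.V) (P := W.V) (P₂ := Z.V) h)

theorem hom_ext₄ {X Y W U Z : FDMod k H} {f g : ((X ⊗ Y) ⊗ W) ⊗ U ⟶ Z}
    (h : ∀ (x : X.V) (y : Y.V) (w : W.V) (u : U.V),
      toLin f (((x ⊗ₜ[k] y) ⊗ₜ[k] w) ⊗ₜ[k] u : ((X.V ⊗[k] Y.V) ⊗[k] W.V) ⊗[k] U.V) =
      toLin g (((x ⊗ₜ[k] y) ⊗ₜ[k] w) ⊗ₜ[k] u : ((X.V ⊗[k] Y.V) ⊗[k] W.V) ⊗[k] U.V)) : f = g :=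
  toLin_injective (TensorProduct.ext_fourfold (M := X.V) (N := Y.V) (P := W.V) (Q := U.V)
    (P₂ := Z.V) h)

instance : MonoidalCategory (FDMod k H) where
  tensorHom_def _ _ := hom_ext₂ fun _ _ => rfl
  id_tensorHom_id _ _ := hom_ext₂ fun _ _ => rfl
  tensorHom_comp_tensorHom _ _ _ _ := hom_ext₂ fun _ _ => rfl
  whiskerLeft_id _ _ := hom_ext₂ fun _ _ => rfl
  id_whiskerRight _ _ := hom_ext₂ fun _ _ => rfl
  associator_naturality _ _ _ := hom_ext₃ fun _ _ _ => rfl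
  leftUnitor_naturality f := hom_ext₂ fun c x => ((toLin f).map_smul (c : k) x).symm
  rightUnitor_naturality f := hom_ext₂ fun x c => ((toLin f).map_smul (c : k) x).symm
  pentagon _ _ _ _ := hom_ext₄ fun _ _ _ _ => rfl
  triangle X Y := hom_ext₃ fun x c y =>
    (TensorProduct.smul_tmul (R := k) (R' := k) (M := X.V) (N := Y.V) c x y).symm

instance : MonoidalPreadditive (FDMod k H) where
  whiskerLeft_zero := hom_ext₂ fun x _ => TensorProduct.tmul_zero _ x
  zero_whiskerRight := hom_ext₂ fun _ y => TensorProduct.zero_tmul _ y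
  whiskerLeft_add f g := hom_ext₂ fun x y => TensorProduct.tmul_add x (toLin f y) (toLin g y)
  add_whiskerRight f g := hom_ext₂ fun x y => TensorProduct.add_tmul (toLin f x) (toLin g x) y

instance : MonoidalLinear k (FDMod k H) where
  whiskerLeft_smul _ _ _ r f := hom_ext₂ fun x y => TensorProduct.tmul_smul r x (toLin f y)
  smul_whiskerRight r _ _ f _ := hom_ext₂ fun x y => (TensorProduct.smul_tmul' r (toLin f x) y).symm

end Monoidal

end FDMod

/-! ## Quasi-triangular Hopf algebras -/

section QuasiTriangular

variable (k : Type u) {H : Type u} [Field k] [Ring H] [HopfAlgebra k H]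

/-- `x ⊗ y ↦ x ⊗ y ⊗ 1` -/
def leg₁₂ : H ⊗[k] H →ₐ[k] H ⊗[k] (H ⊗[k] H) :=
  Algebra.TensorProduct.map (AlgHom.id k H) Algebra.TensorProduct.includeLeft

/-- `x ⊗ y ↦ x ⊗ 1 ⊗ y` -/
def leg₁₃ : H ⊗[k] H →ₐ[k] H ⊗[k] (H ⊗[k] H) :=
  Algebra.TensorProduct.map (AlgHom.id k H) Algebra.TensorProduct.includeRight

/-- `x ⊗ y ↦ 1 ⊗ x ⊗ y` -/
def leg₂₃ : H ⊗[k] H →ₐ[k] H ⊗[k] (H ⊗[k] H) :=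
  Algebra.TensorProduct.includeRight

variable (H) in
/-- A quasi-triangular structure on a Hopf algebra: an invertible `R` in `H ⊗ H` with
`R Δ(h) = Δᵒᵖ(h) R`, `(Δ ⊗ id) R = R₁₃ R₂₃` and `(id ⊗ Δ) R = R₁₃ R₁₂`. -/
class QuasiTriangular where
  R : (H ⊗[k] H)ˣ
  mul_comul : ∀ h : H, (R : H ⊗[k] H) * Coalgebra.comul (R := k) h =
    TensorProduct.comm k H H (Coalgebra.comul (R := k) h) * R
  comul_left : TensorProduct.assoc k H H H
      (Algebra.TensorProduct.map (Bialgebra.comulAlgHom k H) (AlgHom.id k H) (R : H ⊗[k] H)) =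
    leg₁₃ k (R : H ⊗[k] H) * leg₂₃ k (R : H ⊗[k] H)
  comul_right :
    Algebra.TensorProduct.map (AlgHom.id k H) (Bialgebra.comulAlgHom k H) (R : H ⊗[k] H) =
      leg₁₃ k (R : H ⊗[k] H) * leg₁₂ k (R : H ⊗[k] H)

variable (H) in
/-- The universal R-matrix. -/
abbrev Rmat [QuasiTriangular k H] : H ⊗[k] H := (QuasiTriangular.R : (H ⊗[k] H)ˣ)

end QuasiTriangular

namespace FDMod

section Braided

variable {k H : Type u} [Field k] [Ring H] [HopfAlgebra k H]

section Reps

variable {U V W : Type u} [AddCommGroup U] [Module k U] [AddCommGroup V] [Module k V]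
  [AddCommGroup W] [Module k W]
variable (ρ : H →ₐ[k] Module.End k U) (σ : H →ₐ[k] Module.End k V) (τ : H →ₐ[k] Module.End k W)

theorem leg₁₂_eq (r : H ⊗[k] H) : leg₁₂ k r = TensorProduct.assoc k H H H (r ⊗ₜ 1) := by
  induction r with
  | zero => simp
  | add x y hx hy => simp only [map_add, hx, hy, TensorProduct.add_tmul]
  | tmul a b => simp [leg₁₂]

theorem act₃_leg₁₂ (r : H ⊗[k] H) (v : (U ⊗[k] V) ⊗[k] W) :
    act₃ ρ σ τ (leg₁₂ k r) (TensorProduct.assoc k U V W v) =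
      TensorProduct.assoc k U V W (TensorProduct.map (act₂ ρ σ r) LinearMap.id v) := by
  rw [leg₁₂_eq, ← map_act₂_assoc, map_one]
  rfl

theorem act₃_leg₂₃ (r : H ⊗[k] H) :
    act₃ ρ σ τ (leg₂₃ k r) = TensorProduct.map LinearMap.id (act₂ σ τ r) := by
  change act₃ ρ σ τ (1 ⊗ₜ r) = _
  rw [act₃_tmul, map_one]
  rfl

theorem act₃_leg₁₃_forward (r : H ⊗[k] H) (w : (U ⊗[k] V) ⊗[k] W) :
    TensorProduct.assoc k V W U (TensorProduct.comm k U (V ⊗[k] W)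
      (act₃ ρ σ τ (leg₁₃ k r) (TensorProduct.assoc k U V W w))) =
    TensorProduct.map LinearMap.id ((TensorProduct.comm k U W).toLinearMap ∘ₗ act₂ ρ τ r)
      (TensorProduct.assoc k V U W
        (TensorProduct.map (TensorProduct.comm k U V).toLinearMap LinearMap.id w)) := by
  induction r with
  | zero => simp
  | add x y hx hy =>
    simp only [map_add, LinearMap.add_apply, hx, hy, LinearMap.comp_add,
      TensorProduct.map_add_right]
  | tmul a b =>
    induction w with
    | zero => simp
    | add x y hx hy => simp only [map_add, hx, hy]
    | tmul t z =>
      induction t with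
      | zero => simp
      | add x y hx hy => simp only [map_add, hx, hy, TensorProduct.add_tmul]
      | tmul x y => simp [leg₁₃]

theorem act₃_leg₁₃_reverse (r : H ⊗[k] H) (w : U ⊗[k] (V ⊗[k] W)) :
    (TensorProduct.assoc k W U V).symm (TensorProduct.comm k (U ⊗[k] V) W
      ((TensorProduct.assoc k U V W).symm (act₃ ρ σ τ (leg₁₃ k r) w))) =
    TensorProduct.map ((TensorProduct.comm k U W).toLinearMap ∘ₗ act₂ ρ τ r) LinearMap.id
      ((TensorProduct.assoc k U W V).symm
        (TensorProduct.map LinearMap.id (TensorProduct.comm k V W).toLinearMap w)) := by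
  induction r with
  | zero => simp
  | add x y hx hy =>
    simp only [map_add, LinearMap.add_apply, hx, hy, LinearMap.comp_add,
      TensorProduct.map_add_left]
  | tmul a b =>
    induction w with
    | zero => simp
    | add x y hx hy => simp only [map_add, hx, hy]
    | tmul x t =>
      induction t with
      | zero => simp
      | add x y hx hy => simp only [map_add, hx, hy, TensorProduct.tmul_add]
      | tmul y z => simp [leg₁₃]

variable [QuasiTriangular k H]

/-- Act with the R-matrix, then swap the factors. -/
def braidMap : U ⊗[k] V →ₗ[k] V ⊗[k] U :=
  (TensorProduct.comm k U V).toLinearMap ∘ₗ act₂ ρ σ (Rmat k H)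

def braidEquiv : U ⊗[k] V ≃ₗ[k] V ⊗[k] U :=
  LinearEquiv.ofLinearMap (braidMap ρ σ)
    (act₂ ρ σ (↑(QuasiTriangular.R : (H ⊗[k] H)ˣ)⁻¹ : H ⊗[k] H) ∘ₗ
      (TensorProduct.comm k U V).symm.toLinearMap)
    (LinearMap.ext fun v => by
      simp only [braidMap, LinearMap.comp_apply, LinearEquiv.coe_coe, LinearMap.id_apply]
      rw [← Module.End.mul_apply, ← map_mul, Units.mul_inv, map_one, Module.End.one_apply,
        LinearEquiv.apply_symm_apply])
    (LinearMap.ext fun v => by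
      simp only [braidMap, LinearMap.comp_apply, LinearEquiv.coe_coe, LinearMap.id_apply,
        LinearEquiv.symm_apply_apply]
      rw [← Module.End.mul_apply, ← map_mul, Units.inv_mul, map_one, Module.End.one_apply])

theorem braidMap_tensorRep (h : H) (v : U ⊗[k] V) :
    braidMap ρ σ (tensorRep ρ σ h v) = tensorRep σ ρ h (braidMap ρ σ v) := by
  simp only [braidMap, LinearMap.comp_apply, LinearEquiv.coe_coe, tensorRep_apply]
  rw [← Module.End.mul_apply, ← map_mul, QuasiTriangular.mul_comul, map_mul, Module.End.mul_apply,
    comm_act₂]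
  congr 2
  exact LinearEquiv.symm_apply_apply (TensorProduct.comm k H H) _

theorem braidMap_hexagon_forward (v : (U ⊗[k] V) ⊗[k] W) :
    TensorProduct.assoc k V W U (braidMap ρ (tensorRep σ τ) (TensorProduct.assoc k U V W v)) =
      TensorProduct.map LinearMap.id (braidMap ρ τ)
        (TensorProduct.assoc k V U W (TensorProduct.map (braidMap ρ σ) LinearMap.id v)) := by
  have h : (TensorProduct.map (braidMap ρ σ) LinearMap.id : _ →ₗ[k] (V ⊗[k] U) ⊗[k] W) v =
      TensorProduct.map (TensorProduct.comm k U V).toLinearMap LinearMap.id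
        (TensorProduct.map (act₂ ρ σ (Rmat k H)) LinearMap.id v) := by
    rw [← LinearMap.comp_apply, ← TensorProduct.map_comp]
    rfl
  rw [h]
  refine Eq.trans ?_ (act₃_leg₁₃_forward ρ σ τ (Rmat k H) _)
  rw [← act₃_leg₁₂, ← Module.End.mul_apply, ← map_mul, ← QuasiTriangular.comul_right,
    ← act₂_tensorRep_right]
  rfl

theorem braidMap_hexagon_reverse (v : U ⊗[k] (V ⊗[k] W)) :
    (TensorProduct.assoc k W U V).symm
        (braidMap (tensorRep ρ σ) τ ((TensorProduct.assoc k U V W).symm v)) =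
      TensorProduct.map (braidMap ρ τ) LinearMap.id
        ((TensorProduct.assoc k U W V).symm (TensorProduct.map LinearMap.id (braidMap σ τ) v)) := by
  have h : (TensorProduct.map LinearMap.id (braidMap σ τ) : _ →ₗ[k] U ⊗[k] (W ⊗[k] V)) v =
      TensorProduct.map LinearMap.id (TensorProduct.comm k V W).toLinearMap
        (TensorProduct.map LinearMap.id (act₂ σ τ (Rmat k H)) v) := by
    rw [← LinearMap.comp_apply, ← TensorProduct.map_comp]
    rfl
  rw [h]
  refine Eq.trans ?_ (act₃_leg₁₃_reverse ρ σ τ (Rmat k H) _)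
  rw [← act₃_leg₂₃ ρ, ← Module.End.mul_apply, ← map_mul, ← QuasiTriangular.comul_left]
  have h2 := act₂_tensorRep_left ρ σ τ (Rmat k H) ((TensorProduct.assoc k U V W).symm v)
  rw [LinearEquiv.apply_symm_apply] at h2
  rw [← h2, LinearEquiv.symm_apply_apply]
  rfl

end Reps

variable [QuasiTriangular k H]

/-- The braiding `c_{X,Y}`: act with the R-matrix, then swap the factors. -/
def braid (X Y : FDMod k H) : X ⊗ Y ≅ Y ⊗ X :=
  isoMk (X := tensor X Y) (Y := tensor Y X) (braidEquiv X.ρ Y.ρ) fun h =>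
    LinearMap.ext fun v => braidMap_tensorRep X.ρ Y.ρ h v

theorem toLin_braid (X Y : FDMod k H) : toLin (braid X Y).hom = braidMap X.ρ Y.ρ := rfl

theorem braidMap_natural {X X' Y Y' : FDMod k H} (f : X ⟶ X') (g : Y ⟶ Y') (v : X.V ⊗[k] Y.V) :
    braidMap X'.ρ Y'.ρ (TensorProduct.map (toLin f) (toLin g) v) =
      TensorProduct.map (toLin g) (toLin f) (braidMap X.ρ Y.ρ v) := by
  have h := LinearMap.congr_fun (map_comp_act₂ X.ρ Y.ρ (Hom.comm f) (Hom.comm g) (Rmat k H)) v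
  simp only [braidMap, LinearMap.comp_apply, LinearEquiv.coe_coe] at h ⊢
  rw [TensorProduct.map_comm]
  exact congrArg _ h.symm

instance : BraidedCategory (FDMod k H) where
  braiding := braid
  braiding_naturality_right X _ _ f := toLin_injective (LinearMap.ext fun v =>
    braidMap_natural (𝟙 X) f v)
  braiding_naturality_left f Z := toLin_injective (LinearMap.ext fun v =>
    braidMap_natural f (𝟙 Z) v)
  hexagon_forward X Y Z := toLin_injective (LinearMap.ext fun v =>
    braidMap_hexagon_forward X.ρ Y.ρ Z.ρ v)
  hexagon_reverse X Y Z := toLin_injective (LinearMap.ext fun v =>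
    braidMap_hexagon_reverse X.ρ Y.ρ Z.ρ v)

end Braided

end FDMod

/-! ## The elliptic Drinfeld double -/

section Double

variable (k : Type u) {H : Type u} [Field k] [Ring H] [HopfAlgebra k H]

/-- `S⁻¹`, the inverse of the antipode in the algebra of linear endomorphisms of `H`. -/
def antipodeInv : H →ₗ[k] H :=
  Ring.inverse (HopfAlgebra.antipode k (A := H) : Module.End k H)

variable {k}

/-- The product of the dual Hopf algebra: `(f * g)(h) = f(h₁) g(h₂)`. -/
def convMul (f g : Module.Dual k H) : Module.Dual k H :=
  LinearMap.mul' k k ∘ₗ TensorProduct.map f g ∘ₗ Coalgebra.comul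

/-- `⟨f₁, a⟩ ⟨f₃, b⟩ f₂`, that is, the functional `y ↦ f(a y b)`, where `f₁ ⊗ f₂ ⊗ f₃` is the
iterated transpose of the multiplication of `H` applied to `f`. -/
def sandwich (a b : H) (f : Module.Dual k H) : Module.Dual k H :=
  f ∘ₗ LinearMap.mulLeftRight k (a, b)

/-- The iterated comultiplication `h ↦ h₁ ⊗ h₂ ⊗ h₃`. -/
def comul₂ (h : H) : H ⊗[k] (H ⊗[k] H) :=
  Coalgebra.comul.lTensor H (Coalgebra.comul (R := k) h)

namespace EllipticDouble

variable (k H) in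
/-- The tensor algebra on `H ⊕ H^* ⊕ H^*`. -/
abbrev Pre := TensorAlgebra k (H × Module.Dual k H × Module.Dual k H)

/-- The generators from `H`. -/
def gen₀ (h : H) : Pre k H := TensorAlgebra.ι k (h, 0, 0)
/-- The generators from the first copy of `H^*`. -/
def gen₁ (f : Module.Dual k H) : Pre k H := TensorAlgebra.ι k (0, f, 0)
/-- The generators from the second copy of `H^*`. -/
def gen₂ (f : Module.Dual k H) : Pre k H := TensorAlgebra.ι k (0, 0, f)

/-- The defining relations: `H` and the two copies of `H^*` (with the convolution product) map in by
algebra maps; each copy of `H^*` commutes past `H` as in the Drinfeld double,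
`f h = ⟨f₃, S⁻¹(h₁)⟩ ⟨f₁, h₃⟩ h₂ f₂`; and, with `R = ∑ s ⊗ t`, the two copies commute by
`g f = ⟨f₁, s⟩ ⟨f₃, t'⟩ ⟨g₁, t⟩ ⟨g₃, s'⟩ f₂ g₂` for `f` in the first copy and `g` in the second. -/
inductive Rel [QuasiTriangular k H] : Pre k H → Pre k H → Prop
  | one₀ : Rel (gen₀ 1) 1
  | mul₀ (a b : H) : Rel (gen₀ (a * b)) (gen₀ a * gen₀ b)
  | one₁ : Rel (gen₁ Coalgebra.counit) 1
  | mul₁ (f g : Module.Dual k H) : Rel (gen₁ (convMul f g)) (gen₁ f * gen₁ g)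
  | one₂ : Rel (gen₂ Coalgebra.counit) 1
  | mul₂ (f g : Module.Dual k H) : Rel (gen₂ (convMul f g)) (gen₂ f * gen₂ g)
  | cross₁ (f : Module.Dual k H) (h : H) (n : ℕ) (h₁ h₂ h₃ : Fin n → H)
      (hh : comul₂ (k := k) h = ∑ i, h₁ i ⊗ₜ[k] (h₂ i ⊗ₜ[k] h₃ i)) :
      Rel (gen₁ f * gen₀ h)
        (∑ i, gen₀ (h₂ i) * gen₁ (sandwich (h₃ i) (antipodeInv k (h₁ i)) f))
  | cross₂ (f : Module.Dual k H) (h : H) (n : ℕ) (h₁ h₂ h₃ : Fin n → H)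
      (hh : comul₂ (k := k) h = ∑ i, h₁ i ⊗ₜ[k] (h₂ i ⊗ₜ[k] h₃ i)) :
      Rel (gen₂ f * gen₀ h)
        (∑ i, gen₀ (h₂ i) * gen₂ (sandwich (h₃ i) (antipodeInv k (h₁ i)) f))
  | comm (f g : Module.Dual k H) (n : ℕ) (s t : Fin n → H)
      (hR : Rmat k H = ∑ i, s i ⊗ₜ[k] t i) :
      Rel (gen₂ g * gen₁ f)
        (∑ i, ∑ j, gen₁ (sandwich (s i) (t j) f) * gen₂ (sandwich (t i) (s j) g))

end EllipticDouble

variable (k H) in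
/-- The elliptic Drinfeld double of a quasi-triangular Hopf algebra. -/
def EllipticDouble [QuasiTriangular k H] : Type u := RingQuot (EllipticDouble.Rel (k := k) (H := H))

namespace EllipticDouble

variable [QuasiTriangular k H]

instance : Ring (EllipticDouble k H) := inferInstanceAs (Ring (RingQuot _))

instance : Algebra k (EllipticDouble k H) := inferInstanceAs (Algebra k (RingQuot _))

variable (k H) in
/-- The quotient map. -/
def mk : Pre k H →ₐ[k] EllipticDouble k H := RingQuot.mkAlgHom k (Rel (k := k) (H := H))

theorem mk_rel {x y : Pre k H} (h : Rel x y) : mk k H x = mk k H y :=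
  RingQuot.mkAlgHom_rel k h

variable (k H) in
/-- The map from `H`. -/
def ι₀ : H →ₐ[k] EllipticDouble k H :=
  AlgHom.ofLinearMap
    ((mk k H).toLinearMap ∘ₗ TensorAlgebra.ι k ∘ₗ
      LinearMap.inl k H (Module.Dual k H × Module.Dual k H))
    ((mk_rel Rel.one₀).trans (map_one _))
    fun a b => (mk_rel (Rel.mul₀ a b)).trans (map_mul _ _ _)

variable (k H) in
/-- The map from the first copy of `H^*`. -/
def ι₁ : Module.Dual k H →ₗ[k] EllipticDouble k H :=
  (mk k H).toLinearMap ∘ₗ TensorAlgebra.ι k ∘ₗ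
    LinearMap.inr k H (Module.Dual k H × Module.Dual k H) ∘ₗ LinearMap.inl k _ _

variable (k H) in
/-- The map from the second copy of `H^*`. -/
def ι₂ : Module.Dual k H →ₗ[k] EllipticDouble k H :=
  (mk k H).toLinearMap ∘ₗ TensorAlgebra.ι k ∘ₗ
    LinearMap.inr k H (Module.Dual k H × Module.Dual k H) ∘ₗ LinearMap.inr k _ _

variable (k H) in
/-- `h ⊗ f ⊗ g ↦ h f g`. -/
def mulMap : H ⊗[k] (Module.Dual k H ⊗[k] Module.Dual k H) →ₗ[k] EllipticDouble k H :=
  LinearMap.mul' k _ ∘ₗ TensorProduct.map (ι₀ k H).toLinearMap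
    (LinearMap.mul' k _ ∘ₗ TensorProduct.map (ι₁ k H) (ι₂ k H))

end EllipticDouble

end Double

/-! ## Actions of the dual -/

section DualAction

variable {k H : Type u} [Field k] [Ring H] [HopfAlgebra k H]

/-- `s` is an action of the algebra `H^*` on the `H`-module `X` that commutes past the action of `H`
as in the Drinfeld double, `f h = ⟨f₃, S⁻¹(h₁)⟩ ⟨f₁, h₃⟩ h₂ f₂`. -/
structure IsDoubleAction (X : FDMod k H) (s : Module.Dual k H →ₗ[k] Module.End k X.V) : Prop where
  one : s Coalgebra.counit = 1
  mul : ∀ f g : Module.Dual k H, s (convMul f g) = s f * s g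
  cross : ∀ (f : Module.Dual k H) (h : H) (n : ℕ) (h₁ h₂ h₃ : Fin n → H),
    comul₂ (k := k) h = ∑ i, h₁ i ⊗ₜ[k] (h₂ i ⊗ₜ[k] h₃ i) →
      s f * X.ρ h = ∑ i, X.ρ (h₂ i) * s (sandwich (h₃ i) (antipodeInv k (h₁ i)) f)

/-- The action of `H^*` obtained from a half-braiding: `f · x = (id ⊗ f)(λ_H (1 ⊗ x))`. -/
def dualAct [Module.Finite k H] {X : FDMod k H} (l : LeftHalfBraiding X) :
    Module.Dual k H →ₗ[k] Module.End k X.V where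
  toFun f := (TensorProduct.rid k X.V).toLinearMap ∘ₗ f.lTensor X.V ∘ₗ
    (show H ⊗[k] X.V →ₗ[k] X.V ⊗[k] H from
      FDMod.toLin (l.β (FDMod.regular k H)).hom) ∘ₗ TensorProduct.mk k H X.V 1
  map_add' f g := by rw [LinearMap.lTensor_add, LinearMap.add_comp, LinearMap.comp_add]
  map_smul' c f := by
    rw [LinearMap.lTensor_smul, LinearMap.smul_comp, LinearMap.comp_smul, RingHom.id_apply]

end DualAction

end EllipticDrinfeld

end

open EllipticDrinfeld

noncomputable section

namespace EllipticDrinfeld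

open WithConv

section Convolution

variable {k H W W' : Type*} [Field k] [Ring H] [HopfAlgebra k H] [Ring W] [Algebra k W]
  [Ring W'] [Algebra k W']

/-- The multiple `h ↦ ε(h) w` of the unit of the convolution algebra. -/
def konst (w : W) : WithConv (H →ₗ[k] W) := toConv ((Coalgebra.counit (R := k)).smulRight w)

theorem konst_mul (w : W) (F : WithConv (H →ₗ[k] W)) :
    konst w * F = toConv (LinearMap.mulLeft k w ∘ₗ F.ofConv) := by
  ext h
  rw [(Coalgebra.Repr.arbitrary k h).convMul_apply]
  conv_rhs => rw [← Coalgebra.sum_counit_smul (R := k) (Coalgebra.Repr.arbitrary k h)]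
  simp [konst]

theorem mul_konst (w : W) (F : WithConv (H →ₗ[k] W)) :
    F * konst w = toConv (LinearMap.mulRight k w ∘ₗ F.ofConv) := by
  ext h
  have := congrArg (TensorProduct.rid k W) (Coalgebra.sum_map_tmul_counit_eq (R := k)
    (repr := Coalgebra.Repr.arbitrary k h) F.ofConv)
  rw [(Coalgebra.Repr.arbitrary k h).convMul_apply]
  simp only [map_sum, TensorProduct.rid_tmul, one_smul] at this
  simp [konst, ← this]

theorem konst_mul_konst (v w : W) :
    (konst v * konst w : WithConv (H →ₗ[k] W)) = konst (v * w) := by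
  rw [konst_mul]
  ext h
  simp [konst]

theorem konst_comm {w : W} {F : H →ₗ[k] W} (h : ∀ x, Commute w (F x)) :
    konst w * toConv F = toConv F * konst w := by
  rw [konst_mul, mul_konst]
  ext x
  exact (h x)

/-- A linear map to `W` as an element of the convolution algebra of `Wᵐᵒᵖ`. -/
def opConv (F : H →ₗ[k] W) : WithConv (H →ₗ[k] Wᵐᵒᵖ) :=
  toConv ((MulOpposite.opLinearEquiv k).toLinearMap ∘ₗ F)

theorem opConv_injective : Function.Injective (opConv : (H →ₗ[k] W) → _) := fun F G h => by
  ext x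
  exact MulOpposite.op_injective (LinearMap.congr_fun (congrArg ofConv h) x)

/-- The product `α(a) β(b)` as a linear map on `a ⊗ b`. -/
def pair {U V : Type*} [AddCommGroup U] [Module k U] [AddCommGroup V] [Module k V]
    (α : U →ₗ[k] W) (β : V →ₗ[k] W) : U ⊗[k] V →ₗ[k] W :=
  LinearMap.mul' k W ∘ₗ TensorProduct.map α β

section Pair

variable {U V : Type*} [AddCommGroup U] [Module k U] [AddCommGroup V] [Module k V]

@[simp]
theorem pair_tmul (α : U →ₗ[k] W) (β : V →ₗ[k] W) (a : U) (b : V) :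
    pair α β (a ⊗ₜ b) = α a * β b := rfl

theorem algHom_pair (θ : W →ₐ[k] W') (α : U →ₗ[k] W) (β : V →ₗ[k] W) (r : U ⊗[k] V) :
    θ (pair α β r) = pair (θ.toLinearMap ∘ₗ α) (θ.toLinearMap ∘ₗ β) r := by
  induction r with
  | zero => simp
  | add x y hx hy => simp [hx, hy]
  | tmul a b => simp

theorem commute_pair {w : W} {α : U →ₗ[k] W} {β : V →ₗ[k] W} (hα : ∀ a, Commute w (α a))
    (hβ : ∀ b, Commute w (β b)) (r : U ⊗[k] V) : Commute w (pair α β r) := by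
  induction r with
  | zero => simp
  | add x y hx hy => rw [map_add]; exact hx.add_right hy
  | tmul a b => exact (hα a).mul_right (hβ b)

end Pair

theorem opConv_mul (F G : H →ₗ[k] W) : opConv F * opConv G =
    opConv (pair G F ∘ₗ (TensorProduct.comm k H H).toLinearMap ∘ₗ Coalgebra.comul) := by
  ext h
  change _ = MulOpposite.op _
  rw [(Coalgebra.Repr.arbitrary k h).convMul_apply]
  simp only [LinearMap.comp_apply, LinearEquiv.coe_coe]
  conv_rhs => rw [← (Coalgebra.Repr.arbitrary k h).eq]
  simp [opConv]

theorem opConv_mul_apply {h : H} {ι : Type*} (r : Coalgebra.Repr k h ι) (F G : H →ₗ[k] W) :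
    (opConv F * opConv G) h = MulOpposite.op (∑ i ∈ r.index, G (r.right i) * F (r.left i)) := by
  rw [r.convMul_apply]
  simp [opConv]

variable (k H W) in
/-- The counit followed by the inclusion of scalars, the unit of convolution. -/
def counitHom : H →ₐ[k] W := (Algebra.ofId k W).comp (Bialgebra.counitAlgHom k H)

end Convolution

section Antipode

variable {k H : Type*} [Field k] [Ring H] [HopfAlgebra k H]

local notation "S" => HopfAlgebra.antipode k (A := H)

theorem antipode_sq_cancel :
    opConv S * opConv (S ∘ₗ S) = (1 : WithConv (H →ₗ[k] Hᵐᵒᵖ)) := by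
  ext h
  rw [opConv_mul_apply (Coalgebra.Repr.arbitrary k h)]
  have := congrArg S (HopfAlgebra.sum_mul_antipode_eq_algebraMap_counit
    (Coalgebra.Repr.arbitrary k h))
  simp only [map_sum, HopfAlgebra.antipode_mul_antidistrib] at this
  simp only [LinearMap.comp_apply, this]
  simp [Algebra.algebraMap_eq_smul_one, HopfAlgebra.antipode_one]


end Antipode

section RMatrix

variable {k : Type u} {H : Type u} [Field k] [Ring H] [HopfAlgebra k H] [QuasiTriangular k H]
variable {W : Type*} [Ring W] [Algebra k W]

theorem pair_mul {A B : Type*} [Ring A] [Algebra k A] [Ring B] [Algebra k B]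
    {α : A →ₐ[k] W} {β : B →ₐ[k] W} (h : ∀ a b, Commute (α a) (β b)) (r r' : A ⊗[k] B) :
    pair α.toLinearMap β.toLinearMap (r * r') =
      pair α.toLinearMap β.toLinearMap r * pair α.toLinearMap β.toLinearMap r' := by
  have : pair α.toLinearMap β.toLinearMap = (Algebra.TensorProduct.lift α β h).toLinearMap :=
    TensorProduct.ext' fun _ _ => by simp
  rw [this]
  exact map_mul (Algebra.TensorProduct.lift α β h) r r'

theorem pair_one {A B : Type*} [Ring A] [Algebra k A] [Ring B] [Algebra k B]
    (α : A →ₐ[k] W) (β : B →ₐ[k] W) :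
    pair α.toLinearMap β.toLinearMap (1 : A ⊗[k] B) = 1 := by
  rw [Algebra.TensorProduct.one_def, pair_tmul]
  simp

/-- `(α * β) ⊗ γ` on the R-matrix. -/
theorem pair_conv_left {α β γ : H →ₐ[k] W} (h : ∀ a b, Commute (β a) (γ b)) :
    pair (pair α.toLinearMap β.toLinearMap ∘ₗ Coalgebra.comul) γ.toLinearMap (Rmat k H) =
      pair α.toLinearMap γ.toLinearMap (Rmat k H) *
        pair β.toLinearMap γ.toLinearMap (Rmat k H) := by
  have key := congrArg (pair α.toLinearMap (pair β.toLinearMap γ.toLinearMap))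
    (QuasiTriangular.comul_left (k := k) (H := H))
  have e1 : ∀ r : H ⊗[k] H, pair α.toLinearMap (pair β.toLinearMap γ.toLinearMap)
      (TensorProduct.assoc k H H H
        (Algebra.TensorProduct.map (Bialgebra.comulAlgHom k H) (AlgHom.id k H) r)) =
      pair (pair α.toLinearMap β.toLinearMap ∘ₗ Coalgebra.comul) γ.toLinearMap r := by
    intro r
    induction r with
    | zero => simp
    | add x y hx hy => simp only [map_add, hx, hy]
    | tmul a b =>
      simp only [Algebra.TensorProduct.map_tmul, Bialgebra.comulAlgHom_apply, AlgHom.id_apply,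
        pair_tmul, LinearMap.comp_apply]
      generalize Coalgebra.comul (R := k) a = z
      induction z with
      | zero => simp
      | add x y hx hy => simp only [TensorProduct.add_tmul, map_add, hx, hy, add_mul]
      | tmul c d => simp [mul_assoc]
  have e2 : ∀ r r' : H ⊗[k] H, pair α.toLinearMap (pair β.toLinearMap γ.toLinearMap)
      (leg₁₃ k r * leg₂₃ k r') =
      pair α.toLinearMap γ.toLinearMap r * pair β.toLinearMap γ.toLinearMap r' := by
    intro r r'
    induction r with
    | zero => simp
    | add x y hx hy => simp only [map_add, hx, hy, add_mul]
    | tmul a b =>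
      induction r' with
      | zero => simp
      | add x y hx hy => simp only [map_add, hx, hy, mul_add]
      | tmul c d =>
        simp only [leg₁₃, leg₂₃, Algebra.TensorProduct.map_tmul, AlgHom.id_apply,
          Algebra.TensorProduct.includeRight_apply, Algebra.TensorProduct.tmul_mul_tmul, mul_one,
          one_mul, pair_tmul, AlgHom.toLinearMap_apply, map_mul]
        rw [mul_assoc (α a), ← mul_assoc (β c), (h c b).eq, mul_assoc]
  rw [e1, e2] at key
  exact key

/-- `α ⊗ (β * γ)` on the R-matrix. -/
theorem pair_conv_right {α β γ : H →ₐ[k] W} (h : ∀ a b, Commute (α a) (γ b))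
    (h' : ∀ a b, Commute (β a) (γ b)) :
    pair α.toLinearMap (pair β.toLinearMap γ.toLinearMap ∘ₗ Coalgebra.comul) (Rmat k H) =
      pair α.toLinearMap γ.toLinearMap (Rmat k H) *
        pair α.toLinearMap β.toLinearMap (Rmat k H) := by
  have key := congrArg (pair α.toLinearMap (pair β.toLinearMap γ.toLinearMap))
    (QuasiTriangular.comul_right (k := k) (H := H))
  have e1 : ∀ r : H ⊗[k] H, pair α.toLinearMap (pair β.toLinearMap γ.toLinearMap)
      (Algebra.TensorProduct.map (AlgHom.id k H) (Bialgebra.comulAlgHom k H) r) =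
      pair α.toLinearMap (pair β.toLinearMap γ.toLinearMap ∘ₗ Coalgebra.comul) r := by
    intro r
    induction r with
    | zero => simp
    | add x y hx hy => simp only [map_add, hx, hy]
    | tmul a b => simp
  have e2 : ∀ r r' : H ⊗[k] H, pair α.toLinearMap (pair β.toLinearMap γ.toLinearMap)
      (leg₁₃ k r * leg₁₂ k r') =
      pair α.toLinearMap γ.toLinearMap r * pair α.toLinearMap β.toLinearMap r' := by
    intro r r'
    induction r with
    | zero => simp
    | add x y hx hy => simp only [map_add, hx, hy, add_mul]
    | tmul a b =>
      induction r' with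
      | zero => simp
      | add x y hx hy => simp only [map_add, hx, hy, mul_add]
      | tmul c d =>
        simp only [leg₁₃, leg₁₂, Algebra.TensorProduct.map_tmul, AlgHom.id_apply,
          Algebra.TensorProduct.includeRight_apply, Algebra.TensorProduct.includeLeft_apply,
          Algebra.TensorProduct.tmul_mul_tmul, mul_one,
          one_mul, pair_tmul, AlgHom.toLinearMap_apply, map_mul]
        rw [mul_assoc, mul_assoc, (h' d b).eq, ← mul_assoc (α c), (h c b).eq, mul_assoc]
  rw [e1, e2] at key
  exact key

/-- The R-matrix stays invertible under a pair of commuting algebra maps. -/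
theorem pair_mul_inv {α β : H →ₐ[k] W} (h : ∀ a b, Commute (α a) (β b)) :
    pair α.toLinearMap β.toLinearMap (Rmat k H) *
      pair α.toLinearMap β.toLinearMap (↑(QuasiTriangular.R : (H ⊗[k] H)ˣ)⁻¹ : H ⊗[k] H) = 1 := by
  rw [← pair_mul h, Units.mul_inv, pair_one]

theorem pair_inv_mul {α β : H →ₐ[k] W} (h : ∀ a b, Commute (α a) (β b)) :
    pair α.toLinearMap β.toLinearMap (↑(QuasiTriangular.R : (H ⊗[k] H)ˣ)⁻¹ : H ⊗[k] H) *
      pair α.toLinearMap β.toLinearMap (Rmat k H) = 1 := by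
  rw [← pair_mul h, Units.inv_mul, pair_one]

theorem pair_counit_left (γ : H →ₐ[k] W) :
    pair (counitHom k H W).toLinearMap γ.toLinearMap (Rmat k H) = 1 := by
  have h : ∀ a b, Commute (counitHom k H W a) (γ b) := fun a b => Algebra.commutes _ _
  have key := pair_conv_left (α := counitHom k H W) h
  have e : (pair (counitHom k H W).toLinearMap (counitHom k H W).toLinearMap ∘ₗ
      Coalgebra.comul : H →ₗ[k] W) = (counitHom k H W).toLinearMap :=
    congrArg ofConv (one_mul (1 : WithConv (H →ₗ[k] W)))
  rw [e] at key
  have := congrArg (pair (counitHom k H W).toLinearMap γ.toLinearMap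
    (↑(QuasiTriangular.R : (H ⊗[k] H)ˣ)⁻¹ : H ⊗[k] H) * ·) key
  simpa only [← mul_assoc, pair_inv_mul h, one_mul] using this.symm

theorem pair_counit_right (γ : H →ₐ[k] W) :
    pair γ.toLinearMap (counitHom k H W).toLinearMap (Rmat k H) = 1 := by
  have h : ∀ a b, Commute (γ a) (counitHom k H W b) := fun a b => (Algebra.commutes _ _).symm
  have key := pair_conv_right (β := counitHom k H W) h (fun a b => Algebra.commutes _ _)
  have e : (pair (counitHom k H W).toLinearMap (counitHom k H W).toLinearMap ∘ₗ
      Coalgebra.comul : H →ₗ[k] W) = (counitHom k H W).toLinearMap :=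
    congrArg ofConv (one_mul (1 : WithConv (H →ₗ[k] W)))
  rw [e] at key
  have := congrArg (pair γ.toLinearMap (counitHom k H W).toLinearMap
    (↑(QuasiTriangular.R : (H ⊗[k] H)ˣ)⁻¹ : H ⊗[k] H) * ·) key
  simpa only [← mul_assoc, pair_inv_mul h, one_mul] using this.symm

/-- `R Δ(h) = Δᵒᵖ(h) R` under a pair of commuting algebra maps. -/
theorem pair_Rmat_comul {α β : H →ₐ[k] W} (h : ∀ a b, Commute (α a) (β b)) (x : H) :
    pair α.toLinearMap β.toLinearMap (Rmat k H) *
        pair α.toLinearMap β.toLinearMap (Coalgebra.comul (R := k) x) =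
      pair β.toLinearMap α.toLinearMap (Coalgebra.comul (R := k) x) *
        pair α.toLinearMap β.toLinearMap (Rmat k H) := by
  rw [← pair_mul h, QuasiTriangular.mul_comul, pair_mul h]
  congr 1
  generalize Coalgebra.comul (R := k) x = z
  induction z with
  | zero => simp
  | add x y hx hy => simp only [map_add, hx, hy]
  | tmul c d => exact h d c

end RMatrix

section AntipodeBijective

variable {k : Type u} {H : Type u} [Field k] [Ring H] [HopfAlgebra k H]

local notation "S" => HopfAlgebra.antipode k (A := H)

theorem pair_antipode_mul_tmul (r : H ⊗[k] H) (a b : H) :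
    pair S LinearMap.id (TensorProduct.comm k H H (r * a ⊗ₜ b)) =
      S b * pair S LinearMap.id (TensorProduct.comm k H H r) * a := by
  induction r with
  | zero => simp
  | add x y hx hy => simp only [add_mul, mul_add, map_add, hx, hy]
  | tmul c d => simp [HopfAlgebra.antipode_mul_antidistrib, mul_assoc]

theorem pair_antipode_comul_mul (r : H ⊗[k] H) (h : H) :
    pair S LinearMap.id (TensorProduct.comm k H H
        (TensorProduct.comm k H H (Coalgebra.comul (R := k) h) * r)) =
      Coalgebra.counit (R := k) h • pair S LinearMap.id (TensorProduct.comm k H H r) := by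
  induction r with
  | zero => simp
  | add x y hx hy => simp only [mul_add, map_add, hx, hy, smul_add]
  | tmul s t =>
    have e : ∀ z : H ⊗[k] H, pair S LinearMap.id (TensorProduct.comm k H H
        (TensorProduct.comm k H H z * s ⊗ₜ t)) = S t * pair S LinearMap.id z * s := by
      intro z
      induction z with
      | zero => simp
      | add x y hx hy => simp only [mul_add, add_mul, map_add, hx, hy]
      | tmul c d => simp [HopfAlgebra.antipode_mul_antidistrib, mul_assoc]
    have e' : pair S LinearMap.id (Coalgebra.comul (R := k) h) =
        algebraMap k H (Coalgebra.counit (R := k) h) :=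
      HopfAlgebra.mul_antipode_rTensor_comul_apply h
    rw [e, e', Algebra.algebraMap_eq_smul_one]
    simp

variable [QuasiTriangular k H]

variable (k H) in
/-- The Drinfeld element `∑ S(t) s` for `R = ∑ s ⊗ t`. -/
def drinfeldElement : H :=
  pair S LinearMap.id (TensorProduct.comm k H H (Rmat k H))

theorem antipode_mul_drinfeldElement_mul :
    (opConv (LinearMap.id : H →ₗ[k] H) * konst (MulOpposite.op (drinfeldElement k H)) * opConv S :
      WithConv (H →ₗ[k] Hᵐᵒᵖ)) = konst (MulOpposite.op (drinfeldElement k H)) := by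
  ext h
  have e : (opConv (LinearMap.id : H →ₗ[k] H) * konst (MulOpposite.op (drinfeldElement k H)) :
      WithConv (H →ₗ[k] Hᵐᵒᵖ)) = opConv (LinearMap.mulLeft k (drinfeldElement k H)) := by
    rw [mul_konst]
    rfl
  rw [e, opConv_mul_apply (Coalgebra.Repr.arbitrary k h)]
  have := pair_antipode_comul_mul (Rmat k H) h
  rw [← QuasiTriangular.mul_comul, ← (Coalgebra.Repr.arbitrary k h).eq, Finset.mul_sum] at this
  simp only [map_sum, pair_antipode_mul_tmul] at this
  simp only [LinearMap.mulLeft_apply, ← mul_assoc]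
  exact congrArg MulOpposite.op this

theorem drinfeldElement_mul (h : H) :
    drinfeldElement k H * h = S (S h) * drinfeldElement k H := by
  have := congrArg (· * opConv (S ∘ₗ S)) (antipode_mul_drinfeldElement_mul (k := k) (H := H))
  simp only [mul_assoc, antipode_sq_cancel, mul_one] at this
  rw [mul_konst, konst_mul] at this
  exact congrArg MulOpposite.unop (LinearMap.congr_fun (congrArg ofConv this) h)

theorem exists_mul_drinfeldElement : ∃ v : H, v * drinfeldElement k H = 1 := by
  let Ξ : H ⊗[k] (H ⊗[k] H) →ₗ[k] H := pair (LinearMap.mul' k H ∘ₗ (S).lTensor H) LinearMap.id ∘ₗ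
    (TensorProduct.comm k H (H ⊗[k] H)).toLinearMap
  have e1 : ∀ r : H ⊗[k] H,
      Ξ (Algebra.TensorProduct.map (AlgHom.id k H) (Bialgebra.comulAlgHom k H) r) =
      pair (AlgHom.id k H).toLinearMap (counitHom k H H).toLinearMap r := by
    intro r
    induction r with
    | zero => simp
    | add x y hx hy => simp only [map_add, hx, hy]
    | tmul a b =>
      simp only [Ξ, LinearMap.comp_apply, LinearEquiv.coe_coe, Algebra.TensorProduct.map_tmul,
        TensorProduct.comm_tmul, pair_tmul, Bialgebra.comulAlgHom_apply,
        HopfAlgebra.mul_antipode_lTensor_comul_apply]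
      exact Algebra.commutes _ _
  have e2 : ∀ r r' : H ⊗[k] H, Ξ (leg₁₃ k r * leg₁₂ k r') =
      pair LinearMap.id (LinearMap.mulLeft k (pair S LinearMap.id (TensorProduct.comm k H H r)))
        (TensorProduct.comm k H H r') := by
    intro r r'
    induction r' with
    | zero => simp
    | add x y hx hy => simp only [map_add, hx, hy, mul_add]
    | tmul c d =>
      induction r with
      | zero => simp
      | add x y hx hy =>
        simp only [map_add, add_mul, hx, hy, TensorProduct.comm_tmul, pair_tmul,
          LinearMap.mulLeft_apply, mul_add]
      | tmul a b => simp [Ξ, leg₁₂, leg₁₃, mul_assoc]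
  have key := congrArg Ξ (QuasiTriangular.comul_right (k := k) (H := H))
  rw [e1, pair_counit_right, e2] at key
  refine ⟨pair LinearMap.id (S ∘ₗ S) (TensorProduct.comm k H H (Rmat k H)), ?_⟩
  rw [key]
  suffices h : ∀ r : H ⊗[k] H,
      pair LinearMap.id (S ∘ₗ S) (TensorProduct.comm k H H r) * drinfeldElement k H =
        pair LinearMap.id (LinearMap.mulLeft k (drinfeldElement k H)) (TensorProduct.comm k H H r)
    from h _
  intro r
  induction r with
  | zero => simp
  | add x y hx hy => simp only [map_add, add_mul, hx, hy]
  | tmul c d => simp [mul_assoc, drinfeldElement_mul (k := k)]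

theorem antipode_injective : Function.Injective S := by
  rw [injective_iff_map_eq_zero]
  intro h hh
  obtain ⟨v, hv⟩ := exists_mul_drinfeldElement (k := k) (H := H)
  have := drinfeldElement_mul (k := k) h
  rw [hh, map_zero, zero_mul] at this
  rw [← one_mul h, ← hv, mul_assoc, this, mul_zero]

variable [Module.Finite k H]

theorem antipode_antipodeInv (h : H) : S (antipodeInv k h) = h := by
  have : IsUnit (S : Module.End k H) := (Module.End.isUnit_iff _).2
    ⟨antipode_injective, LinearMap.injective_iff_surjective.1 antipode_injective⟩
  exact LinearMap.congr_fun (Ring.mul_inverse_cancel _ this) h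

theorem antipodeInv_mul (a b : H) :
    antipodeInv k (a * b) = antipodeInv k b * antipodeInv k a := by
  apply antipode_injective (k := k)
  rw [HopfAlgebra.antipode_mul_antidistrib]
  simp only [antipode_antipodeInv]

theorem antipodeInv_one : antipodeInv k (1 : H) = 1 := by
  apply antipode_injective (k := k)
  rw [antipode_antipodeInv, HopfAlgebra.antipode_one]

theorem counit_antipodeInv (h : H) :
    Coalgebra.counit (R := k) (antipodeInv k h) = Coalgebra.counit (R := k) h := by
  rw [← HopfAlgebra.counit_antipode (R := k) (antipodeInv k h), antipode_antipodeInv]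

/-- `h₂ S⁻¹(h₁) = ε(h)` -/
theorem opConv_antipodeInv_mul_id :
    opConv (antipodeInv k) * opConv LinearMap.id = (1 : WithConv (H →ₗ[k] Hᵐᵒᵖ)) := by
  ext h
  rw [opConv_mul_apply (Coalgebra.Repr.arbitrary k h)]
  refine congrArg MulOpposite.op (antipode_injective (k := k) ?_)
  have := HopfAlgebra.sum_mul_antipode_eq_algebraMap_counit (Coalgebra.Repr.arbitrary k h)
  simp only [map_sum, HopfAlgebra.antipode_mul_antidistrib, antipode_antipodeInv,
    LinearMap.id_apply]
  refine this.trans ?_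
  simp [Algebra.algebraMap_eq_smul_one, HopfAlgebra.antipode_one]

/-- `S⁻¹(h₂) h₁ = ε(h)` -/
theorem opConv_id_mul_antipodeInv :
    opConv LinearMap.id * opConv (antipodeInv k) = (1 : WithConv (H →ₗ[k] Hᵐᵒᵖ)) := by
  ext h
  rw [opConv_mul_apply (Coalgebra.Repr.arbitrary k h)]
  refine congrArg MulOpposite.op (antipode_injective (k := k) ?_)
  have := HopfAlgebra.sum_antipode_mul_eq_algebraMap_counit (Coalgebra.Repr.arbitrary k h)
  simp only [map_sum, HopfAlgebra.antipode_mul_antidistrib, antipode_antipodeInv,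
    LinearMap.id_apply]
  refine this.trans ?_
  simp [Algebra.algebraMap_eq_smul_one, HopfAlgebra.antipode_one]

end AntipodeBijective

end EllipticDrinfeld

end

noncomputable section

namespace EllipticDrinfeld

open WithConv

section Contract

variable {k E E' V V' : Type*} [Field k] [AddCommGroup E] [Module k E] [AddCommGroup E']
  [Module k E'] [AddCommGroup V] [Module k V] [AddCommGroup V'] [Module k V']

/-- The map `e ⊗ v ↦ f(v) e`. -/
def contract (f : Module.Dual k V) : E ⊗[k] V →ₗ[k] E :=
  (TensorProduct.rid k E).toLinearMap ∘ₗ f.lTensor E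

@[simp]
theorem contract_tmul (f : Module.Dual k V) (e : E) (v : V) : contract f (e ⊗ₜ[k] v) = f v • e := by
  simp [contract]

theorem sum_contract_tmul {ι : Type*} [Fintype ι] (b : Module.Basis ι k V) (z : E ⊗[k] V) :
    ∑ i, contract (b.coord i) z ⊗ₜ[k] b i = z := by
  induction z with
  | zero => simp
  | add x y hx hy => simp only [map_add, TensorProduct.add_tmul, Finset.sum_add_distrib, hx, hy]
  | tmul e v =>
    simp only [contract_tmul, TensorProduct.smul_tmul, ← TensorProduct.tmul_sum]
    congr 1
    exact b.sum_repr v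

theorem contract_ext_basis {ι : Type*} [Fintype ι] (b : Module.Basis ι k V) {z w : E ⊗[k] V}
    (h : ∀ i, contract (b.coord i) z = contract (b.coord i) w) : z = w := by
  rw [← sum_contract_tmul b z, ← sum_contract_tmul b w]
  simp only [h]

theorem contract_ext [Module.Finite k V] {z w : E ⊗[k] V}
    (h : ∀ f : Module.Dual k V, contract f z = contract f w) : z = w :=
  contract_ext_basis (Module.finBasis k V) fun _ => h _

theorem contract_pair_ext [Module.Finite k V] [Module.Finite k V'] {z w : E ⊗[k] (V ⊗[k] V')}
    (h : ∀ (f : Module.Dual k V) (g : Module.Dual k V'),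
      contract (pair f g) z = contract (pair f g) w) : z = w := by
  let b := Module.finBasis k V
  let b' := Module.finBasis k V'
  refine contract_ext_basis (b.tensorProduct b') fun ij => ?_
  have : (b.tensorProduct b').coord ij = pair (b.coord ij.1) (b'.coord ij.2) :=
    TensorProduct.ext' fun x y => by
      rw [Module.Basis.coord_apply, Module.Basis.tensorProduct_repr_tmul_apply]
      simp [mul_comm]
  rw [this]
  exact h _ _

/-- An element of `E ⊗ V` as a linear map from the dual of `V` to `E`. -/
def contractMap (z : E ⊗[k] V) : Module.Dual k V →ₗ[k] E where
  toFun f := contract f z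
  map_add' f g := by simp [contract, LinearMap.lTensor_add]
  map_smul' c f := by simp [contract, LinearMap.lTensor_smul]

@[simp]
theorem contractMap_apply (z : E ⊗[k] V) (f : Module.Dual k V) :
    contractMap z f = contract f z := rfl

/-- The element of `E ⊗ V` attached to a linear map from the dual of `V` to `E`. -/
def ofDual [Module.Finite k V] (s : Module.Dual k V →ₗ[k] E) : E ⊗[k] V :=
  ∑ i, s ((Module.finBasis k V).coord i) ⊗ₜ[k] Module.finBasis k V i

theorem contractMap_ofDual [Module.Finite k V] (s : Module.Dual k V →ₗ[k] E) :
    contractMap (ofDual s) = s := by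
  ext f
  refine Eq.trans ?_ (congrArg s ((Module.finBasis k V).sum_dual_apply_smul_coord f))
  rw [contractMap_apply, ofDual, map_sum, map_sum]
  simp only [contract_tmul, map_smul]

theorem contract_ofDual [Module.Finite k V] (s : Module.Dual k V →ₗ[k] E) (f : Module.Dual k V) :
    contract f (ofDual s) = s f := LinearMap.congr_fun (contractMap_ofDual s) f

theorem contract_lTensor (f : Module.Dual k V') (φ : V →ₗ[k] V') (z : E ⊗[k] V) :
    contract f (φ.lTensor E z) = contract (f ∘ₗ φ) z := by
  induction z with
  | zero => simp
  | add x y hx hy => simp only [map_add, hx, hy]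
  | tmul e v => simp

theorem map_contract (θ : E →ₗ[k] E') (f : Module.Dual k V) (z : E ⊗[k] V) :
    θ (contract f z) = contract f (θ.rTensor V z) := by
  induction z with
  | zero => simp
  | add x y hx hy => simp only [map_add, hx, hy]
  | tmul e v => simp

end Contract

section Legs

variable (k H : Type u) (E : Type*) [Field k] [Ring E] [Algebra k E] [Ring H] [HopfAlgebra k H]

/-- `e ⊗ a ↦ e ⊗ a ⊗ 1` -/
def inLeg₁ : E ⊗[k] H →ₐ[k] E ⊗[k] (H ⊗[k] H) :=
  Algebra.TensorProduct.map (AlgHom.id k E) Algebra.TensorProduct.includeLeft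

/-- `e ⊗ b ↦ e ⊗ 1 ⊗ b` -/
def inLeg₂ : E ⊗[k] H →ₐ[k] E ⊗[k] (H ⊗[k] H) :=
  Algebra.TensorProduct.map (AlgHom.id k E) Algebra.TensorProduct.includeRight

/-- `e ⊗ a ↦ e ⊗ Δ(a)` -/
def comulLeg : E ⊗[k] H →ₐ[k] E ⊗[k] (H ⊗[k] H) :=
  Algebra.TensorProduct.map (AlgHom.id k E) (Bialgebra.comulAlgHom k H)

/-- `a ⊗ b ↦ 1 ⊗ a ⊗ b` -/
def inLegs : H ⊗[k] H →ₐ[k] E ⊗[k] (H ⊗[k] H) := Algebra.TensorProduct.includeRight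

/-- The inclusion of `E` in `E ⊗ H`. -/
def inl : E →ₐ[k] E ⊗[k] H := Algebra.TensorProduct.includeLeft

/-- The inclusion of `H` in `E ⊗ H`. -/
def inr : H →ₐ[k] E ⊗[k] H := Algebra.TensorProduct.includeRight

variable {k H E}

@[simp]
theorem inl_apply (e : E) : inl k H E e = e ⊗ₜ 1 := rfl

@[simp]
theorem inr_apply (a : H) : inr k H E a = 1 ⊗ₜ a := rfl

@[simp]
theorem inLegs_apply (r : H ⊗[k] H) : inLegs k H E r = 1 ⊗ₜ r := rfl

@[simp]
theorem inLeg₁_tmul (e : E) (a : H) : inLeg₁ k H E (e ⊗ₜ a) = e ⊗ₜ (a ⊗ₜ 1) := by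
  simp [inLeg₁]

@[simp]
theorem inLeg₂_tmul (e : E) (a : H) : inLeg₂ k H E (e ⊗ₜ a) = e ⊗ₜ (1 ⊗ₜ a) := by
  simp [inLeg₂]

@[simp]
theorem comulLeg_tmul (e : E) (a : H) :
    comulLeg k H E (e ⊗ₜ a) = e ⊗ₜ Coalgebra.comul (R := k) a := by
  simp [comulLeg]

theorem commute_inl_inr (e : E) (a : H) : Commute (inl k H E e) (inr k H E a) := by
  simp [Commute, SemiconjBy]

theorem contract_comulLeg (f g : Module.Dual k H) (L : E ⊗[k] H) :
    contract (pair f g) (comulLeg k H E L) = contract (convMul f g) L :=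
  contract_lTensor (pair f g) Coalgebra.comul L

theorem contract_inLeg₁_mul_inLeg₂ (f g : Module.Dual k H) (L M : E ⊗[k] H) :
    contract (pair f g) (inLeg₁ k H E L * inLeg₂ k H E M) = contract f L * contract g M := by
  induction L with
  | zero => simp
  | add x y hx hy => simp only [map_add, add_mul, hx, hy]
  | tmul a b =>
    induction M with
    | zero => simp
    | add x y hx hy => simp only [map_add, mul_add, hx, hy]
    | tmul c d => simp [smul_smul, mul_comm]

theorem contract_inLeg₂_mul_inLeg₁ (f g : Module.Dual k H) (L M : E ⊗[k] H) :
    contract (pair f g) (inLeg₂ k H E M * inLeg₁ k H E L) = contract g M * contract f L := by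
  induction L with
  | zero => simp
  | add x y hx hy => simp only [map_add, mul_add, hx, hy]
  | tmul a b =>
    induction M with
    | zero => simp
    | add x y hx hy => simp only [map_add, add_mul, hx, hy]
    | tmul c d => simp [smul_smul]

theorem contract_sandwich (f : Module.Dual k H) (e : E) (a b : H) (L : E ⊗[k] H) :
    contract f (inl k H E e * inr k H E a * L * inr k H E b) =
      e * contract (sandwich a b f) L := by
  induction L with
  | zero => simp
  | add x y hx hy => simp only [map_add, mul_add, add_mul, hx, hy]
  | tmul c d => simp [sandwich]

theorem contract_mul_inl (f : Module.Dual k H) (e : E) (L : E ⊗[k] H) :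
    contract f (L * inl k H E e) = contract f L * e := by
  induction L with
  | zero => simp
  | add x y hx hy => simp only [map_add, add_mul, hx, hy]
  | tmul c d => simp

theorem contract_sandwich₂ (f g : Module.Dual k H) (s t s' t' : H) (L M : E ⊗[k] H) :
    contract (pair f g) (inLegs k H E (s ⊗ₜ t) * inLeg₁ k H E L * inLeg₂ k H E M *
      inLegs k H E (t' ⊗ₜ s')) =
      contract (sandwich s t' f) L * contract (sandwich t s' g) M := by
  induction L with
  | zero => simp
  | add x y hx hy => simp only [map_add, add_mul, mul_add, hx, hy]
  | tmul a b =>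
    induction M with
    | zero => simp
    | add x y hx hy => simp only [map_add, add_mul, mul_add, hx, hy]
    | tmul c d => simp [sandwich, smul_smul, mul_comm]

end Legs

section YetterDrinfeld

variable {k H : Type u} {E W W' : Type*} [Field k] [Ring H] [HopfAlgebra k H] [Ring E] [Algebra k E]
  [Ring W] [Algebra k W] [Ring W'] [Algebra k W']

/-- The cross relation `ρ(h₁) x(h₂) L = L x(h₁) ρ(h₂)`. -/
def Crosses (ρ x : H →ₗ[k] W) (L : W) : Prop :=
  toConv ρ * toConv x * konst L = konst L * (toConv x * toConv ρ)

theorem crosses_iff {ρ x : H →ₗ[k] W} {L : W} : Crosses ρ x L ↔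
    ∀ h, pair ρ x (Coalgebra.comul (R := k) h) * L = L * pair x ρ (Coalgebra.comul (R := k) h) := by
  rw [Crosses, konst_mul, mul_konst, WithConv.ext_iff, LinearMap.ext_iff]
  rfl

theorem Crosses.map {ρ x : H →ₗ[k] W} {L : W} (h : Crosses ρ x L) (θ : W →ₐ[k] W') :
    Crosses (θ.toLinearMap ∘ₗ ρ) (θ.toLinearMap ∘ₗ x) (θ L) := by
  rw [crosses_iff] at h ⊢
  intro a
  simpa [algHom_pair] using congrArg θ (h a)

/-- The compatibility of `L ∈ E ⊗ H` with an algebra map `ρ : H → E` which makes the contraction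
with `L` an action of `H^*` that commutes past the action of `H` as in the Drinfeld double. -/
structure IsYD (ρ : H →ₐ[k] E) (L : E ⊗[k] H) : Prop where
  one : contract Coalgebra.counit L = 1
  mul : comulLeg k H E L = inLeg₁ k H E L * inLeg₂ k H E L
  cross : Crosses ((inl k H E).toLinearMap ∘ₗ ρ.toLinearMap) (inr k H E).toLinearMap L

/-- `s` is an algebra map from `H^*` to `E` that commutes past `ρ : H → E` as in the Drinfeld
double. -/
structure IsDoubleHom (ρ : H →ₐ[k] E) (s : Module.Dual k H →ₗ[k] E) : Prop where
  one : s Coalgebra.counit = 1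
  mul : ∀ f g : Module.Dual k H, s (convMul f g) = s f * s g
  cross : ∀ (f : Module.Dual k H) (h : H) (n : ℕ) (h₁ h₂ h₃ : Fin n → H),
    comul₂ (k := k) h = ∑ i, h₁ i ⊗ₜ[k] (h₂ i ⊗ₜ[k] h₃ i) →
      s f * ρ h = ∑ i, ρ (h₂ i) * s (sandwich (h₃ i) (antipodeInv k (h₁ i)) f)

theorem exists_sum_tmul_tmul_eq {U V V' : Type*} [AddCommGroup U] [Module k U] [AddCommGroup V]
    [Module k V] [AddCommGroup V'] [Module k V'] (z : U ⊗[k] (V ⊗[k] V')) :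
    ∃ (n : ℕ) (a : Fin n → U) (b : Fin n → V) (c : Fin n → V'),
      z = ∑ i, a i ⊗ₜ[k] (b i ⊗ₜ[k] c i) := by
  induction z with
  | zero => exact ⟨0, isEmptyElim, isEmptyElim, isEmptyElim, by simp⟩
  | tmul x y =>
    obtain ⟨n, b, c, rfl⟩ := TensorProduct.exists_sum_tmul_eq y
    exact ⟨n, fun _ => x, b, c, TensorProduct.tmul_sum _ _ _⟩
  | add x y hx hy =>
    obtain ⟨n, a, b, c, rfl⟩ := hx
    obtain ⟨m, a', b', c', rfl⟩ := hy
    refine ⟨n + m, Fin.addCases a a', Fin.addCases b b', Fin.addCases c c', ?_⟩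
    simp [Fin.sum_univ_add]

end YetterDrinfeld

section Correspondence

variable {k H : Type u} {E : Type*} [Field k] [Ring H] [HopfAlgebra k H] [Ring E] [Algebra k E]

/-- The linear map `a ⊗ b ⊗ c ↦ ρ(b) c L S⁻¹(a)`. -/
def crossMap (ρ : H →ₐ[k] E) (L : E ⊗[k] H) : H ⊗[k] (H ⊗[k] H) →ₗ[k] E ⊗[k] H :=
  pair (LinearMap.mulRight k L ∘ₗ
      pair ((inl k H E).toLinearMap ∘ₗ ρ.toLinearMap) (inr k H E).toLinearMap)
    ((inr k H E).toLinearMap ∘ₗ antipodeInv k) ∘ₗ (TensorProduct.comm k H (H ⊗[k] H)).toLinearMap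

theorem crossMap_tmul (ρ : H →ₐ[k] E) (L : E ⊗[k] H) (a b c : H) :
    crossMap ρ L (a ⊗ₜ (b ⊗ₜ c)) =
      inl k H E (ρ b) * inr k H E c * L * inr k H E (antipodeInv k a) := rfl

theorem opConv_algHom {W : Type*} [Ring W] [Algebra k W] (x : H →ₐ[k] W) {f g : H →ₗ[k] H}
    (h : opConv f * opConv g = 1) :
    opConv (x.toLinearMap ∘ₗ f) * opConv (x.toLinearMap ∘ₗ g) = 1 := by
  ext a
  have h1 := LinearMap.congr_fun (congrArg ofConv h) a
  rw [opConv_mul_apply (Coalgebra.Repr.arbitrary k a)] at h1 ⊢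
  have h2 := congrArg x (congrArg MulOpposite.unop h1)
  simp only [MulOpposite.unop_op, map_sum, map_mul] at h2
  exact congrArg MulOpposite.op (h2.trans (AlgHomClass.commutes x _))

variable [QuasiTriangular k H] [Module.Finite k H]

theorem opConv_antipodeInv_mul_map {W : Type*} [Ring W] [Algebra k W] (x : H →ₐ[k] W) :
    opConv (x.toLinearMap ∘ₗ antipodeInv k) * opConv x.toLinearMap = 1 := by
  have := opConv_algHom x (opConv_antipodeInv_mul_id (k := k) (H := H))
  rwa [LinearMap.comp_id] at this

theorem opConv_map_mul_antipodeInv {W : Type*} [Ring W] [Algebra k W] (x : H →ₐ[k] W) :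
    opConv x.toLinearMap * opConv (x.toLinearMap ∘ₗ antipodeInv k) = 1 := by
  have := opConv_algHom x (opConv_id_mul_antipodeInv (k := k) (H := H))
  rwa [LinearMap.comp_id] at this

theorem crosses_iff_crossMap (ρ : H →ₐ[k] E) (L : E ⊗[k] H) :
    Crosses ((inl k H E).toLinearMap ∘ₗ ρ.toLinearMap) (inr k H E).toLinearMap L ↔
      ∀ h, L * inl k H E (ρ h) = crossMap ρ L (comul₂ (k := k) h) := by
  set x := inr k H E
  set F : H →ₗ[k] E ⊗[k] H := LinearMap.mulRight k L ∘ₗ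
    pair ((inl k H E).toLinearMap ∘ₗ ρ.toLinearMap) x.toLinearMap ∘ₗ Coalgebra.comul with hF
  set G : H →ₗ[k] E ⊗[k] H := LinearMap.mulLeft k L ∘ₗ (inl k H E).toLinearMap ∘ₗ ρ.toLinearMap
    with hG
  have h1 : Crosses ((inl k H E).toLinearMap ∘ₗ ρ.toLinearMap) x.toLinearMap L ↔
      opConv F = opConv x.toLinearMap * opConv G := by
    rw [crosses_iff, opConv_mul, opConv_injective.eq_iff, LinearMap.ext_iff]
    refine forall_congr' fun h => Eq.congr rfl ?_
    simp only [LinearMap.comp_apply, LinearEquiv.coe_coe]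
    generalize Coalgebra.comul (R := k) h = z
    induction z with
    | zero => simp
    | add x y hx hy => simp only [map_add, mul_add, hx, hy]
    | tmul a b =>
      simp only [pair_tmul, TensorProduct.comm_tmul, hG, LinearMap.comp_apply,
        LinearMap.mulLeft_apply, AlgHom.toLinearMap_apply, mul_assoc]
      rw [(commute_inl_inr (ρ b) a).eq]
  have h2 : (∀ h, L * inl k H E (ρ h) = crossMap ρ L (comul₂ (k := k) h)) ↔
      opConv G = opConv (x.toLinearMap ∘ₗ antipodeInv k) * opConv F := by
    rw [opConv_mul, opConv_injective.eq_iff, LinearMap.ext_iff]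
    refine forall_congr' fun h => Eq.congr rfl ?_
    simp only [LinearMap.comp_apply, LinearEquiv.coe_coe, comul₂]
    generalize Coalgebra.comul (R := k) h = z
    induction z with
    | zero => simp
    | add x y hx hy => simp only [map_add, hx, hy]
    | tmul a b => rfl
  rw [h1, h2]
  constructor
  · intro h
    rw [h, ← mul_assoc, opConv_antipodeInv_mul_map, one_mul]
  · intro h
    rw [h, ← mul_assoc, opConv_map_mul_antipodeInv, one_mul]

theorem isDoubleHom_contractMap (ρ : H →ₐ[k] E) (L : E ⊗[k] H) :
    IsDoubleHom ρ (contractMap L) ↔ IsYD ρ L := by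
  have hc : ∀ (f : Module.Dual k H) (n : ℕ) (h₁ h₂ h₃ : Fin n → H),
      contract f (crossMap ρ L (∑ i, h₁ i ⊗ₜ[k] (h₂ i ⊗ₜ[k] h₃ i))) =
        ∑ i, ρ (h₂ i) * contractMap L (sandwich (h₃ i) (antipodeInv k (h₁ i)) f) := by
    intro f n h₁ h₂ h₃
    simp only [map_sum, crossMap_tmul, contract_sandwich, contractMap_apply]
  constructor
  · rintro ⟨h1, h2, h3⟩
    refine ⟨h1, contract_pair_ext fun f g => ?_, ?_⟩
    · rw [contract_comulLeg, contract_inLeg₁_mul_inLeg₂]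
      exact h2 f g
    · rw [crosses_iff_crossMap]
      intro h
      refine contract_ext fun f => ?_
      obtain ⟨n, a, b, c, e⟩ := exists_sum_tmul_tmul_eq (comul₂ (k := k) h)
      rw [e, hc, contract_mul_inl]
      exact h3 f h n a b c e
  · rintro ⟨h1, h2, h3⟩
    refine ⟨h1, fun f g => ?_, fun f h n a b c e => ?_⟩
    · have := congrArg (contract (pair f g)) h2
      rwa [contract_comulLeg, contract_inLeg₁_mul_inLeg₂] at this
    · rw [← hc, ← e, ← (crosses_iff_crossMap ρ L).1 h3 h, contract_mul_inl]
      rfl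

theorem isYD_ofDual {ρ : H →ₐ[k] E} {s : Module.Dual k H →ₗ[k] E} (h : IsDoubleHom ρ s) :
    IsYD ρ (ofDual s) := by
  rwa [← isDoubleHom_contractMap, contractMap_ofDual]

/-- The commutation relation between two copies of `H^*` in terms of elements of `E ⊗ H`:
`(L₂)₂ (L₁)₁ = R (L₁)₁ (L₂)₂ R₂₁`. -/
def IsExchange (L₁ L₂ : E ⊗[k] H) : Prop :=
  inLeg₂ k H E L₂ * inLeg₁ k H E L₁ = inLegs k H E (Rmat k H) * inLeg₁ k H E L₁ *
    inLeg₂ k H E L₂ * inLegs k H E (TensorProduct.comm k H H (Rmat k H))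

theorem isExchange_iff (L₁ L₂ : E ⊗[k] H) {n : ℕ} {s t : Fin n → H}
    (hR : Rmat k H = ∑ i, s i ⊗ₜ[k] t i) : IsExchange L₁ L₂ ↔ ∀ f g : Module.Dual k H,
      contractMap L₂ g * contractMap L₁ f = ∑ i, ∑ j,
        contractMap L₁ (sandwich (s i) (t j) f) * contractMap L₂ (sandwich (t i) (s j) g) := by
  have e : ∀ f g : Module.Dual k H, contract (pair f g) (inLegs k H E (Rmat k H) *
      inLeg₁ k H E L₁ * inLeg₂ k H E L₂ * inLegs k H E (TensorProduct.comm k H H (Rmat k H))) =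
      ∑ i, ∑ j,
        contractMap L₁ (sandwich (s i) (t j) f) * contractMap L₂ (sandwich (t i) (s j) g) := by
    intro f g
    simp only [hR, map_sum, TensorProduct.comm_tmul, Finset.sum_mul, Finset.mul_sum,
      contract_sandwich₂, contractMap_apply]
    exact Finset.sum_comm
  constructor
  · intro h f g
    rw [← e, ← h, contract_inLeg₂_mul_inLeg₁]
    rfl
  · intro h
    refine contract_pair_ext fun f g => ?_
    rw [e, ← h, contract_inLeg₂_mul_inLeg₁]
    rfl

end Correspondence

end EllipticDrinfeld

end

noncomputable section

namespace EllipticDrinfeld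

open WithConv

section MapLeg

variable {k H : Type u} {E F : Type*} [Field k] [Ring H] [HopfAlgebra k H] [Ring E] [Algebra k E]
  [Ring F] [Algebra k F]

variable (H) in
/-- The map `E ⊗ H → F ⊗ H` induced by an algebra map `E → F`. -/
def mapLeg (θ : E →ₐ[k] F) : E ⊗[k] H →ₐ[k] F ⊗[k] H :=
  Algebra.TensorProduct.map θ (AlgHom.id k H)

variable (H) in
/-- The map `E ⊗ H ⊗ H → F ⊗ H ⊗ H` induced by an algebra map `E → F`. -/
def mapLegs (θ : E →ₐ[k] F) : E ⊗[k] (H ⊗[k] H) →ₐ[k] F ⊗[k] (H ⊗[k] H) :=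
  Algebra.TensorProduct.map θ (AlgHom.id k (H ⊗[k] H))

@[simp]
theorem mapLeg_tmul (θ : E →ₐ[k] F) (e : E) (a : H) : mapLeg H θ (e ⊗ₜ a) = θ e ⊗ₜ a := by
  simp [mapLeg]

@[simp]
theorem mapLegs_tmul (θ : E →ₐ[k] F) (e : E) (r : H ⊗[k] H) :
    mapLegs H θ (e ⊗ₜ r) = θ e ⊗ₜ r := by
  simp [mapLegs]

theorem comulLeg_mapLeg (θ : E →ₐ[k] F) (L : E ⊗[k] H) :
    comulLeg k H F (mapLeg H θ L) = mapLegs H θ (comulLeg k H E L) := by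
  induction L with
  | zero => simp
  | add x y hx hy => simp only [map_add, hx, hy]
  | tmul e a => simp

theorem inLeg₁_mapLeg (θ : E →ₐ[k] F) (L : E ⊗[k] H) :
    inLeg₁ k H F (mapLeg H θ L) = mapLegs H θ (inLeg₁ k H E L) := by
  induction L with
  | zero => simp
  | add x y hx hy => simp only [map_add, hx, hy]
  | tmul e a => simp

theorem inLeg₂_mapLeg (θ : E →ₐ[k] F) (L : E ⊗[k] H) :
    inLeg₂ k H F (mapLeg H θ L) = mapLegs H θ (inLeg₂ k H E L) := by
  induction L with
  | zero => simp
  | add x y hx hy => simp only [map_add, hx, hy]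
  | tmul e a => simp

theorem contract_mapLeg (θ : E →ₐ[k] F) (f : Module.Dual k H) (L : E ⊗[k] H) :
    contract f (mapLeg H θ L) = θ (contract f L) := by
  induction L with
  | zero => simp
  | add x y hx hy => simp only [map_add, hx, hy]
  | tmul e a => simp

theorem comulLeg_mapLeg_eq {L : E ⊗[k] H}
    (h : comulLeg k H E L = inLeg₁ k H E L * inLeg₂ k H E L) (θ : E →ₐ[k] F) :
    comulLeg k H F (mapLeg H θ L) =
      inLeg₁ k H F (mapLeg H θ L) * inLeg₂ k H F (mapLeg H θ L) := by
  rw [comulLeg_mapLeg, h, map_mul, inLeg₁_mapLeg, inLeg₂_mapLeg]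

theorem commute_algHom_of_tmul {θ : E ⊗[k] H →ₐ[k] F} {w : F}
    (h₁ : ∀ e, Commute w (θ (inl k H E e)))
    (h₂ : ∀ a, Commute w (θ (inr k H E a))) (L : E ⊗[k] H) : Commute w (θ L) := by
  induction L with
  | zero => simp
  | add x y hx hy => rw [map_add]; exact hx.add_right hy
  | tmul e a =>
    have : e ⊗ₜ[k] a = inl k H E e * inr k H E a := by simp
    rw [this, map_mul]
    exact (h₁ e).mul_right (h₂ a)

end MapLeg

section ConvHom

variable {k H : Type u} {W W' : Type*} [Field k] [Ring H] [HopfAlgebra k H] [Ring W] [Algebra k W]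
  [Ring W'] [Algebra k W']

/-- The convolution product of two algebra maps with commuting images. -/
def convHom (α β : H →ₐ[k] W) (h : ∀ a b, Commute (α a) (β b)) : H →ₐ[k] W :=
  (Algebra.TensorProduct.lift α β h).comp (Bialgebra.comulAlgHom k H)

theorem convHom_toLinearMap (α β : H →ₐ[k] W) (h : ∀ a b, Commute (α a) (β b)) :
    (convHom α β h).toLinearMap = pair α.toLinearMap β.toLinearMap ∘ₗ Coalgebra.comul := by
  have : pair α.toLinearMap β.toLinearMap = (Algebra.TensorProduct.lift α β h).toLinearMap :=
    TensorProduct.ext' fun _ _ => by simp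
  rw [this]
  rfl

theorem toConv_convHom (α β : H →ₐ[k] W) (h : ∀ a b, Commute (α a) (β b)) :
    toConv (convHom α β h).toLinearMap = toConv α.toLinearMap * toConv β.toLinearMap := by
  rw [convHom_toLinearMap]
  rfl

theorem commute_convHom {w : W} {α β : H →ₐ[k] W} {h : ∀ a b, Commute (α a) (β b)}
    (hα : ∀ a, Commute w (α a)) (hβ : ∀ a, Commute w (β a)) (a : H) :
    Commute w (convHom α β h a) := by
  rw [← AlgHom.toLinearMap_apply, convHom_toLinearMap]
  exact commute_pair hα hβ _

theorem toConv_comp {f g g' : H →ₗ[k] W} (θ : W →ₐ[k] W')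
    (h : toConv f = toConv g * toConv g') :
    toConv (θ.toLinearMap ∘ₗ f) =
      toConv (θ.toLinearMap ∘ₗ g) * toConv (θ.toLinearMap ∘ₗ g') := by
  have h' : f = (toConv g * toConv g').ofConv := congrArg ofConv h
  rw [h', LinearMap.algHom_comp_convMul_distrib]

theorem Crosses.conv {q ρ l x : H →ₗ[k] W} {P L Q : W} (hP : Crosses l x P) (hL : Crosses ρ x L)
    (hQ : Crosses q x Q) (hPq : ∀ a, Commute P (q a)) (hPρ : ∀ a, Commute P (ρ a))
    (hLq : ∀ a, Commute L (q a)) (hLl : ∀ a, Commute L (l a)) (hQρ : ∀ a, Commute Q (ρ a))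
    (hQl : ∀ a, Commute Q (l a)) {ρ' : H →ₗ[k] W}
    (hρ' : toConv ρ' = toConv q * (toConv ρ * toConv l)) : Crosses ρ' x (P * L * Q) := by
  unfold Crosses at *
  rw [hρ', ← konst_mul_konst, ← konst_mul_konst]
  have e1 := konst_comm hPq
  have e2 := konst_comm hPρ
  have e3 := konst_comm hLq
  have e4 := konst_comm hLl
  have e5 := konst_comm hQρ
  have e6 := konst_comm hQl
  generalize (konst P : WithConv (H →ₗ[k] W)) = P' at *
  generalize (konst L : WithConv (H →ₗ[k] W)) = L' at *
  generalize (konst Q : WithConv (H →ₗ[k] W)) = Q' at *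
  generalize toConv q = q' at *
  generalize toConv ρ = r at *
  generalize toConv l = l' at *
  generalize toConv x = x' at *
  calc q' * (r * l') * x' * (P' * L' * Q')
      = q' * r * (l' * x' * P') * L' * Q' := by simp only [mul_assoc]
    _ = q' * (r * P') * x' * (l' * L') * Q' := by rw [hP]; simp only [mul_assoc]
    _ = (q' * P') * (r * x' * L') * (l' * Q') := by rw [← e2, ← e4]; simp only [mul_assoc]
    _ = P' * (q' * L') * x' * (r * Q') * l' := by rw [← e1, hL, ← e6]; simp only [mul_assoc]
    _ = P' * L' * (q' * x' * Q') * r * l' := by rw [← e3, ← e5]; simp only [mul_assoc]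
    _ = P' * L' * Q' * (x' * (q' * (r * l'))) := by rw [hQ]; simp only [mul_assoc]

theorem Crosses.conv_of_intertwines {q ρ l x : H →ₗ[k] W} {Λ : W}
    (hl : toConv l * toConv x * konst Λ = konst Λ * toConv l)
    (hq : toConv q * konst Λ = konst Λ * (toConv x * toConv q))
    (hρ : ∀ a, Commute Λ (ρ a)) {ρ' : H →ₗ[k] W}
    (hρ' : toConv ρ' = toConv q * (toConv ρ * toConv l)) : Crosses ρ' x Λ := by
  unfold Crosses at *
  rw [hρ']
  have e := konst_comm hρ
  calc toConv q * (toConv ρ * toConv l) * toConv x * konst Λ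
      = toConv q * toConv ρ * (toConv l * toConv x * konst Λ) := by simp only [mul_assoc]
    _ = toConv q * (toConv ρ * konst Λ) * toConv l := by rw [hl]; simp only [mul_assoc]
    _ = (toConv q * konst Λ) * toConv ρ * toConv l := by rw [← e]; simp only [mul_assoc]
    _ = konst Λ * (toConv x * (toConv q * (toConv ρ * toConv l))) := by
      rw [hq]; simp only [mul_assoc]

end ConvHom

section RCrosses

variable {k H : Type u} {W : Type*} [Field k] [Ring H] [HopfAlgebra k H] [Ring W] [Algebra k W]
  [QuasiTriangular k H]

variable (k H) in
/-- The inverse of the R-matrix. -/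
abbrev Rinv : H ⊗[k] H := (↑(QuasiTriangular.R : (H ⊗[k] H)ˣ)⁻¹ : H ⊗[k] H)

theorem crosses_pair_Rmat {l x : H →ₐ[k] W} (h : ∀ a b, Commute (x a) (l b)) :
    Crosses l.toLinearMap x.toLinearMap (pair x.toLinearMap l.toLinearMap (Rmat k H)) :=
  crosses_iff.2 fun a => (pair_Rmat_comul h a).symm

theorem crosses_pair_Rinv {q x : H →ₐ[k] W} (h : ∀ a b, Commute (q a) (x b)) :
    Crosses q.toLinearMap x.toLinearMap (pair q.toLinearMap x.toLinearMap (Rinv k H)) := by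
  refine crosses_iff.2 fun a => ?_
  have h1 := pair_inv_mul h
  have h2 := pair_mul_inv h
  have h3 := pair_Rmat_comul h a
  calc _ = (pair q.toLinearMap x.toLinearMap (Rinv k H) * pair q.toLinearMap x.toLinearMap
        (Rmat k H)) * pair q.toLinearMap x.toLinearMap (Coalgebra.comul (R := k) a) *
          pair q.toLinearMap x.toLinearMap (Rinv k H) := by rw [h1, one_mul]
    _ = _ := by rw [mul_assoc (pair _ _ _), h3, mul_assoc, mul_assoc, h2, mul_one]

end RCrosses

section Coinduction

variable {k H : Type u} {E F F' : Type*} [Field k] [Ring H] [HopfAlgebra k H] [Ring E] [Algebra k E]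
  [Ring F] [Algebra k F] [Ring F'] [Algebra k F']

/-- Three algebra maps to `F` with commuting images. -/
structure CommutingMaps (e : E →ₐ[k] F) (l q : H →ₐ[k] F) : Prop where
  comm_el : ∀ a b, Commute (e a) (l b)
  comm_eq : ∀ a b, Commute (e a) (q b)
  comm_lq : ∀ a b, Commute (l a) (q b)

/-- The algebra map `h ↦ q(h₁) e(ρ(h₂)) l(h₃)`. -/
def coindRep (ρ : H →ₐ[k] E) {e : E →ₐ[k] F} {l q : H →ₐ[k] F} (c : CommutingMaps e l q) :
    H →ₐ[k] F :=
  convHom q (convHom (e.comp ρ) l fun _ b => c.comm_el _ b) fun _ b =>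
    commute_convHom (fun _ => (c.comm_eq _ _).symm) (fun _ => (c.comm_lq _ _).symm) b

theorem toConv_coindRep (ρ : H →ₐ[k] E) {e : E →ₐ[k] F} {l q : H →ₐ[k] F}
    (c : CommutingMaps e l q) : toConv (coindRep ρ c).toLinearMap =
      toConv q.toLinearMap * (toConv (e.comp ρ).toLinearMap * toConv l.toLinearMap) :=
  (toConv_convHom _ _ _).trans (congrArg _ (toConv_convHom _ _ _))

theorem toConv_map_coindRep (ρ : H →ₐ[k] E) {e : E →ₐ[k] F} {l q : H →ₐ[k] F}
    (c : CommutingMaps e l q) (θ : F →ₐ[k] F') :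
    toConv (θ.toLinearMap ∘ₗ (coindRep ρ c).toLinearMap) =
      toConv (θ.comp q).toLinearMap *
        (toConv (θ.comp (e.comp ρ)).toLinearMap * toConv (θ.comp l).toLinearMap) := by
  have h1 := toConv_comp θ (toConv_coindRep ρ c)
  have h2 := toConv_comp (f := (toConv (e.comp ρ).toLinearMap * toConv l.toLinearMap).ofConv) θ rfl
  exact h1.trans (congrArg _ h2)

theorem comulLeg_inr (a : H) : comulLeg k H F (inr k H F a) =
    pair ((inLeg₁ k H F).comp (inr k H F)).toLinearMap
      ((inLeg₂ k H F).comp (inr k H F)).toLinearMap (Coalgebra.comul (R := k) a) := by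
  rw [inr_apply, comulLeg_tmul]
  generalize Coalgebra.comul (R := k) a = z
  induction z with
  | zero => simp
  | add x y hx hy => simp only [map_add, TensorProduct.tmul_add, hx, hy]
  | tmul a b => simp

variable [QuasiTriangular k H]

/-- The element `l(t) s L q(s') t'` of `F ⊗ H`, where `s ⊗ t` is the R-matrix and `s' ⊗ t'` its
inverse. -/
def coindLeg (e : E →ₐ[k] F) (l q : H →ₐ[k] F) (L : E ⊗[k] H) : F ⊗[k] H :=
  pair (inr k H F).toLinearMap ((inl k H F).comp l).toLinearMap (Rmat k H) * mapLeg H e L *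
    pair ((inl k H F).comp q).toLinearMap (inr k H F).toLinearMap (Rinv k H)

theorem mapLeg_coindLeg (e : E →ₐ[k] F) (l q : H →ₐ[k] F) (L : E ⊗[k] H) (θ : F →ₐ[k] F') :
    mapLeg H θ (coindLeg e l q L) = coindLeg (θ.comp e) (θ.comp l) (θ.comp q) L := by
  have h : ∀ a : H →ₐ[k] F, (mapLeg H θ).toLinearMap ∘ₗ ((inl k H F).comp a).toLinearMap =
      ((inl k H F').comp (θ.comp a)).toLinearMap := fun a => by ext; simp
  have h' : (mapLeg H θ).toLinearMap ∘ₗ (inr k H F).toLinearMap =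
      (inr k H F').toLinearMap := by ext; simp
  have h'' : mapLeg H θ (mapLeg H e L) = mapLeg H (θ.comp e) L := by
    induction L with
    | zero => simp
    | add x y hx hy => simp only [map_add, hx, hy]
    | tmul e a => simp
  simp only [coindLeg, map_mul, algHom_pair, h, h', h'']

variable {e : E →ₐ[k] F} {l q : H →ₐ[k] F}

theorem crosses_coindLeg (c : CommutingMaps e l q) {ρ : H →ₐ[k] E} {L : E ⊗[k] H}
    (h : Crosses ((inl k H E).toLinearMap ∘ₗ ρ.toLinearMap) (inr k H E).toLinearMap L) :
    Crosses ((inl k H F).toLinearMap ∘ₗ (coindRep ρ c).toLinearMap) (inr k H F).toLinearMap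
      (coindLeg e l q L) := by
  have hl : ∀ a (b : H), Commute (inr k H F b) ((inl k H F).comp l a) :=
    fun a b => (commute_inl_inr _ _).symm
  have hq : ∀ a (b : H), Commute ((inl k H F).comp q a) (inr k H F b) :=
    fun a b => commute_inl_inr _ _
  have hL : Crosses ((inl k H F).comp (e.comp ρ)).toLinearMap (inr k H F).toLinearMap
      (mapLeg H e L) := by
    have := h.map (mapLeg H e)
    have h1 : (mapLeg H e).toLinearMap ∘ₗ (inl k H E).toLinearMap ∘ₗ ρ.toLinearMap =
      ((inl k H F).comp (e.comp ρ)).toLinearMap := by ext; simp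
    have h2 : (mapLeg H e).toLinearMap ∘ₗ (inr k H E).toLinearMap =
      (inr k H F).toLinearMap := by ext; simp
    rwa [h1, h2] at this
  refine Crosses.conv (crosses_pair_Rmat fun a b => hl b a) hL (crosses_pair_Rinv hq)
    ?_ ?_ ?_ ?_ ?_ ?_ ?_
  · exact fun a => (commute_pair (fun b => hq a b) (fun b => ((c.comm_lq b a).symm.map (inl k H F))) _).symm
  · exact fun a => (commute_pair (fun b => commute_inl_inr _ _)
      (fun b => ((c.comm_el (ρ a) b).map (inl k H F))) _).symm
  · refine fun a => (commute_algHom_of_tmul (fun b => ?_) (fun b => ?_) _).symm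
    · simpa using ((c.comm_eq b a).symm.map (inl k H F))
    · simpa using hq a b
  · refine fun a => (commute_algHom_of_tmul (fun b => ?_) (fun b => ?_) _).symm
    · simpa using ((c.comm_el b a).symm.map (inl k H F))
    · simpa using (hl a b).symm
  · exact fun a => (commute_pair (fun b => ((c.comm_eq (ρ a) b).map (inl k H F)))
      (fun b => commute_inl_inr _ _) _).symm
  · exact fun a => (commute_pair (fun b => ((c.comm_lq a b).map (inl k H F)))
      (fun b => commute_inl_inr _ _) _).symm
  · exact toConv_map_coindRep ρ c (inl k H F)

theorem comulLeg_coindLeg (c : CommutingMaps e l q) {L : E ⊗[k] H}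
    (h : comulLeg k H E L = inLeg₁ k H E L * inLeg₂ k H E L) :
    comulLeg k H F (coindLeg e l q L) =
      inLeg₁ k H F (coindLeg e l q L) * inLeg₂ k H F (coindLeg e l q L) := by
  have hL := comulLeg_mapLeg_eq h e
  set x₁ := (inLeg₁ k H F).comp (inr k H F) with hx₁
  set x₂ := (inLeg₂ k H F).comp (inr k H F) with hx₂
  set x := (comulLeg k H F).comp (inr k H F) with hx
  set i : F →ₐ[k] F ⊗[k] (H ⊗[k] H) := Algebra.TensorProduct.includeLeft with hi
  have c₁ : (inLeg₁ k H F).comp (inl k H F) = i := by ext; simp [hi, Algebra.TensorProduct.one_def]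
  have c₂ : (inLeg₂ k H F).comp (inl k H F) = i := by ext; simp [hi, Algebra.TensorProduct.one_def]
  have c₀ : (comulLeg k H F).comp (inl k H F) = i := by ext; simp [hi, Algebra.TensorProduct.one_def]
  have hxx : x.toLinearMap = pair x₁.toLinearMap x₂.toLinearMap ∘ₗ Coalgebra.comul :=
    LinearMap.ext comulLeg_inr
  have i₁ : ∀ a b, Commute (i a) (x₁ b) := fun a b => by
    simp [Commute, SemiconjBy, hi, hx₁]
  have i₂ : ∀ a b, Commute (i a) (x₂ b) := fun a b => by
    simp [Commute, SemiconjBy, hi, hx₂]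
  have i₀ : ∀ a b, Commute (i a) (x b) := fun a b => by
    simp [Commute, SemiconjBy, hi, hx]
  have x₁₂ : ∀ a b, Commute (x₁ a) (x₂ b) := fun a b => by
    simp [Commute, SemiconjBy, hx₁, hx₂]
  have key : ∀ (θ : F ⊗[k] H →ₐ[k] F ⊗[k] (H ⊗[k] H)) (y : H →ₐ[k] F ⊗[k] (H ⊗[k] H)),
      θ.comp (inl k H F) = i → θ.comp (inr k H F) = y → θ (coindLeg e l q L) =
        pair y.toLinearMap (i.comp l).toLinearMap (Rmat k H) * θ (mapLeg H e L) *
          pair (i.comp q).toLinearMap y.toLinearMap (Rinv k H) := by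
    rintro θ y h1 rfl
    rw [← h1]
    simp only [coindLeg, map_mul, algHom_pair]
    rfl
  rw [key _ x c₀ rfl, key _ x₁ c₁ rfl, key _ x₂ c₂ rfl, hL]
  set L₁ := inLeg₁ k H F (mapLeg H e L) with hL₁
  set L₂ := inLeg₂ k H F (mapLeg H e L) with hL₂
  have hP : pair x.toLinearMap (i.comp l).toLinearMap (Rmat k H) =
      pair x₁.toLinearMap (i.comp l).toLinearMap (Rmat k H) *
        pair x₂.toLinearMap (i.comp l).toLinearMap (Rmat k H) := by
    rw [hxx, pair_conv_left fun a b => (i₂ _ _).symm]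
  have hQ : pair (i.comp q).toLinearMap x.toLinearMap (Rinv k H) =
      pair (i.comp q).toLinearMap x₁.toLinearMap (Rinv k H) *
        pair (i.comp q).toLinearMap x₂.toLinearMap (Rinv k H) := by
    refine left_inv_eq_right_inv (pair_inv_mul (fun a b => i₀ _ _)) ?_
    rw [hxx, pair_conv_right (fun a b => i₂ _ _) x₁₂, mul_assoc,
      ← mul_assoc (pair (i.comp q).toLinearMap x₁.toLinearMap (Rmat k H)),
      pair_mul_inv (fun a b => i₁ _ _), one_mul, pair_mul_inv (fun a b => i₂ _ _)]
  have d1 : Commute L₁ (pair x₂.toLinearMap (i.comp l).toLinearMap (Rmat k H)) := by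
    refine commute_pair (fun a => ?_) (fun a => ?_) _
    · refine (commute_algHom_of_tmul (θ := (inLeg₁ k H F).comp (mapLeg H e)) (fun b => ?_)
        (fun b => ?_) L).symm
      · simpa [hi, Algebra.TensorProduct.one_def] using (i₂ (e b) a).symm
      · simpa [hx₁] using (x₁₂ b a).symm
    · refine (commute_algHom_of_tmul (θ := (inLeg₁ k H F).comp (mapLeg H e)) (fun b => ?_)
        (fun b => ?_) L).symm
      · simpa [hi, Algebra.TensorProduct.one_def] using (c.comm_el b a).symm.map i
      · simpa [hx₁] using i₁ (l a) b
  have d2 : Commute (pair (i.comp q).toLinearMap x₁.toLinearMap (Rinv k H))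
      (pair x₂.toLinearMap (i.comp l).toLinearMap (Rmat k H)) := by
    refine commute_pair (fun a => (commute_pair (fun b => ?_) (fun b => ?_) _).symm)
      (fun a => (commute_pair (fun b => ?_) (fun b => ?_) _).symm) _
    · exact (i₂ _ _).symm
    · exact (x₁₂ _ _).symm
    · exact (c.comm_lq a b).map i
    · exact i₁ _ _
  have d3 : Commute (pair (i.comp q).toLinearMap x₁.toLinearMap (Rinv k H)) L₂ := by
    refine (commute_pair (fun a => ?_) (fun a => ?_) _).symm
    · refine (commute_algHom_of_tmul (θ := (inLeg₂ k H F).comp (mapLeg H e)) (fun b => ?_)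
        (fun b => ?_) L).symm
      · simpa [hi, Algebra.TensorProduct.one_def] using (c.comm_eq b a).symm.map i
      · simpa [hx₂] using i₂ (q a) b
    · refine (commute_algHom_of_tmul (θ := (inLeg₂ k H F).comp (mapLeg H e)) (fun b => ?_)
        (fun b => ?_) L).symm
      · simpa [hi, Algebra.TensorProduct.one_def] using (i₁ (e b) a).symm
      · simpa [hx₂] using x₁₂ a b
  rw [hP, hQ]
  generalize pair x₁.toLinearMap (i.comp l).toLinearMap (Rmat k H) = P₁ at *
  generalize pair x₂.toLinearMap (i.comp l).toLinearMap (Rmat k H) = P₂ at *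
  generalize pair (i.comp q).toLinearMap x₁.toLinearMap (Rinv k H) = Q₁ at *
  generalize pair (i.comp q).toLinearMap x₂.toLinearMap (Rinv k H) = Q₂ at *
  calc P₁ * P₂ * (L₁ * L₂) * (Q₁ * Q₂) = P₁ * (P₂ * L₁) * (L₂ * Q₁) * Q₂ := by
        simp only [mul_assoc]
    _ = P₁ * L₁ * (P₂ * Q₁) * L₂ * Q₂ := by rw [← d1.eq, ← d3.eq]; simp only [mul_assoc]
    _ = P₁ * L₁ * Q₁ * (P₂ * L₂ * Q₂) := by rw [← d2.eq]; simp only [mul_assoc]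

theorem contract_counit_coindLeg {L : E ⊗[k] H} (h : contract Coalgebra.counit L = 1) :
    contract Coalgebra.counit (coindLeg e l q L) = 1 := by
  let ε : F ⊗[k] H →ₐ[k] F := Algebra.TensorProduct.lift (AlgHom.id k F) (counitHom k H F)
    fun a b => (Algebra.commutes _ _).symm
  have hε : ∀ z : F ⊗[k] H, contract Coalgebra.counit z = ε z := by
    intro z
    induction z with
    | zero => simp
    | add x y hx hy => simp only [map_add, hx, hy]
    | tmul e a => simp [ε, counitHom, Algebra.smul_def, Algebra.ofId_apply, Algebra.commutes]
  have h1 : ∀ a : H →ₐ[k] F, ε.toLinearMap ∘ₗ ((inl k H F).comp a).toLinearMap = a.toLinearMap :=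
    fun a => by
      ext x
      change ε (a x ⊗ₜ 1) = a x
      rw [← hε]
      simp
  have h2 : ε.toLinearMap ∘ₗ (inr k H F).toLinearMap = (counitHom k H F).toLinearMap := by
    ext x
    change ε (1 ⊗ₜ x) = _
    rw [← hε]
    simp [counitHom, Algebra.ofId_apply, Algebra.algebraMap_eq_smul_one]
  have hq : pair q.toLinearMap (counitHom k H F).toLinearMap (Rinv k H) = 1 := by
    have := pair_inv_mul (α := q) (β := counitHom k H F) fun a b => (Algebra.commutes _ _).symm
    rwa [pair_counit_right, mul_one] at this
  rw [hε, coindLeg, map_mul, map_mul, algHom_pair, algHom_pair, h1, h1, h2, pair_counit_left, hq,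
    ← hε, contract_mapLeg, h]
  simp

theorem IsYD.coind (c : CommutingMaps e l q) {ρ : H →ₐ[k] E} {L : E ⊗[k] H} (h : IsYD ρ L) :
    IsYD (coindRep ρ c) (coindLeg e l q L) :=
  ⟨contract_counit_coindLeg h.one, comulLeg_coindLeg c h.mul, crosses_coindLeg c h.cross⟩

end Coinduction

end EllipticDrinfeld

end

noncomputable section

namespace EllipticDrinfeld

open WithConv

section Exchange

variable {k H : Type u} {E F : Type*} [Field k] [Ring H] [HopfAlgebra k H] [Ring E] [Algebra k E]
  [Ring F] [Algebra k F] {e : E →ₐ[k] F} {l q : H →ₐ[k] F} {Λ : F ⊗[k] H}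

/-- The commutation rules of the cofree coaction `Λ` with the three commuting maps. -/
structure CofreeRules (e : E →ₐ[k] F) (l q : H →ₐ[k] F) (Λ : F ⊗[k] H) : Prop where
  rule_e : ∀ x, Commute Λ (inl k H F (e x))
  rule_l : ∀ a, Λ * inl k H F (l a) = pair ((inl k H F).comp l).toLinearMap
    (inr k H F).toLinearMap (Coalgebra.comul (R := k) a) * Λ
  rule_q : ∀ a, inl k H F (q a) * Λ = Λ * pair (inr k H F).toLinearMap
    ((inl k H F).comp q).toLinearMap (Coalgebra.comul (R := k) a)

theorem CofreeRules.crosses (r : CofreeRules e l q Λ) (c : CommutingMaps e l q) (ρ : H →ₐ[k] E) :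
    Crosses ((inl k H F).toLinearMap ∘ₗ (coindRep ρ c).toLinearMap) (inr k H F).toLinearMap Λ := by
  refine Crosses.conv_of_intertwines (ρ := ((inl k H F).comp (e.comp ρ)).toLinearMap) ?_ ?_
    (fun a => r.rule_e (ρ a)) (toConv_map_coindRep ρ c (inl k H F))
  · rw [mul_konst, konst_mul]
    ext a
    exact (r.rule_l a).symm
  · rw [mul_konst, konst_mul]
    ext a
    exact r.rule_q a

variable [QuasiTriangular k H]

theorem CofreeRules.isExchange (r : CofreeRules e l q Λ) (L : E ⊗[k] H) :
    IsExchange (coindLeg e l q L) Λ := by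
  set x₁ := (inLeg₁ k H F).comp (inr k H F) with hx₁
  set x₂ := (inLeg₂ k H F).comp (inr k H F) with hx₂
  set i : F →ₐ[k] F ⊗[k] (H ⊗[k] H) := Algebra.TensorProduct.includeLeft with hi
  have c₁ : (inLeg₁ k H F).comp (inl k H F) = i := by
    ext; simp [hi, Algebra.TensorProduct.one_def]
  have c₂ : (inLeg₂ k H F).comp (inl k H F) = i := by
    ext; simp [hi, Algebra.TensorProduct.one_def]
  have i₁ : ∀ a b, Commute (i a) (x₁ b) := fun a b => by
    simp [Commute, SemiconjBy, hi, hx₁]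
  have i₂ : ∀ a b, Commute (i a) (x₂ b) := fun a b => by
    simp [Commute, SemiconjBy, hi, hx₂]
  have x₁₂ : ∀ a b, Commute (x₁ a) (x₂ b) := fun a b => by
    simp [Commute, SemiconjBy, hx₁, hx₂]
  have hR : ∀ r, inLegs k H F r = pair x₁.toLinearMap x₂.toLinearMap r := by
    intro r
    induction r with
    | zero => simp
    | add x y hx hy => simp only [map_add, hx, hy]
    | tmul a b => simp [hx₁, hx₂]
  have hR' : ∀ r, inLegs k H F (TensorProduct.comm k H H r) =
      pair x₂.toLinearMap x₁.toLinearMap r := by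
    intro r
    induction r with
    | zero => simp
    | add x y hx hy => simp only [map_add, hx, hy]
    | tmul a b => simp [hx₁, hx₂]
  set M := inLeg₂ k H F Λ with hM
  have hMx : ∀ a, Commute (x₁ a) M := fun a =>
    commute_algHom_of_tmul (fun b => by
      have := (i₁ b a).symm
      rwa [← c₂] at this) (fun b => x₁₂ a b) Λ
  have hMl : ∀ a, M * i (l a) =
      pair (i.comp l).toLinearMap x₂.toLinearMap (Coalgebra.comul (R := k) a) * M := by
    intro a
    have := congrArg (inLeg₂ k H F) (r.rule_l a)
    rw [map_mul, map_mul, algHom_pair] at this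
    rw [← c₂]
    exact this
  have hMq : ∀ a, i (q a) * M =
      M * pair x₂.toLinearMap (i.comp q).toLinearMap (Coalgebra.comul (R := k) a) := by
    intro a
    have := congrArg (inLeg₂ k H F) (r.rule_q a)
    rw [map_mul, map_mul, algHom_pair] at this
    rw [← c₂]
    exact this
  have hMe : ∀ a, Commute M (i (e a)) := fun a => by
    rw [← c₂]
    exact (r.rule_e a).map (inLeg₂ k H F)
  have hML : Commute M (inLeg₁ k H F (mapLeg H e L)) :=
    commute_algHom_of_tmul (θ := (inLeg₁ k H F).comp (mapLeg H e)) (fun b => by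
      have := hMe b
      rw [← c₁] at this
      simpa using this) (fun b => by simpa [hx₁] using (hMx b).symm) L
  have hMP : M * pair x₁.toLinearMap (i.comp l).toLinearMap (Rmat k H) =
      pair x₁.toLinearMap x₂.toLinearMap (Rmat k H) *
        pair x₁.toLinearMap (i.comp l).toLinearMap (Rmat k H) * M := by
    rw [← pair_conv_right (β := i.comp l) x₁₂ fun a b => i₂ _ _]
    generalize Rmat k H = z
    induction z with
    | zero => simp
    | add x y hx hy => simp only [map_add, mul_add, add_mul, hx, hy]
    | tmul a b =>
      simp only [pair_tmul, AlgHom.toLinearMap_apply, AlgHom.comp_apply, LinearMap.comp_apply]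
      rw [← mul_assoc, ← (hMx a).eq, mul_assoc, hMl, mul_assoc]
  have hMQ : pair (i.comp q).toLinearMap x₁.toLinearMap (Rmat k H) * M =
      M * (pair x₂.toLinearMap x₁.toLinearMap (Rmat k H) *
        pair (i.comp q).toLinearMap x₁.toLinearMap (Rmat k H)) := by
    rw [← pair_conv_left (α := x₂) fun a b => i₁ _ _]
    generalize Rmat k H = z
    induction z with
    | zero => simp
    | add x y hx hy => simp only [map_add, mul_add, add_mul, hx, hy]
    | tmul a b =>
      simp only [pair_tmul, AlgHom.toLinearMap_apply, AlgHom.comp_apply, LinearMap.comp_apply]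
      rw [mul_assoc, (hMx b).eq, ← mul_assoc, hMq, mul_assoc]
  have hMQ' : M * pair (i.comp q).toLinearMap x₁.toLinearMap (Rinv k H) =
      pair (i.comp q).toLinearMap x₁.toLinearMap (Rinv k H) * M *
        pair x₂.toLinearMap x₁.toLinearMap (Rmat k H) := by
    have h1 := pair_inv_mul (k := k) (α := i.comp q) (β := x₁) fun a b => i₁ _ _
    have h2 := pair_mul_inv (k := k) (α := i.comp q) (β := x₁) fun a b => i₁ _ _
    generalize pair (i.comp q).toLinearMap x₁.toLinearMap (Rmat k H) = Q' at *
    change _ * pair _ _ (Rinv k H) = 1 at h2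
    change pair _ _ (Rinv k H) * _ = 1 at h1
    generalize pair (i.comp q).toLinearMap x₁.toLinearMap (Rinv k H) = Q at *
    generalize pair x₂.toLinearMap x₁.toLinearMap (Rmat k H) = T at *
    calc M * Q = Q * (Q' * M) * Q := by rw [← mul_assoc, h1, one_mul]
      _ = Q * M * T := by
        rw [hMQ, mul_assoc Q, mul_assoc M, mul_assoc T, h2, mul_one, ← mul_assoc]
  have key : inLeg₁ k H F (coindLeg e l q L) =
        pair x₁.toLinearMap (i.comp l).toLinearMap (Rmat k H) *
          inLeg₁ k H F (mapLeg H e L) *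
          pair (i.comp q).toLinearMap x₁.toLinearMap (Rinv k H) := by
    rw [← c₁]
    simp only [coindLeg, map_mul, algHom_pair]
    rfl
  rw [IsExchange, hR, hR', key, ← hM]
  generalize pair x₁.toLinearMap (i.comp l).toLinearMap (Rmat k H) = P at *
  generalize pair (i.comp q).toLinearMap x₁.toLinearMap (Rinv k H) = Q at *
  generalize inLeg₁ k H F (mapLeg H e L) = L' at *
  generalize pair x₁.toLinearMap x₂.toLinearMap (Rmat k H) = R' at *
  generalize pair x₂.toLinearMap x₁.toLinearMap (Rmat k H) = T at *
  calc M * (P * L' * Q) = M * P * L' * Q := by simp only [mul_assoc]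
    _ = R' * P * (M * L') * Q := by rw [hMP]; simp only [mul_assoc]
    _ = R' * P * L' * (M * Q) := by rw [hML.eq]; simp only [mul_assoc]
    _ = _ := by rw [hMQ']; simp only [mul_assoc]

end Exchange

section CofreeLeg

variable (k H : Type u) [Field k] [Ring H] [HopfAlgebra k H]

/-- The action of `H^*` on `H` by `g · b = b₁ g(b₂)`. -/
def translate : Module.Dual k H →ₗ[k] Module.End k H where
  toFun g := contract g ∘ₗ Coalgebra.comul
  map_add' f g := by ext; simp [contract, LinearMap.lTensor_add]
  map_smul' c f := by ext; simp [contract, LinearMap.lTensor_smul]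

variable {k H}

theorem translate_apply (g : Module.Dual k H) (b : H) :
    translate k H g b = contract g (Coalgebra.comul (R := k) b) := rfl

theorem translate_counit : translate k H Coalgebra.counit = 1 := by
  ext b
  rw [translate_apply, contract, LinearMap.comp_apply, Coalgebra.lTensor_counit_comul]
  simp

theorem contract_comul_contract (f g : Module.Dual k H) (z : H ⊗[k] H) :
    contract f (Coalgebra.comul (R := k) (contract g z)) = contract (pair f g)
      (TensorProduct.assoc k H H H (Coalgebra.comul.rTensor H z)) := by
  induction z with
  | zero => simp
  | add x y hx hy => simp only [map_add, hx, hy]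
  | tmul a b =>
    simp only [contract_tmul, map_smul, LinearMap.rTensor_tmul]
    generalize Coalgebra.comul (R := k) a = w
    induction w with
    | zero => simp
    | add x y hx hy => simp only [map_add, TensorProduct.add_tmul, smul_add, hx, hy]
    | tmul c d => simp [smul_smul, mul_comm]

theorem translate_convMul (f g : Module.Dual k H) :
    translate k H (convMul f g) = translate k H f * translate k H g := by
  ext b
  rw [Module.End.mul_apply, translate_apply, translate_apply, translate_apply,
    contract_comul_contract, Coalgebra.coassoc_apply, contract_lTensor]
  rfl

theorem contract_mul_mul (f : Module.Dual k H) (a b c : H) (z : H ⊗[k] H) :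
    contract f ((a ⊗ₜ b) * z * (1 ⊗ₜ c)) = a * contract (sandwich b c f) z := by
  have := contract_sandwich f a b c z
  simpa using this

variable [Module.Finite k H]

variable (k H) in
/-- The element of `End(H) ⊗ H` attached to `translate`. -/
def cofreeLeg : Module.End k H ⊗[k] H := ofDual (translate k H)

theorem contract_cofreeLeg (f : Module.Dual k H) :
    contract f (cofreeLeg k H) = translate k H f := contract_ofDual _ f

theorem comulLeg_cofreeLeg : comulLeg k H _ (cofreeLeg k H) =
    inLeg₁ k H _ (cofreeLeg k H) * inLeg₂ k H _ (cofreeLeg k H) :=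
  contract_pair_ext fun f g => by
    rw [contract_comulLeg, contract_inLeg₁_mul_inLeg₂]
    simp only [contract_cofreeLeg, translate_convMul]

theorem cofreeLeg_mul_inl (a : H) : cofreeLeg k H * inl k H _ (Algebra.lmul k H a) =
    pair ((inl k H _).comp (Algebra.lmul k H)).toLinearMap (inr k H _).toLinearMap
      (Coalgebra.comul (R := k) a) * cofreeLeg k H := by
  refine contract_ext fun f => LinearMap.ext fun b => ?_
  rw [contract_mul_inl, contract_cofreeLeg, Module.End.mul_apply, translate_apply]
  change contract f (Coalgebra.comul (R := k) (a * b)) = _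
  rw [Bialgebra.comul_mul]
  generalize Coalgebra.comul (R := k) a = z
  induction z with
  | zero => simp
  | add x y hx hy => simp only [map_add, add_mul, hx, hy, LinearMap.add_apply]
  | tmul c d =>
    have h1 := contract_mul_mul f c d 1 (Coalgebra.comul (R := k) b)
    have h2 := contract_sandwich f (Algebra.lmul k H c) d 1 (cofreeLeg k H)
    rw [map_one, mul_one] at h2
    rw [← Algebra.TensorProduct.one_def, mul_one] at h1
    rw [h1, pair_tmul]
    refine Eq.trans ?_ (LinearMap.congr_fun h2 b).symm
    rw [contract_cofreeLeg]
    rfl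

variable [QuasiTriangular k H]

variable (k H) in
/-- The action of `H` on itself by right multiplication by `S⁻¹(h)`. -/
def antipodeInvRep : H →ₐ[k] Module.End k H :=
  AlgHom.ofLinearMap ((LinearMap.mul k H).flip ∘ₗ antipodeInv k)
    (by ext; simp [antipodeInv_one])
    fun a b => by ext; simp [antipodeInv_mul, mul_assoc]

@[simp]
theorem antipodeInvRep_apply (a b : H) : antipodeInvRep k H a b = b * antipodeInv k a := rfl

/-- `S⁻¹(h) ⊗ 1 = Δ(S⁻¹(h₂)) (1 ⊗ h₁)` -/
theorem pair_comul_antipodeInv (h : H) :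
    pair (Coalgebra.comul ∘ₗ antipodeInv k) (inr k H H).toLinearMap
      (TensorProduct.comm k H H (Coalgebra.comul (R := k) h)) = antipodeInv k h ⊗ₜ 1 := by
  have e1 : opConv (Bialgebra.comulAlgHom k H).toLinearMap =
      opConv (inl k H H).toLinearMap * opConv (inr k H H).toLinearMap := by
    rw [opConv_mul]
    congr 1
    ext a
    simp only [LinearMap.comp_apply, LinearEquiv.coe_coe, AlgHom.toLinearMap_apply,
      Bialgebra.comulAlgHom_apply]
    generalize Coalgebra.comul (R := k) a = z
    induction z with
    | zero => simp
    | add x y hx hy => simp only [map_add, ← hx, ← hy]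
    | tmul c d => simp
  have e2 := congrArg (opConv ((inl k H H).toLinearMap ∘ₗ antipodeInv k) * ·) e1
  simp only [← mul_assoc, opConv_antipodeInv_mul_map, one_mul] at e2
  have e3 := congrArg (· * opConv ((Bialgebra.comulAlgHom k H).toLinearMap ∘ₗ antipodeInv k)) e2
  simp only [mul_assoc, opConv_map_mul_antipodeInv, mul_one] at e3
  rw [opConv_mul] at e3
  exact (LinearMap.congr_fun (opConv_injective e3) h).symm

theorem inl_mul_cofreeLeg (a : H) : inl k H _ (antipodeInvRep k H a) * cofreeLeg k H =
    cofreeLeg k H * pair (inr k H _).toLinearMap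
      ((inl k H _).comp (antipodeInvRep k H)).toLinearMap (Coalgebra.comul (R := k) a) := by
  refine contract_ext fun f => LinearMap.ext fun b => ?_
  have h1 := contract_sandwich f (antipodeInvRep k H a) 1 1 (cofreeLeg k H)
  have h0 : sandwich 1 1 f = f := by ext; simp [sandwich]
  rw [map_one, mul_one, mul_one, h0, contract_cofreeLeg] at h1
  rw [h1, Module.End.mul_apply, antipodeInvRep_apply, translate_apply]
  have h2 : contract f (Coalgebra.comul (R := k) b) * antipodeInv k a =
      contract f (Coalgebra.comul (R := k) b * (antipodeInv k a ⊗ₜ 1)) :=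
    (contract_mul_inl f (antipodeInv k a) (Coalgebra.comul (R := k) b)).symm
  rw [h2, ← pair_comul_antipodeInv]
  generalize Coalgebra.comul (R := k) a = z
  induction z with
  | zero => simp
  | add x y hx hy => simp only [map_add, mul_add, hx, hy, LinearMap.add_apply]
  | tmul c d =>
    have h3 := contract_mul_mul f 1 1 c (Coalgebra.comul (R := k) (b * antipodeInv k d))
    have h4 := contract_sandwich f 1 1 c (cofreeLeg k H)
    rw [← Algebra.TensorProduct.one_def, one_mul, one_mul, Bialgebra.comul_mul] at h3
    rw [map_one, map_one, one_mul, one_mul, one_mul] at h4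
    simp only [TensorProduct.comm_tmul, pair_tmul, LinearMap.comp_apply, AlgHom.toLinearMap_apply,
      AlgHom.comp_apply]
    rw [← mul_assoc, ← mul_assoc, contract_mul_inl, h4, contract_cofreeLeg]
    refine h3.trans ?_
    rw [← Bialgebra.comul_mul]
    rfl

/-- The three commuting maps to `E ⊗ End(H)`. -/
theorem commutingMaps_end {E : Type*} [Ring E] [Algebra k E] : CommutingMaps
    (Algebra.TensorProduct.includeLeft : E →ₐ[k] E ⊗[k] Module.End k H)
    (Algebra.TensorProduct.includeRight.comp (Algebra.lmul k H))
    (Algebra.TensorProduct.includeRight.comp (antipodeInvRep k H)) := by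
  refine ⟨fun a b => ?_, fun a b => ?_, fun a b => ?_⟩
  · simp [Commute, SemiconjBy]
  · simp [Commute, SemiconjBy]
  · have : Commute (Algebra.lmul k H a) (antipodeInvRep k H b) := by
      ext c
      simp [mul_assoc]
    exact this.map (Algebra.TensorProduct.includeRight :
      Module.End k H →ₐ[k] E ⊗[k] Module.End k H)

theorem cofreeRules_end {E : Type*} [Ring E] [Algebra k E] : CofreeRules
    (Algebra.TensorProduct.includeLeft : E →ₐ[k] E ⊗[k] Module.End k H)
    (Algebra.TensorProduct.includeRight.comp (Algebra.lmul k H))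
    (Algebra.TensorProduct.includeRight.comp (antipodeInvRep k H))
    (mapLeg H Algebra.TensorProduct.includeRight (cofreeLeg k H)) := by
  refine ⟨fun a => ?_, fun a => ?_, fun a => ?_⟩
  · refine (commute_algHom_of_tmul (fun b => ?_) (fun b => ?_) _).symm <;>
      simp [Commute, SemiconjBy]
  · have := congrArg (mapLeg H (Algebra.TensorProduct.includeRight :
      Module.End k H →ₐ[k] E ⊗[k] Module.End k H)) (cofreeLeg_mul_inl a)
    rw [map_mul, map_mul, algHom_pair] at this
    refine Eq.trans ?_ (this.trans ?_)
    · simp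
    · congr 2
  · have := congrArg (mapLeg H (Algebra.TensorProduct.includeRight :
      Module.End k H →ₐ[k] E ⊗[k] Module.End k H)) (inl_mul_cofreeLeg a)
    rw [map_mul, map_mul, algHom_pair] at this
    refine Eq.trans ?_ (this.trans ?_)
    · simp
    · congr 2

theorem isYD_cofree {E : Type*} [Ring E] [Algebra k E] (ρ : H →ₐ[k] E) :
    IsYD (coindRep ρ (commutingMaps_end (k := k) (H := H)))
      (mapLeg H Algebra.TensorProduct.includeRight (cofreeLeg k H)) where
  one := by rw [contract_mapLeg, contract_cofreeLeg, translate_counit, map_one]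
  mul := comulLeg_mapLeg_eq comulLeg_cofreeLeg _
  cross := cofreeRules_end.crosses _ ρ

end CofreeLeg

end EllipticDrinfeld

end

noncomputable section

namespace EllipticDrinfeld

section Lift

variable {k H : Type u} [Field k] [Ring H] [HopfAlgebra k H] [QuasiTriangular k H]

namespace EllipticDouble

theorem isDoubleHom_ι₁ : IsDoubleHom (ι₀ k H) (ι₁ k H) where
  one := (mk_rel Rel.one₁).trans (map_one _)
  mul f g := (mk_rel (Rel.mul₁ f g)).trans (map_mul _ _ _)
  cross f h n h₁ h₂ h₃ hh := by
    have := mk_rel (Rel.cross₁ f h n h₁ h₂ h₃ hh)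
    simp only [map_mul, map_sum] at this
    exact this

theorem isDoubleHom_ι₂ : IsDoubleHom (ι₀ k H) (ι₂ k H) where
  one := (mk_rel Rel.one₂).trans (map_one _)
  mul f g := (mk_rel (Rel.mul₂ f g)).trans (map_mul _ _ _)
  cross f h n h₁ h₂ h₃ hh := by
    have := mk_rel (Rel.cross₂ f h n h₁ h₂ h₃ hh)
    simp only [map_mul, map_sum] at this
    exact this

theorem ι₂_mul_ι₁ (f g : Module.Dual k H) {n : ℕ} {s t : Fin n → H}
    (hR : Rmat k H = ∑ i, s i ⊗ₜ[k] t i) : ι₂ k H g * ι₁ k H f =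
      ∑ i, ∑ j, ι₁ k H (sandwich (s i) (t j) f) * ι₂ k H (sandwich (t i) (s j) g) := by
  have := mk_rel (Rel.comm f g n s t hR)
  simp only [map_mul, map_sum] at this
  exact this

variable {F : Type*} [Ring F] [Algebra k F]

theorem algHom_ext {φ ψ : EllipticDouble k H →ₐ[k] F} (h₀ : ∀ h, φ (ι₀ k H h) = ψ (ι₀ k H h))
    (h₁ : ∀ f, φ (ι₁ k H f) = ψ (ι₁ k H f)) (h₂ : ∀ f, φ (ι₂ k H f) = ψ (ι₂ k H f)) : φ = ψ := by
  refine RingQuot.ringQuot_ext' k φ ψ (TensorAlgebra.hom_ext ?_)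
  exact LinearMap.prod_ext (LinearMap.ext h₀)
    (LinearMap.prod_ext (LinearMap.ext h₁) (LinearMap.ext h₂))

/-- Algebra maps out of the elliptic double. -/
def lift (ρ : H →ₐ[k] F) (s₁ s₂ : Module.Dual k H →ₗ[k] F) (h₁ : IsDoubleHom ρ s₁)
    (h₂ : IsDoubleHom ρ s₂) (hc : ∀ (f g : Module.Dual k H) (n : ℕ) (s t : Fin n → H),
      Rmat k H = ∑ i, s i ⊗ₜ[k] t i → s₂ g * s₁ f =
        ∑ i, ∑ j, s₁ (sandwich (s i) (t j) f) * s₂ (sandwich (t i) (s j) g)) :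
    EllipticDouble k H →ₐ[k] F :=
  RingQuot.liftAlgHom k ⟨TensorAlgebra.lift k (LinearMap.coprod ρ.toLinearMap
    (LinearMap.coprod s₁ s₂)), by
      have e₀ : ∀ h, TensorAlgebra.lift k (LinearMap.coprod ρ.toLinearMap
        (LinearMap.coprod s₁ s₂)) (gen₀ h) = ρ h := fun h => by simp [gen₀]
      have e₁ : ∀ f, TensorAlgebra.lift k (LinearMap.coprod ρ.toLinearMap
        (LinearMap.coprod s₁ s₂)) (gen₁ f) = s₁ f := fun h => by simp [gen₁]
      have e₂ : ∀ f, TensorAlgebra.lift k (LinearMap.coprod ρ.toLinearMap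
        (LinearMap.coprod s₁ s₂)) (gen₂ f) = s₂ f := fun h => by simp [gen₂]
      intro x y h
      induction h with
      | one₀ => rw [e₀, map_one, map_one]
      | mul₀ a b => rw [map_mul, e₀, e₀, e₀, map_mul]
      | one₁ => rw [e₁, map_one, h₁.one]
      | mul₁ f g => rw [map_mul, e₁, e₁, e₁, h₁.mul]
      | one₂ => rw [e₂, map_one, h₂.one]
      | mul₂ f g => rw [map_mul, e₂, e₂, e₂, h₂.mul]
      | cross₁ f h n a b c hh => simp only [map_mul, map_sum, e₀, e₁, h₁.cross f h n a b c hh]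
      | cross₂ f h n a b c hh => simp only [map_mul, map_sum, e₀, e₂, h₂.cross f h n a b c hh]
      | comm f g n s t hR => simp only [map_mul, map_sum, e₁, e₂, hc f g n s t hR]⟩

section

variable {ρ : H →ₐ[k] F} {s₁ s₂ : Module.Dual k H →ₗ[k] F} (h₁ : IsDoubleHom ρ s₁)
    (h₂ : IsDoubleHom ρ s₂) (hc : ∀ (f g : Module.Dual k H) (n : ℕ) (s t : Fin n → H),
      Rmat k H = ∑ i, s i ⊗ₜ[k] t i → s₂ g * s₁ f =
        ∑ i, ∑ j, s₁ (sandwich (s i) (t j) f) * s₂ (sandwich (t i) (s j) g))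

theorem lift_mk_ι (v : H × Module.Dual k H × Module.Dual k H) :
    lift ρ s₁ s₂ h₁ h₂ hc (mk k H (TensorAlgebra.ι k v)) =
      LinearMap.coprod ρ.toLinearMap (LinearMap.coprod s₁ s₂) v :=
  (RingQuot.liftAlgHom_mkAlgHom_apply k _ _ _).trans (TensorAlgebra.lift_ι_apply _ _)

theorem lift_ι₀ (h : H) : lift ρ s₁ s₂ h₁ h₂ hc (ι₀ k H h) = ρ h :=
  (lift_mk_ι h₁ h₂ hc (h, 0, 0)).trans (by simp)

theorem lift_ι₁ (f : Module.Dual k H) : lift ρ s₁ s₂ h₁ h₂ hc (ι₁ k H f) = s₁ f :=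
  (lift_mk_ι h₁ h₂ hc (0, f, 0)).trans (by simp)

theorem lift_ι₂ (f : Module.Dual k H) : lift ρ s₁ s₂ h₁ h₂ hc (ι₂ k H f) = s₂ f :=
  (lift_mk_ι h₁ h₂ hc (0, 0, f)).trans (by simp)

end

theorem mulMap_tmul (h : H) (f g : Module.Dual k H) :
    mulMap k H (h ⊗ₜ (f ⊗ₜ g)) = ι₀ k H h * (ι₁ k H f * ι₂ k H g) := rfl

theorem mulMap_mem (h : H) (f g : Module.Dual k H) :
    ι₀ k H h * (ι₁ k H f * ι₂ k H g) ∈ LinearMap.range (mulMap k H) := ⟨_, mulMap_tmul h f g⟩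

theorem mem_range_of_tmul {d : EllipticDouble k H}
    (hd : ∀ (h : H) (f g : Module.Dual k H),
      d * (ι₀ k H h * (ι₁ k H f * ι₂ k H g)) ∈ LinearMap.range (mulMap k H))
    {z : EllipticDouble k H} (hz : z ∈ LinearMap.range (mulMap k H)) :
    d * z ∈ LinearMap.range (mulMap k H) := by
  obtain ⟨w, rfl⟩ := hz
  induction w with
  | zero => simp
  | add x y hx hy => rw [map_add, mul_add]; exact Submodule.add_mem _ hx hy
  | tmul h r =>
    induction r with
    | zero => simp
    | add x y hx hy =>
      rw [TensorProduct.tmul_add, map_add, mul_add]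
      exact Submodule.add_mem _ hx hy
    | tmul f g => exact hd h f g

theorem ι₁_mul_mem (f' : Module.Dual k H) {z : EllipticDouble k H}
    (hz : z ∈ LinearMap.range (mulMap k H)) : ι₁ k H f' * z ∈ LinearMap.range (mulMap k H) := by
  refine mem_range_of_tmul (fun h f g => ?_) hz
  obtain ⟨n, a, b, c, e⟩ := exists_sum_tmul_tmul_eq (comul₂ (k := k) h)
  rw [← mul_assoc, isDoubleHom_ι₁.cross f' h n a b c e, Finset.sum_mul]
  refine Submodule.sum_mem _ fun i _ => ?_
  rw [mul_assoc, ← mul_assoc (ι₁ k H _), ← isDoubleHom_ι₁.mul]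
  exact mulMap_mem _ _ _

theorem ι₂_mul_mem (f' : Module.Dual k H) {z : EllipticDouble k H}
    (hz : z ∈ LinearMap.range (mulMap k H)) : ι₂ k H f' * z ∈ LinearMap.range (mulMap k H) := by
  refine mem_range_of_tmul (fun h f g => ?_) hz
  obtain ⟨n, a, b, c, e⟩ := exists_sum_tmul_tmul_eq (comul₂ (k := k) h)
  obtain ⟨m, s, t, hR⟩ := TensorProduct.exists_sum_tmul_eq (Rmat k H)
  rw [← mul_assoc, isDoubleHom_ι₂.cross f' h n a b c e, Finset.sum_mul]
  refine Submodule.sum_mem _ fun i _ => ?_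
  rw [mul_assoc, ← mul_assoc (ι₂ k H _), ι₂_mul_ι₁ _ _ hR, Finset.sum_mul, Finset.mul_sum]
  refine Submodule.sum_mem _ fun j _ => ?_
  rw [Finset.sum_mul, Finset.mul_sum]
  refine Submodule.sum_mem _ fun l _ => ?_
  rw [mul_assoc (ι₁ k H _), ← isDoubleHom_ι₂.mul]
  exact mulMap_mem _ _ _

theorem ι₀_mul_mem (h' : H) {z : EllipticDouble k H}
    (hz : z ∈ LinearMap.range (mulMap k H)) : ι₀ k H h' * z ∈ LinearMap.range (mulMap k H) := by
  refine mem_range_of_tmul (fun h f g => ?_) hz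
  rw [← mul_assoc, ← map_mul]
  exact mulMap_mem _ _ _

theorem mulMap_surjective : Function.Surjective (mulMap k H) := by
  have key : ∀ (x : Pre k H), ∀ z ∈ LinearMap.range (mulMap k H),
      mk k H x * z ∈ LinearMap.range (mulMap k H) := by
    intro x
    induction x using TensorAlgebra.induction with
    | algebraMap r =>
      intro z hz
      rw [AlgHomClass.commutes, ← Algebra.smul_def]
      exact Submodule.smul_mem _ _ hz
    | ι v =>
      intro z hz
      have e : mk k H (TensorAlgebra.ι k v) = ι₀ k H v.1 + ι₁ k H v.2.1 + ι₂ k H v.2.2 := by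
        change _ = mk k H (TensorAlgebra.ι k _) + mk k H (TensorAlgebra.ι k _) +
          mk k H (TensorAlgebra.ι k _)
        rw [← map_add, ← map_add, ← map_add, ← map_add]
        simp
      rw [e, add_mul, add_mul]
      exact Submodule.add_mem _ (Submodule.add_mem _ (ι₀_mul_mem _ hz) (ι₁_mul_mem _ hz))
        (ι₂_mul_mem _ hz)
    | mul a b ha hb =>
      intro z hz
      rw [map_mul, mul_assoc]
      exact ha _ (hb _ hz)
    | add a b ha hb =>
      intro z hz
      rw [map_add, add_mul]
      exact Submodule.add_mem _ (ha _ hz) (hb _ hz)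
  intro d
  obtain ⟨x, rfl⟩ : ∃ x, mk k H x = d := RingQuot.mkAlgHom_surjective k _ d
  have h1 : (1 : EllipticDouble k H) ∈ LinearMap.range (mulMap k H) := by
    refine ⟨1 ⊗ₜ (Coalgebra.counit ⊗ₜ Coalgebra.counit), ?_⟩
    rw [mulMap_tmul, isDoubleHom_ι₁.one, isDoubleHom_ι₂.one, map_one, one_mul, one_mul]
  have := key x 1 h1
  rwa [mul_one] at this

end EllipticDouble

end Lift

section Detect

variable {k H : Type u} [Field k] [Ring H] [HopfAlgebra k H] {E : Type*} [Ring E] [Algebra k E]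

variable (k H) in
/-- The linear map `β ↦ ε ∘ β`. -/
def counitEval : Module.End k H →ₗ[k] Module.Dual k H :=
  LinearMap.llcomp k H H k Coalgebra.counit

/-- The linear map `x ⊗ β ↦ x ⊗ (ε ∘ β)`. -/
def detect : E ⊗[k] Module.End k H →ₗ[k] E ⊗[k] Module.Dual k H := (counitEval k H).lTensor E

@[simp]
theorem detect_tmul (e : E) (β : Module.End k H) :
    detect (e ⊗ₜ β) = e ⊗ₜ[k] (Coalgebra.counit ∘ₗ β : Module.Dual k H) := rfl

/-- Three commuting maps to `E ⊗ (H ⊗ H)`. -/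
theorem commutingMaps_tensor : CommutingMaps
    (Algebra.TensorProduct.includeLeft : E →ₐ[k] E ⊗[k] (H ⊗[k] H))
    (Algebra.TensorProduct.includeRight.comp Algebra.TensorProduct.includeLeft)
    (Algebra.TensorProduct.includeRight.comp Algebra.TensorProduct.includeRight) := by
  refine ⟨fun a b => ?_, fun a b => ?_, fun a b => ?_⟩ <;> simp [Commute, SemiconjBy]

theorem commute_counitHom (a : H) (x : E) : Commute (counitHom k H E a) x := Algebra.commutes _ _

theorem toConv_counitHom : WithConv.toConv (counitHom k H E).toLinearMap = 1 := rfl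

theorem inl_comp_counitHom : (inl k H E).comp (counitHom k H E) = counitHom k H _ := by
  ext a
  exact AlgHomClass.commutes (inl k H E) _

variable (k H E) in
/-- The map `a ⊗ b ↦ ε(a) ε(b)`. -/
def counitHom₂ : H ⊗[k] H →ₐ[k] E :=
  Algebra.TensorProduct.lift (counitHom k H E) (counitHom k H E) fun _ _ => commute_counitHom _ _

theorem counitHom₂_tmul (a b : H) :
    counitHom₂ k H E (a ⊗ₜ b) = counitHom k H E a * counitHom k H E b :=
  Algebra.TensorProduct.lift_tmul _ _ _ _ _

theorem commute_counitHom₂ (x : E) (r : H ⊗[k] H) : Commute x (counitHom₂ k H E r) := by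
  induction r with
  | zero => simp
  | add a b ha hb => rw [map_add]; exact ha.add_right hb
  | tmul a b =>
    rw [counitHom₂_tmul]
    exact (commute_counitHom a x).symm.mul_right (commute_counitHom b x).symm

variable (k H E) in
/-- The map `e ⊗ a ⊗ b ↦ ε(a) ε(b) e`. -/
def collapse : E ⊗[k] (H ⊗[k] H) →ₐ[k] E :=
  Algebra.TensorProduct.lift (AlgHom.id k E) (counitHom₂ k H E) commute_counitHom₂

theorem collapse_tmul (e : E) (a b : H) : collapse k H E (e ⊗ₜ (a ⊗ₜ b)) =
    e * (counitHom k H E a * counitHom k H E b) := by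
  rw [← counitHom₂_tmul]
  exact Algebra.TensorProduct.lift_tmul _ _ _ _ _

theorem collapse_comp_includeLeft : (collapse k H E).comp
    (Algebra.TensorProduct.includeLeft : E →ₐ[k] E ⊗[k] (H ⊗[k] H)) = AlgHom.id k E := by
  ext e
  simp [Algebra.TensorProduct.one_def, collapse_tmul]

theorem collapse_comp_left : (collapse k H E).comp
    ((Algebra.TensorProduct.includeRight : H ⊗[k] H →ₐ[k] E ⊗[k] (H ⊗[k] H)).comp
      Algebra.TensorProduct.includeLeft) = counitHom k H E := by
  ext a
  simp [collapse_tmul]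

theorem collapse_comp_right : (collapse k H E).comp
    ((Algebra.TensorProduct.includeRight : H ⊗[k] H →ₐ[k] E ⊗[k] (H ⊗[k] H)).comp
      Algebra.TensorProduct.includeRight) = counitHom k H E := by
  ext a
  simp [collapse_tmul]

theorem collapse_coindRep (ρ : H →ₐ[k] E) :
    (collapse k H E).comp (coindRep ρ (commutingMaps_tensor (k := k) (H := H))) = ρ := by
  apply AlgHom.toLinearMap_injective
  apply WithConv.toConv_injective
  refine (toConv_map_coindRep ρ commutingMaps_tensor (collapse k H E)).trans ?_
  rw [collapse_comp_left, collapse_comp_right, ← AlgHom.comp_assoc, collapse_comp_includeLeft,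
    toConv_counitHom, one_mul, mul_one]
  rfl

section

variable [Module.Finite k H]

theorem detect_contract_cofreeLeg (f : Module.Dual k H) :
    detect (contract f (mapLeg H (Algebra.TensorProduct.includeRight :
      Module.End k H →ₐ[k] E ⊗[k] Module.End k H) (cofreeLeg k H))) = 1 ⊗ₜ f := by
  rw [contract_mapLeg, contract_cofreeLeg, Algebra.TensorProduct.includeRight_apply, detect_tmul]
  congr 1
  ext b
  have : ∀ z : H ⊗[k] H, Coalgebra.counit (R := k) (contract f z) =
      f (TensorProduct.lid k H (Coalgebra.counit.rTensor H z)) := by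
    intro z
    induction z with
    | zero => simp
    | add x y hx hy => simp only [map_add, hx, hy]
    | tmul a b => simp [mul_comm]
  rw [LinearMap.comp_apply, translate_apply, this, Coalgebra.rTensor_counit_comul]
  simp

end

variable [QuasiTriangular k H]

theorem pair_counit_left_Rinv (γ : H →ₐ[k] E) :
    pair (counitHom k H E).toLinearMap γ.toLinearMap (Rinv k H) = 1 := by
  have := pair_inv_mul (α := counitHom k H E) (β := γ) fun a b => Algebra.commutes _ _
  rwa [pair_counit_left, mul_one] at this

theorem coindLeg_counitHom (L : E ⊗[k] H) :
    coindLeg (AlgHom.id k E) (counitHom k H E) (counitHom k H E) L = L := by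
  have : mapLeg H (AlgHom.id k E) L = L := by
    simp [mapLeg]
  rw [coindLeg, inl_comp_counitHom, pair_counit_right, pair_counit_left_Rinv, this, one_mul,
    mul_one]

theorem collapse_contract_coindLeg (L : E ⊗[k] H) (f : Module.Dual k H) :
    collapse k H E (contract f (coindLeg
      (Algebra.TensorProduct.includeLeft : E →ₐ[k] E ⊗[k] (H ⊗[k] H))
      (Algebra.TensorProduct.includeRight.comp Algebra.TensorProduct.includeLeft)
      (Algebra.TensorProduct.includeRight.comp Algebra.TensorProduct.includeRight) L)) =
    contract f L := by
  rw [← contract_mapLeg, mapLeg_coindLeg, collapse_comp_left, collapse_comp_right,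
    collapse_comp_includeLeft, coindLeg_counitHom]

variable [Module.Finite k H]


theorem commute_lmul_antipodeInvRep (a b : H) :
    Commute (Algebra.lmul k H a) (antipodeInvRep k H b) := by
  ext c
  simp [mul_assoc]

variable (k H) in
/-- Left multiplications and right multiplications by `S⁻¹`. -/
def leftRightHom : H ⊗[k] H →ₐ[k] Module.End k H :=
  Algebra.TensorProduct.lift (Algebra.lmul k H) (antipodeInvRep k H) commute_lmul_antipodeInvRep

theorem leftRightHom_tmul (a b : H) :
    leftRightHom k H (a ⊗ₜ b) = Algebra.lmul k H a * antipodeInvRep k H b :=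
  Algebra.TensorProduct.lift_tmul _ _ _ _ _

variable (k H E) in
/-- The map from `E ⊗ H ⊗ H` to `E ⊗ End(H)`. -/
def spread : E ⊗[k] (H ⊗[k] H) →ₐ[k] E ⊗[k] Module.End k H :=
  Algebra.TensorProduct.map (AlgHom.id k E) (leftRightHom k H)

theorem detect_spread_mul (u : E ⊗[k] (H ⊗[k] H)) (z : E ⊗[k] Module.End k H) :
    detect (spread k H E u * z) =
      (LinearMap.mulLeft k (collapse k H E u)).rTensor _ (detect z) := by
  induction u with
  | zero => simp [LinearMap.mulLeft_zero_eq_zero]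
  | add x y hx hy =>
    rw [map_add, add_mul, map_add, hx, hy, map_add, ← LinearMap.add_apply, ← LinearMap.rTensor_add]
    congr 2
    ext
    simp [add_mul]
  | tmul e r =>
    induction r with
    | zero => simp [LinearMap.mulLeft_zero_eq_zero]
    | add x y hx hy =>
      rw [TensorProduct.tmul_add, map_add, add_mul, map_add, hx, hy, map_add,
        ← LinearMap.add_apply, ← LinearMap.rTensor_add]
      congr 2
      ext
      simp [add_mul]
    | tmul a b =>
      induction z with
      | zero => simp
      | add x y hx hy => simp only [mul_add, map_add, hx, hy]
      | tmul x β =>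
        rw [collapse_tmul]
        have e1 : (Coalgebra.counit ∘ₗ (leftRightHom k H (a ⊗ₜ b) * β) : Module.Dual k H) =
            (Coalgebra.counit (R := k) a * Coalgebra.counit (R := k) b) •
              (Coalgebra.counit ∘ₗ β : Module.Dual k H) := by
          ext c
          simp only [Module.End.mul_apply, leftRightHom_tmul, LinearMap.comp_apply,
            antipodeInvRep_apply, LinearMap.smul_apply, smul_eq_mul]
          change Coalgebra.counit (R := k) (a * (β c * antipodeInv k b)) = _
          rw [Bialgebra.counit_mul, Bialgebra.counit_mul, counit_antipodeInv]
          ring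
        have e2 : counitHom k H E a * counitHom k H E b =
            algebraMap k E (Coalgebra.counit (R := k) a * Coalgebra.counit (R := k) b) :=
          (map_mul (algebraMap k E) _ _).symm
        simp only [spread, Algebra.TensorProduct.map_tmul, AlgHom.id_apply,
          Algebra.TensorProduct.tmul_mul_tmul, detect_tmul, LinearMap.rTensor_tmul,
          LinearMap.mulLeft_apply, e1, e2, TensorProduct.tmul_smul, TensorProduct.smul_tmul']
        rw [← Algebra.commutes, ← Algebra.smul_def, smul_mul_assoc]

theorem spread_comp_includeLeft : (spread k H E).comp
    (Algebra.TensorProduct.includeLeft : E →ₐ[k] E ⊗[k] (H ⊗[k] H)) =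
      Algebra.TensorProduct.includeLeft := by
  ext e
  simp [spread]

theorem spread_comp_left : (spread k H E).comp
    ((Algebra.TensorProduct.includeRight : H ⊗[k] H →ₐ[k] E ⊗[k] (H ⊗[k] H)).comp
      Algebra.TensorProduct.includeLeft) =
      Algebra.TensorProduct.includeRight.comp (Algebra.lmul k H) := by
  ext a
  simp [spread, leftRightHom_tmul]

theorem spread_comp_right : (spread k H E).comp
    ((Algebra.TensorProduct.includeRight : H ⊗[k] H →ₐ[k] E ⊗[k] (H ⊗[k] H)).comp
      Algebra.TensorProduct.includeRight) =
      Algebra.TensorProduct.includeRight.comp (antipodeInvRep k H) := by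
  ext a
  have : (LinearMap.mul k H 1 : Module.End k H) = 1 := by ext; simp
  simp [spread, leftRightHom_tmul, this]

theorem spread_coindRep (ρ : H →ₐ[k] E) :
    (spread k H E).comp (coindRep ρ (commutingMaps_tensor (k := k) (H := H))) =
      coindRep ρ commutingMaps_end := by
  apply AlgHom.toLinearMap_injective
  apply WithConv.toConv_injective
  refine (toConv_map_coindRep ρ commutingMaps_tensor (spread k H E)).trans ?_
  rw [spread_comp_left, spread_comp_right, ← AlgHom.comp_assoc, spread_comp_includeLeft,
    toConv_coindRep]

/-- Elements of `E ⊗ End(H)` which `detect` turns into left multiplication by `e`. -/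
def DetectsAs (u : E ⊗[k] Module.End k H) (e : E) : Prop :=
  ∀ z, detect (u * z) = (LinearMap.mulLeft k e).rTensor _ (detect z)

theorem detectsAs_coindRep (ρ : H →ₐ[k] E) (h : H) :
    DetectsAs (coindRep ρ (commutingMaps_end (k := k) (H := H)) h) (ρ h) := by
  intro z
  rw [← spread_coindRep, AlgHom.comp_apply, detect_spread_mul, ← AlgHom.comp_apply,
    collapse_coindRep]

theorem detectsAs_coindLeg (L : E ⊗[k] H) (f : Module.Dual k H) :
    DetectsAs (contract f (coindLeg (Algebra.TensorProduct.includeLeft : E →ₐ[k] E ⊗[k] _)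
    (Algebra.TensorProduct.includeRight.comp (Algebra.lmul k H))
    (Algebra.TensorProduct.includeRight.comp (antipodeInvRep k H)) L)) (contract f L) := by
  intro z
  rw [← collapse_contract_coindLeg L f, ← detect_spread_mul, ← contract_mapLeg, mapLeg_coindLeg,
    spread_comp_left, spread_comp_right, spread_comp_includeLeft]

/-- A product `h f g` in `(H ⊗ End(H)) ⊗ End(H)` determines `h ⊗ f ⊗ g`. -/
theorem EllipticDouble.mulMap_injective : Function.Injective (mulMap k H) := by
  let ρ₁ := coindRep (AlgHom.id k H) (commutingMaps_end (k := k) (H := H) (E := H))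
  let L : (H ⊗[k] Module.End k H) ⊗[k] H :=
    mapLeg H (F := H ⊗[k] Module.End k H) Algebra.TensorProduct.includeRight (cofreeLeg k H)
  have hL : IsYD ρ₁ L := isYD_cofree _
  let ρ₂ := coindRep ρ₁ (commutingMaps_end (k := k) (H := H))
  let L₁ : ((H ⊗[k] Module.End k H) ⊗[k] Module.End k H) ⊗[k] H :=
    coindLeg (F := (H ⊗[k] Module.End k H) ⊗[k] Module.End k H) (Algebra.TensorProduct.includeLeft :
    H ⊗[k] Module.End k H →ₐ[k] (H ⊗[k] Module.End k H) ⊗[k] Module.End k H)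
    (Algebra.TensorProduct.includeRight.comp (Algebra.lmul k H))
    (Algebra.TensorProduct.includeRight.comp (antipodeInvRep k H)) L
  let L₂ : ((H ⊗[k] Module.End k H) ⊗[k] Module.End k H) ⊗[k] H :=
    mapLeg H (F := (H ⊗[k] Module.End k H) ⊗[k] Module.End k H)
      Algebra.TensorProduct.includeRight (cofreeLeg k H)
  have h₁ : IsYD ρ₂ L₁ := hL.coind commutingMaps_end
  have h₂ : IsYD ρ₂ L₂ := isYD_cofree _
  have hE := (cofreeRules_end (k := k) (H := H) (E := H ⊗[k] Module.End k H)).isExchange L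
  let φ := lift ρ₂ (contractMap L₁) (contractMap L₂) ((isDoubleHom_contractMap _ _).2 h₁)
    ((isDoubleHom_contractMap _ _).2 h₂) fun f g n s t hR => (isExchange_iff _ _ hR).1 hE f g
  let ψ : EllipticDouble k H →ₗ[k] H ⊗[k] (Module.Dual k H ⊗[k] Module.Dual k H) :=
    (TensorProduct.assoc k _ _ _).toLinearMap ∘ₗ detect.rTensor _ ∘ₗ detect ∘ₗ φ.toLinearMap
  have key : ψ ∘ₗ mulMap k H = LinearMap.id := by
    refine TensorProduct.ext (LinearMap.ext fun h => TensorProduct.ext' fun f g => ?_)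
    change ψ (mulMap k H (h ⊗ₜ (f ⊗ₜ g))) = h ⊗ₜ (f ⊗ₜ g)
    have e : φ (mulMap k H (h ⊗ₜ (f ⊗ₜ g))) = ρ₂ h * (contract f L₁ * contract g L₂) := by
      rw [mulMap_tmul, map_mul, map_mul, lift_ι₀, lift_ι₁, lift_ι₂]
      rfl
    have e1 : detect (ρ₂ h * (contract f L₁ * contract g L₂)) = (ρ₁ h * contract f L) ⊗ₜ g := by
      rw [detectsAs_coindRep, detectsAs_coindLeg, detect_contract_cofreeLeg]
      simp
    have e2 : detect (ρ₁ h * contract f L) = h ⊗ₜ f := by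
      rw [detectsAs_coindRep, detect_contract_cofreeLeg]
      simp
    simp only [ψ, LinearMap.comp_apply, AlgHom.toLinearMap_apply, e, e1, LinearMap.rTensor_tmul, e2]
    simp
  exact Function.LeftInverse.injective (g := ψ) fun x => LinearMap.congr_fun key x

end Detect

end EllipticDrinfeld

end

noncomputable section

namespace EllipticDrinfeld

open FDMod

section LegAct

variable {k : Type u} {K U V W : Type u} [Field k] [Ring K] [Algebra k K] [AddCommGroup U]
  [Module k U] [AddCommGroup V] [Module k V] [AddCommGroup W] [Module k W]

/-- The componentwise action of `End(U) ⊗ K` on `U ⊗ V`. -/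
def legAct (σ : K →ₐ[k] Module.End k V) :
    Module.End k U ⊗[k] K →ₐ[k] Module.End k (U ⊗[k] V) :=
  (Module.endTensorEndAlgHom (R := k) (S := k) (A := k) (M := U) (N := V)).comp
    (Algebra.TensorProduct.map (AlgHom.id k _) σ)

@[simp]
theorem legAct_tmul (σ : K →ₐ[k] Module.End k V) (e : Module.End k U) (a : K) :
    legAct σ (e ⊗ₜ a) = TensorProduct.map e (σ a) := by
  simp only [legAct, AlgHom.comp_apply, Algebra.TensorProduct.map_tmul, AlgHom.id_apply]
  exact Module.endTensorEndAlgHom_apply _ _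

theorem contract_legAct_one (f : Module.Dual k K) (z : Module.End k U ⊗[k] K) (x : U) :
    contract f (legAct (Algebra.lmul k K) z (x ⊗ₜ[k] 1)) = contract f z x := by
  induction z with
  | zero => simp
  | add x y hx hy => simp only [map_add, LinearMap.add_apply, hx, hy]
  | tmul e v => simp

theorem legAct_ext [Module.Finite k K] {z w : Module.End k U ⊗[k] K}
    (h : ∀ x : U, legAct (Algebra.lmul k K) z (x ⊗ₜ[k] 1) =
      legAct (Algebra.lmul k K) w (x ⊗ₜ[k] 1)) : z = w :=
  contract_ext fun f => LinearMap.ext fun x => by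
    rw [← contract_legAct_one, h, contract_legAct_one]

theorem map_legAct {σ : K →ₐ[k] Module.End k V} {τ : K →ₐ[k] Module.End k W} {g : V →ₗ[k] W}
    (hg : ∀ a, g ∘ₗ σ a = τ a ∘ₗ g) (z : Module.End k U ⊗[k] K) (y : U ⊗[k] V) :
    TensorProduct.map LinearMap.id g (legAct σ z y) =
      legAct τ z (TensorProduct.map LinearMap.id g y) := by
  induction z with
  | zero => simp
  | add x y hx hy => simp only [map_add, LinearMap.add_apply, hx, hy]
  | tmul e a =>
    rw [legAct_tmul, legAct_tmul, ← LinearMap.comp_apply, ← LinearMap.comp_apply,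
      ← TensorProduct.map_comp, ← TensorProduct.map_comp, hg]
    rfl

/-- The map `V ⊗ U → U ⊗ V` that swaps the factors and acts with an element of `End(U) ⊗ K`. -/
def swapAct (σ : K →ₐ[k] Module.End k V) (L : Module.End k U ⊗[k] K) : V ⊗[k] U →ₗ[k] U ⊗[k] V :=
  legAct σ L ∘ₗ (TensorProduct.comm k V U).toLinearMap

@[simp]
theorem swapAct_tmul (σ : K →ₐ[k] Module.End k V) (L : Module.End k U ⊗[k] K) (a : V) (x : U) :
    swapAct σ L (a ⊗ₜ[k] x) = legAct σ L (x ⊗ₜ[k] a) := rfl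

end LegAct

section LegActHopf

variable {k H : Type u} {U V W : Type u} [Field k] [Ring H] [HopfAlgebra k H] [AddCommGroup U]
  [Module k U] [AddCommGroup V] [Module k V] [AddCommGroup W] [Module k W]

theorem act₂_lmul : act₂ (Algebra.lmul k H) (Algebra.lmul k H) = Algebra.lmul k (H ⊗[k] H) :=
  Algebra.TensorProduct.ext' fun a b => TensorProduct.ext' fun c d => by simp

theorem legAct_tensorRep (σ : H →ₐ[k] Module.End k V) (τ : H →ₐ[k] Module.End k W)
    (L : Module.End k U ⊗[k] H) :
    legAct (tensorRep σ τ) L = legAct (act₂ σ τ) (comulLeg k H _ L) := by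
  induction L with
  | zero => simp
  | add x y hx hy => simp only [map_add, hx, hy]
  | tmul e a => simp

theorem legAct_mul_tmul (σ : H →ₐ[k] Module.End k V) (τ : H →ₐ[k] Module.End k W)
    (L M : Module.End k U ⊗[k] H) (a : V) (b : W) (x : U) :
    TensorProduct.assoc k U V W (TensorProduct.map (swapAct σ L) LinearMap.id
      ((TensorProduct.assoc k V U W).symm (a ⊗ₜ[k] swapAct τ M (b ⊗ₜ[k] x)))) =
    legAct (act₂ σ τ) (inLeg₁ k H _ L * inLeg₂ k H _ M) (x ⊗ₜ[k] (a ⊗ₜ[k] b)) := by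
  induction M with
  | zero => simp
  | add x y hx hy =>
    simp only [swapAct_tmul] at hx hy ⊢
    simp only [map_add, mul_add, LinearMap.add_apply, TensorProduct.tmul_add, hx, hy]
  | tmul e c =>
    induction L with
    | zero => simp
    | add x y hx hy =>
      simp only [swapAct_tmul, legAct_tmul, TensorProduct.map_tmul,
        TensorProduct.assoc_symm_tmul] at hx hy ⊢
      simp only [map_add, add_mul, LinearMap.add_apply, TensorProduct.add_tmul, hx, hy]
    | tmul e' c' => simp

theorem map_act₂_eq_legAct (σ : H →ₐ[k] Module.End k V) (τ : H →ₐ[k] Module.End k W)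
    (r : H ⊗[k] H) (y : U ⊗[k] (V ⊗[k] W)) :
    TensorProduct.map LinearMap.id (act₂ σ τ r) y = legAct (act₂ σ τ) (inLegs k H _ r) y := by
  rw [inLegs_apply, legAct_tmul]
  rfl

theorem act₂_eq_legAct (ρ : H →ₐ[k] Module.End k U) (σ : H →ₐ[k] Module.End k V) (r : H ⊗[k] H) :
    act₂ ρ σ r = legAct σ
      (pair ((inl k H _).toLinearMap ∘ₗ ρ.toLinearMap) (inr k H _).toLinearMap r) := by
  induction r with
  | zero => simp
  | add x y hx hy => simp only [map_add, hx, hy]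
  | tmul a b => simp

theorem act₂_comm_eq_legAct (ρ : H →ₐ[k] Module.End k U) (σ : H →ₐ[k] Module.End k V)
    (r : H ⊗[k] H) :
    act₂ ρ σ (TensorProduct.comm k H H r) = legAct σ
      (pair (inr k H _).toLinearMap ((inl k H _).toLinearMap ∘ₗ ρ.toLinearMap) r) := by
  induction r with
  | zero => simp
  | add x y hx hy => simp only [map_add, hx, hy]
  | tmul a b => simp

theorem swapAct_tensorRep {ρ : H →ₐ[k] Module.End k U} (σ : H →ₐ[k] Module.End k V)
    (L : Module.End k U ⊗[k] H) (h : H) (v : V ⊗[k] U) :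
    swapAct σ L (tensorRep σ ρ h v) = legAct σ (L * pair (inr k H _).toLinearMap
        ((inl k H _).toLinearMap ∘ₗ ρ.toLinearMap) (Coalgebra.comul (R := k) h))
      (TensorProduct.comm k V U v) := by
  rw [map_mul, ← act₂_comm_eq_legAct]
  exact congrArg (legAct σ L) (comm_act₂ σ ρ _ v)

theorem tensorRep_swapAct {ρ : H →ₐ[k] Module.End k U} (σ : H →ₐ[k] Module.End k V)
    (L : Module.End k U ⊗[k] H) (h : H) (v : V ⊗[k] U) :
    tensorRep ρ σ h (swapAct σ L v) = legAct σ (pair ((inl k H _).toLinearMap ∘ₗ ρ.toLinearMap)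
        (inr k H _).toLinearMap (Coalgebra.comul (R := k) h) * L)
      (TensorProduct.comm k V U v) := by
  rw [map_mul, ← act₂_eq_legAct]
  rfl

variable (k H U) in
/-- `e ⊗ a ⊗ b ↦ e ⊗ b ⊗ a` -/
def swapLegs : Module.End k U ⊗[k] (H ⊗[k] H) →ₐ[k] Module.End k U ⊗[k] (H ⊗[k] H) :=
  Algebra.TensorProduct.map (AlgHom.id k _) (Algebra.TensorProduct.comm k H H).toAlgHom

@[simp]
theorem swapLegs_tmul (e : Module.End k U) (r : H ⊗[k] H) :
    swapLegs k H U (e ⊗ₜ r) = e ⊗ₜ TensorProduct.comm k H H r := rfl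

theorem swapLegs_inLeg₁ (L : Module.End k U ⊗[k] H) :
    swapLegs k H U (inLeg₁ k H _ L) = inLeg₂ k H _ L := by
  induction L with
  | zero => simp
  | add x y hx hy => simp only [map_add, hx, hy]
  | tmul e a => simp

theorem swapLegs_inLeg₂ (L : Module.End k U ⊗[k] H) :
    swapLegs k H U (inLeg₂ k H _ L) = inLeg₁ k H _ L := by
  induction L with
  | zero => simp
  | add x y hx hy => simp only [map_add, hx, hy]
  | tmul e a => simp

theorem map_comm_legAct (σ : H →ₐ[k] Module.End k V) (τ : H →ₐ[k] Module.End k W)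
    (z : Module.End k U ⊗[k] (H ⊗[k] H)) (x : U) (w : V ⊗[k] W) :
    TensorProduct.map LinearMap.id (TensorProduct.comm k V W).toLinearMap
        (legAct (act₂ σ τ) z (x ⊗ₜ[k] w)) =
      legAct (act₂ τ σ) (swapLegs k H U z) (x ⊗ₜ[k] TensorProduct.comm k V W w) := by
  induction z with
  | zero => simp
  | add x y hx hy => simp only [map_add, LinearMap.add_apply, hx, hy]
  | tmul e r => simp [comm_act₂]

end LegActHopf

section Inverse

variable {k H : Type u} {E : Type*} [Field k] [Ring H] [HopfAlgebra k H] [Ring E] [Algebra k E]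

theorem convMul_counit : convMul Coalgebra.counit Coalgebra.counit =
    (Coalgebra.counit : H →ₗ[k] k) := by
  refine LinearMap.ext fun a => ?_
  have h : TensorProduct.map Coalgebra.counit Coalgebra.counit (Coalgebra.comul (R := k) a) =
      Coalgebra.counit.lTensor k (Coalgebra.counit.rTensor H (Coalgebra.comul (R := k) a)) := by
    rw [← LinearMap.comp_apply (LinearMap.lTensor k _), LinearMap.lTensor_comp_rTensor]
  rw [convMul, LinearMap.comp_apply, LinearMap.comp_apply, h, Coalgebra.rTensor_counit_comul]
  simp

theorem lTensor_comulLeg (φ : H ⊗[k] H →ₗ[k] H)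
    (hφ : ∀ a, φ (Coalgebra.comul (R := k) a) = algebraMap k H (Coalgebra.counit a))
    {L : E ⊗[k] H} (h : contract Coalgebra.counit L = 1) : φ.lTensor E (comulLeg k H E L) = 1 := by
  have : φ.lTensor E (comulLeg k H E L) = inl k H E (contract Coalgebra.counit L) := by
    clear h
    induction L with
    | zero => simp
    | add x y hx hy => simp only [map_add, hx, hy]
    | tmul e a =>
      simp [hφ, Algebra.algebraMap_eq_smul_one]
  rw [this, h, map_one]

theorem antipode_lTensor_mul {L : E ⊗[k] H} (h : contract Coalgebra.counit L = 1)
    (hm : comulLeg k H E L = inLeg₁ k H E L * inLeg₂ k H E L) :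
    (HopfAlgebra.antipode k).lTensor E L * L = 1 := by
  rw [← lTensor_comulLeg (LinearMap.mul' k H ∘ₗ (HopfAlgebra.antipode k).rTensor H)
    (fun a => HopfAlgebra.mul_antipode_rTensor_comul_apply a) h, hm]
  generalize hM : L = M
  nth_rw 1 [← hM]; nth_rw 2 [← hM]
  clear hM h hm
  induction L with
  | zero => simp
  | add x y hx hy => simp only [map_add, add_mul, hx, hy]
  | tmul a b =>
    induction M with
    | zero => simp
    | add x y hx hy => simp only [map_add, mul_add, hx, hy]
    | tmul c d => simp

theorem mul_antipode_lTensor {L : E ⊗[k] H} (h : contract Coalgebra.counit L = 1)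
    (hm : comulLeg k H E L = inLeg₁ k H E L * inLeg₂ k H E L) :
    L * (HopfAlgebra.antipode k).lTensor E L = 1 := by
  rw [← lTensor_comulLeg (LinearMap.mul' k H ∘ₗ (HopfAlgebra.antipode k).lTensor H)
    (fun a => HopfAlgebra.mul_antipode_lTensor_comul_apply a) h, hm]
  generalize hM : L = M
  nth_rw 1 [← hM]; nth_rw 2 [← hM]
  clear hM h hm
  induction L with
  | zero => simp
  | add x y hx hy => simp only [map_add, add_mul, hx, hy]
  | tmul a b =>
    induction M with
    | zero => simp
    | add x y hx hy => simp only [map_add, mul_add, hx, hy]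
    | tmul c d => simp

/-- The isomorphism `V ⊗ U ≅ U ⊗ V` attached to an element of `End(U) ⊗ H` that is compatible with
the comultiplication. -/
def swapActEquiv {U V : Type u} [AddCommGroup U] [Module k U] [AddCommGroup V] [Module k V]
    (σ : H →ₐ[k] Module.End k V) {L : Module.End k U ⊗[k] H}
    (h : contract Coalgebra.counit L = 1)
    (hm : comulLeg k H _ L = inLeg₁ k H _ L * inLeg₂ k H _ L) : V ⊗[k] U ≃ₗ[k] U ⊗[k] V :=
  LinearEquiv.ofLinearMap (swapAct σ L) ((TensorProduct.comm k V U).symm.toLinearMap ∘ₗ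
      legAct σ ((HopfAlgebra.antipode k).lTensor _ L))
    (LinearMap.ext fun v => by
      simp only [swapAct, LinearMap.comp_apply, LinearEquiv.coe_coe, LinearMap.id_apply,
        LinearEquiv.apply_symm_apply]
      rw [← Module.End.mul_apply, ← map_mul, mul_antipode_lTensor h hm, map_one,
        Module.End.one_apply])
    (LinearMap.ext fun v => by
      simp only [swapAct, LinearMap.comp_apply, LinearEquiv.coe_coe, LinearMap.id_apply]
      rw [← Module.End.mul_apply, ← map_mul, antipode_lTensor_mul h hm, map_one,
        Module.End.one_apply, LinearEquiv.symm_apply_apply])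

end Inverse

section HalfBraiding

variable {k H : Type u} [Field k] [Ring H] [HopfAlgebra k H]

/-- The morphism from the regular module that takes `1` to `a`. -/
def orbit [Module.Finite k H] {A : FDMod k H} (a : A.V) : regular k H ⟶ A :=
  Hom.mk (X := regular k H) (Y := A) (LinearMap.applyₗ a ∘ₗ A.ρ.toLinearMap) fun b =>
    LinearMap.ext fun c => LinearMap.congr_fun (map_mul A.ρ b c) a

/-- The half-braiding attached to an element of `End(X) ⊗ H`. -/
def halfBraidingOf {X : FDMod k H} {L : Module.End k X.V ⊗[k] H} (h : IsYD X.ρ L) :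
    LeftHalfBraiding X where
  β A := isoMk (X := tensor A X) (Y := tensor X A) (swapActEquiv A.ρ h.one h.mul)
    fun a => LinearMap.ext fun v => by
      refine (swapAct_tensorRep (ρ := X.ρ) A.ρ L a v).trans
        (Eq.trans ?_ (tensorRep_swapAct (ρ := X.ρ) A.ρ L a v).symm)
      rw [crosses_iff.1 h.cross]
  naturality {A B} f := hom_ext₂ fun a x =>
    (map_legAct (U := X.V) (g := toLin f) (Hom.comm f) L (x ⊗ₜ[k] a)).symm
  monoidal A B := hom_ext₃ fun a b x => by
    refine Eq.trans ?_ (legAct_mul_tmul A.ρ B.ρ L L a b x).symm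
    rw [← h.mul, ← legAct_tensorRep]
    rfl

variable [Module.Finite k H]

theorem dualAct_halfBraidingOf {X : FDMod k H} {L : Module.End k X.V ⊗[k] H} (h : IsYD X.ρ L) :
    dualAct (halfBraidingOf h) = contractMap L :=
  LinearMap.ext fun f => LinearMap.ext fun x => contract_legAct_one f L x

namespace LeftHalfBraiding

variable {X : FDMod k H} (l : LeftHalfBraiding X)

/-- The element of `End(X) ⊗ H` attached to a half-braiding. -/
def element : Module.End k X.V ⊗[k] H := ofDual (dualAct l)

theorem contractMap_element : contractMap l.element = dualAct l := contractMap_ofDual _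

theorem toLin_β_regular (x : X.V) :
    toLin (l.β (regular k H)).hom ((1 : H) ⊗ₜ[k] x : H ⊗[k] X.V) =
      (legAct (Algebra.lmul k H) l.element (x ⊗ₜ[k] 1) : X.V ⊗[k] H) := by
  refine contract_ext (k := k) (E := X.V) (V := H) fun f => ?_
  rw [contract_legAct_one, ← contractMap_apply, contractMap_element]
  rfl

theorem toLin_β_tmul (A : FDMod k H) (a : A.V) (x : X.V) :
    toLin (l.β A).hom (a ⊗ₜ[k] x : A.V ⊗[k] X.V) =
      (legAct A.ρ l.element (x ⊗ₜ[k] a) : X.V ⊗[k] A.V) := by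
  have h := LinearMap.congr_fun (congrArg toLin (l.naturality (orbit a)))
    ((1 : H) ⊗ₜ[k] x : H ⊗[k] X.V)
  have h1 : toLin (orbit a ▷ X ≫ (l.β A).hom) ((1 : H) ⊗ₜ[k] x : H ⊗[k] X.V) =
      toLin (l.β A).hom (A.ρ 1 a ⊗ₜ[k] x : A.V ⊗[k] X.V) := rfl
  have h2 : toLin ((l.β (regular k H)).hom ≫ X ◁ orbit a) ((1 : H) ⊗ₜ[k] x : H ⊗[k] X.V) =
      TensorProduct.map LinearMap.id (toLin (orbit a))
        (toLin (l.β (regular k H)).hom ((1 : H) ⊗ₜ[k] x : H ⊗[k] X.V)) := rfl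
  rw [h1, h2, toLin_β_regular, map_one, Module.End.one_apply] at h
  refine h.trans ((map_legAct (U := X.V) (Hom.comm (orbit a)) l.element (x ⊗ₜ[k] (1 : H))).trans ?_)
  refine congrArg (fun y => legAct A.ρ l.element (x ⊗ₜ y)) (?_ : A.ρ 1 a = a)
  rw [map_one, Module.End.one_apply]

theorem toLin_β (A : FDMod k H) : toLin (l.β A).hom = swapAct A.ρ l.element :=
  TensorProduct.ext' fun a x => l.toLin_β_tmul A a x

theorem toLin_β_eq_sum {ι : Type*} [Fintype ι] (b : Module.Basis ι k H) (A : FDMod k H) (a : A.V)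
    (x : X.V) : toLin (l.β A).hom (a ⊗ₜ[k] x : A.V ⊗[k] X.V) =
      (∑ i, dualAct l (b.coord i) x ⊗ₜ[k] A.ρ (b i) a : X.V ⊗[k] A.V) := by
  rw [toLin_β_tmul]
  nth_rw 1 [← sum_contract_tmul b l.element]
  simp only [map_sum, LinearMap.sum_apply, legAct_tmul, TensorProduct.map_tmul,
    ← contractMap_apply, contractMap_element]
  rfl

theorem ext_dualAct {l m : LeftHalfBraiding X} (h : dualAct l = dualAct m) : l = m := by
  refine LeftHalfBraiding.ext (funext fun A => Iso.ext (toLin_injective ?_))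
  rw [toLin_β, toLin_β, element, element, h]

theorem legAct_two (l₁ l₂ : LeftHalfBraiding X) (A B : FDMod k H) (a : A.V) (b : B.V) (x : X.V) :
    toLin ((α_ A B X).hom ≫ A ◁ (l₂.β B).hom ≫ (α_ A X B).inv ≫ (l₁.β A).hom ▷ B ≫ (α_ X A B).hom)
      ((a ⊗ₜ[k] b) ⊗ₜ[k] x : (A.V ⊗[k] B.V) ⊗[k] X.V) =
    (legAct (act₂ A.ρ B.ρ) (inLeg₁ k H _ l₁.element * inLeg₂ k H _ l₂.element)
      (x ⊗ₜ[k] (a ⊗ₜ[k] b)) : X.V ⊗[k] (A.V ⊗[k] B.V)) := by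
  rw [← legAct_mul_tmul, ← toLin_β, ← toLin_β]
  rfl

theorem comulLeg_element : comulLeg k H _ l.element =
    inLeg₁ k H _ l.element * inLeg₂ k H _ l.element := by
  refine legAct_ext fun x => ?_
  have h := LinearMap.congr_fun (congrArg toLin (l.monoidal (regular k H) (regular k H)))
    (((1 : H) ⊗ₜ[k] (1 : H)) ⊗ₜ[k] x : (H ⊗[k] H) ⊗[k] X.V)
  rw [← act₂_lmul, ← legAct_tensorRep]
  exact (l.toLin_β_tmul (regular k H ⊗ regular k H) ((1 : H) ⊗ₜ[k] (1 : H) : H ⊗[k] H) x).symm.trans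
    (h.trans (legAct_two l l (regular k H) (regular k H) (1 : H) (1 : H) x))

theorem toLin_β_unit (x : X.V) : toLin (l.β (unit k H)).hom ((1 : k) ⊗ₜ[k] x : k ⊗[k] X.V) =
    (dualAct l Coalgebra.counit x ⊗ₜ[k] 1 : X.V ⊗[k] k) := by
  refine (l.toLin_β_tmul (unit k H) (1 : k) x).trans ?_
  rw [← contractMap_element, contractMap_apply]
  change legAct (unitRep k H) l.element (x ⊗ₜ[k] (1 : k)) = _
  generalize l.element = z
  induction z with
  | zero => simp
  | add x y hx hy => simp only [map_add, LinearMap.add_apply, hx, hy, TensorProduct.add_tmul]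
  | tmul e a =>
    rw [legAct_tmul, TensorProduct.map_tmul, contract_tmul, unitRep_apply, LinearMap.smul_apply,
      TensorProduct.smul_tmul, smul_eq_mul]

theorem dualAct_counit_injective : Function.Injective (dualAct l Coalgebra.counit) := by
  intro x y h
  have e := (l.toLin_β_unit x).trans ((congrArg (fun z => (z ⊗ₜ[k] 1 : X.V ⊗[k] k)) h).trans
    (l.toLin_β_unit y).symm)
  have e' := congrArg (toLin (l.β (unit k H)).inv) e
  have hi : ∀ v, toLin (l.β (unit k H)).inv (toLin (l.β (unit k H)).hom v) = v := fun v =>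
    LinearMap.congr_fun (congrArg toLin (l.β (unit k H)).hom_inv_id) v
  have e'' : (1 : k) ⊗ₜ[k] x = (1 : k) ⊗ₜ[k] y := (hi _).symm.trans (e'.trans (hi _))
  simpa using congrArg (TensorProduct.lid k X.V) e''

theorem isYD_element : IsYD X.ρ l.element where
  one := by
    rw [← contractMap_apply, contractMap_element]
    refine LinearMap.ext fun x => l.dualAct_counit_injective ?_
    have h := congrArg (contract (pair Coalgebra.counit Coalgebra.counit)) l.comulLeg_element
    rw [contract_comulLeg, contract_inLeg₁_mul_inLeg₂, convMul_counit, ← contractMap_apply,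
      contractMap_element] at h
    exact (LinearMap.congr_fun h x).symm
  mul := l.comulLeg_element
  cross := by
    rw [crosses_iff]
    intro h
    refine (legAct_ext fun x => ?_).symm
    have e := LinearMap.congr_fun (Hom.comm (l.β (regular k H)).hom h)
      ((1 : H) ⊗ₜ[k] x : H ⊗[k] X.V)
    have hβ : Hom.lin (l.β (regular k H)).hom = swapAct (Algebra.lmul k H) l.element :=
      l.toLin_β (regular k H)
    rw [hβ] at e
    exact (swapAct_tensorRep (ρ := X.ρ) (Algebra.lmul k H) l.element h
      ((1 : H) ⊗ₜ[k] x)).symm.trans (e.trans (tensorRep_swapAct (ρ := X.ρ) (Algebra.lmul k H)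
        l.element h ((1 : H) ⊗ₜ[k] x)))

variable [QuasiTriangular k H]

theorem isDoubleHom_dualAct : IsDoubleHom X.ρ (dualAct l) := by
  rw [← contractMap_element, isDoubleHom_contractMap]
  exact l.isYD_element

theorem map_braid_legAct (l₁ l₂ : LeftHalfBraiding X) (A B : FDMod k H) (a : A.V) (b : B.V)
    (x : X.V) :
    toLin ((α_ A B X).hom ≫ A ◁ (l₂.β B).hom ≫ (α_ A X B).inv ≫ (l₁.β A).hom ▷ B ≫
        (α_ X A B).hom ≫ X ◁ (β_ A B).hom) ((a ⊗ₜ[k] b) ⊗ₜ[k] x : (A.V ⊗[k] B.V) ⊗[k] X.V) =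
      TensorProduct.map LinearMap.id (TensorProduct.comm k A.V B.V).toLinearMap
        (legAct (act₂ A.ρ B.ρ) (inLegs k H _ (Rmat k H) * inLeg₁ k H _ l₁.element *
          inLeg₂ k H _ l₂.element) (x ⊗ₜ[k] (a ⊗ₜ[k] b))) := by
  refine (congrArg (TensorProduct.map LinearMap.id (braidMap A.ρ B.ρ))
    (legAct_two l₁ l₂ A B a b x)).trans ?_
  rw [mul_assoc, map_mul _ (inLegs k H _ _), Module.End.mul_apply, ← map_act₂_eq_legAct,
    ← LinearMap.comp_apply (TensorProduct.map _ _) (TensorProduct.map _ _),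
    ← TensorProduct.map_comp]
  rfl

theorem legAct_braid_inv (l₁ l₂ : LeftHalfBraiding X) (A B : FDMod k H) (a : A.V) (b : B.V)
    (x : X.V) :
    toLin ((β_ B A).inv ▷ X ≫ (α_ B A X).hom ≫ B ◁ (l₁.β A).hom ≫ (α_ B X A).inv ≫
        (l₂.β B).hom ▷ A ≫ (α_ X B A).hom) ((a ⊗ₜ[k] b) ⊗ₜ[k] x : (A.V ⊗[k] B.V) ⊗[k] X.V) =
      TensorProduct.map LinearMap.id (TensorProduct.comm k A.V B.V).toLinearMap
        (legAct (act₂ A.ρ B.ρ) (inLeg₂ k H _ l₂.element * inLeg₁ k H _ l₁.element *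
          inLegs k H _ (TensorProduct.comm k H H (Rinv k H))) (x ⊗ₜ[k] (a ⊗ₜ[k] b))) := by
  have key : ∀ w : B.V ⊗[k] A.V, toLin ((α_ B A X).hom ≫ B ◁ (l₁.β A).hom ≫ (α_ B X A).inv ≫
        (l₂.β B).hom ▷ A ≫ (α_ X B A).hom) (w ⊗ₜ[k] x : (B.V ⊗[k] A.V) ⊗[k] X.V) =
      (legAct (act₂ B.ρ A.ρ) (inLeg₁ k H _ l₂.element * inLeg₂ k H _ l₁.element)
        (x ⊗ₜ[k] w) : X.V ⊗[k] (B.V ⊗[k] A.V)) := by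
    intro w
    induction w with
    | zero =>
      simp only [TensorProduct.zero_tmul, TensorProduct.tmul_zero]
      exact (map_zero (toLin _)).trans (map_zero _).symm
    | add u v hu hv =>
      simp only [TensorProduct.add_tmul, TensorProduct.tmul_add]
      exact (map_add (toLin _) _ _).trans ((congrArg₂ (· + ·) hu hv).trans (map_add _ _ _).symm)
    | tmul b a => exact legAct_two l₂ l₁ B A b a x
  refine (key (act₂ B.ρ A.ρ (Rinv k H) (b ⊗ₜ[k] a))).trans ?_
  have e : x ⊗ₜ[k] act₂ B.ρ A.ρ (Rinv k H) (b ⊗ₜ[k] a) =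
      legAct (act₂ B.ρ A.ρ) (inLegs k H _ (Rinv k H)) (x ⊗ₜ[k] (b ⊗ₜ[k] a)) := by
    rw [← map_act₂_eq_legAct]
    rfl
  have hc : TensorProduct.comm k H H (TensorProduct.comm k H H (Rinv k H)) = Rinv k H :=
    (TensorProduct.comm k H H).symm_apply_apply _
  rw [e, map_comm_legAct, map_mul (swapLegs k H X.V), map_mul (swapLegs k H X.V), swapLegs_inLeg₁,
    swapLegs_inLeg₂, inLegs_apply, inLegs_apply, swapLegs_tmul, hc,
    map_mul _ (inLeg₁ k H _ _ * _)]
  rfl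

theorem comm_iff (l₁ l₂ : LeftHalfBraiding X) :
    Comm l₁ l₂ ↔ IsExchange l₁.element l₂.element := by
  have h : IsExchange l₁.element l₂.element ↔
      inLegs k H _ (Rmat k H) * inLeg₁ k H _ l₁.element * inLeg₂ k H _ l₂.element =
        inLeg₂ k H _ l₂.element * inLeg₁ k H _ l₁.element *
          inLegs k H _ (TensorProduct.comm k H H (Rinv k H)) := by
    have e₁ : inLegs k H (Module.End k X.V) (TensorProduct.comm k H H (Rmat k H)) *
        inLegs k H _ (TensorProduct.comm k H H (Rinv k H)) = 1 := by
      have : Algebra.TensorProduct.comm k H H (Rmat k H * Rinv k H) = 1 := by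
        rw [Units.mul_inv, map_one]
      rw [map_mul] at this
      rw [← map_mul]
      exact (congrArg _ this).trans (map_one _)
    have e₂ : inLegs k H (Module.End k X.V) (TensorProduct.comm k H H (Rinv k H)) *
        inLegs k H _ (TensorProduct.comm k H H (Rmat k H)) = 1 := by
      have : Algebra.TensorProduct.comm k H H (Rinv k H * Rmat k H) = 1 := by
        rw [Units.inv_mul, map_one]
      rw [map_mul] at this
      rw [← map_mul]
      exact (congrArg _ this).trans (map_one _)
    rw [IsExchange]
    constructor
    · intro h
      rw [h, mul_assoc _ (inLegs k H _ _), e₁, mul_one]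
    · intro h
      rw [h, mul_assoc _ (inLegs k H _ _), e₂, mul_one]
  rw [h]
  constructor
  · intro hc
    refine legAct_ext fun x => ?_
    have e := LinearMap.congr_fun (congrArg toLin (hc (regular k H) (regular k H)))
      (((1 : H) ⊗ₜ[k] (1 : H)) ⊗ₜ[k] x : (H ⊗[k] H) ⊗[k] X.V)
    have e' := ((map_braid_legAct l₁ l₂ (regular k H) (regular k H) (1 : H) (1 : H) x).symm.trans
      e).trans (legAct_braid_inv l₁ l₂ (regular k H) (regular k H) (1 : H) (1 : H) x)
    rw [← act₂_lmul]
    exact (TensorProduct.congr (LinearEquiv.refl k X.V) (TensorProduct.comm k H H)).injective e'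
  · intro he A B
    refine hom_ext₃ fun a b x => ?_
    rw [map_braid_legAct, legAct_braid_inv, he]

theorem comm_iff_dualAct (l₁ l₂ : LeftHalfBraiding X) {n : ℕ}
    {s t : Fin n → H} (hR : Rmat k H = ∑ i, s i ⊗ₜ[k] t i) :
    Comm l₁ l₂ ↔ ∀ f g : Module.Dual k H, dualAct l₂ g * dualAct l₁ f =
      ∑ i, ∑ j, dualAct l₁ (sandwich (s i) (t j) f) * dualAct l₂ (sandwich (t i) (s j) g) := by
  rw [comm_iff, isExchange_iff _ _ hR, contractMap_element, contractMap_element]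

end LeftHalfBraiding

end HalfBraiding

end EllipticDrinfeld

end

noncomputable section

namespace EllipticDrinfeld

open FDMod

section Maps

variable {k H : Type u} [Field k] [Ring H] [HopfAlgebra k H]

theorem IsDoubleHom.comp {E F : Type*} [Ring E] [Algebra k E] [Ring F] [Algebra k F]
    {ρ : H →ₐ[k] E} {s : Module.Dual k H →ₗ[k] E} (h : IsDoubleHom ρ s) (θ : E →ₐ[k] F) :
    IsDoubleHom (θ.comp ρ) (θ.toLinearMap ∘ₗ s) where
  one := (congrArg θ h.one).trans (map_one θ)
  mul f g := (congrArg θ (h.mul f g)).trans (map_mul θ _ _)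
  cross f a n h₁ h₂ h₃ hh := by
    have := congrArg θ (h.cross f a n h₁ h₂ h₃ hh)
    simp only [map_mul, map_sum] at this
    exact this

theorem EllipticDouble.comp_eq_comp [QuasiTriangular k H] {V W : Type*} [AddCommGroup V]
    [Module k V] [AddCommGroup W] [Module k W] {φ : EllipticDouble k H →ₐ[k] Module.End k V}
    {ψ : EllipticDouble k H →ₐ[k] Module.End k W} {f : V →ₗ[k] W}
    (h₀ : ∀ h, f ∘ₗ φ (ι₀ k H h) = ψ (ι₀ k H h) ∘ₗ f)
    (h₁ : ∀ g, f ∘ₗ φ (ι₁ k H g) = ψ (ι₁ k H g) ∘ₗ f)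
    (h₂ : ∀ g, f ∘ₗ φ (ι₂ k H g) = ψ (ι₂ k H g) ∘ₗ f) (d : EllipticDouble k H) :
    f ∘ₗ φ d = ψ d ∘ₗ f := by
  have hm : ∀ a b, f ∘ₗ φ a = ψ a ∘ₗ f → f ∘ₗ φ b = ψ b ∘ₗ f →
      f ∘ₗ φ (a * b) = ψ (a * b) ∘ₗ f := fun a b ha hb => by
    rw [map_mul, map_mul, Module.End.mul_eq_comp, Module.End.mul_eq_comp, ← LinearMap.comp_assoc,
      ha, LinearMap.comp_assoc, hb, LinearMap.comp_assoc]
  obtain ⟨z, rfl⟩ := mulMap_surjective d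
  induction z with
  | zero => simp
  | add x y hx hy => simp only [map_add, LinearMap.comp_add, LinearMap.add_comp, hx, hy]
  | tmul h y =>
    induction y with
    | zero => simp
    | add x y hx hy =>
      simp only [TensorProduct.tmul_add, map_add, LinearMap.comp_add, LinearMap.add_comp, hx, hy]
    | tmul g g' => exact hm _ _ (h₀ h) (hm _ _ (h₁ g) (h₂ g'))

end Maps

section CenterEquivalence

variable {k H : Type u} [Field k] [Ring H] [HopfAlgebra k H] [Module.Finite k H]

theorem dualAct_bijOn [QuasiTriangular k H] (X : FDMod k H) :
    Set.BijOn (fun l : LeftHalfBraiding X => dualAct l) Set.univ {s | IsDoubleAction X s} := by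
  refine ⟨fun l _ => ?_, fun l _ m _ h => LeftHalfBraiding.ext_dualAct h, fun s hs => ?_⟩
  · exact ⟨l.isDoubleHom_dualAct.one, l.isDoubleHom_dualAct.mul, l.isDoubleHom_dualAct.cross⟩
  · have h : IsYD X.ρ (ofDual s) := isYD_ofDual ⟨hs.one, hs.mul, hs.cross⟩
    exact ⟨halfBraidingOf h, trivial, (dualAct_halfBraidingOf h).trans (contractMap_ofDual s)⟩

theorem intertwines_iff {X Y : FDMod k H} (l : LeftHalfBraiding X) (m : LeftHalfBraiding Y)
    (f : X ⟶ Y) : Intertwines l m f ↔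
      ∀ φ : Module.Dual k H, toLin f ∘ₗ dualAct l φ = dualAct m φ ∘ₗ toLin f := by
  constructor
  · intro h φ
    refine LinearMap.ext fun x => ?_
    have e := LinearMap.congr_fun (congrArg toLin (h (regular k H)))
      ((1 : H) ⊗ₜ[k] x : H ⊗[k] X.V)
    have e₁ := (congrArg (contract φ) e : contract φ ((toLin f).rTensor H
      (toLin (l.β (regular k H)).hom ((1 : H) ⊗ₜ[k] x : H ⊗[k] X.V) : X.V ⊗[k] H)) =
      contract φ (toLin (m.β (regular k H)).hom ((1 : H) ⊗ₜ[k] toLin f x : H ⊗[k] Y.V) :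
        Y.V ⊗[k] H))
    exact (map_contract (toLin f) φ _).trans e₁
  · intro h A
    refine hom_ext₂ fun a x => ?_
    let b := Module.finBasis k H
    have e₁ : toLin ((l.β A).hom ≫ f ▷ A) (a ⊗ₜ[k] x : A.V ⊗[k] X.V) =
        (∑ i, toLin f (dualAct l (b.coord i) x) ⊗ₜ[k] A.ρ (b i) a : Y.V ⊗[k] A.V) := by
      refine (congrArg (TensorProduct.map (toLin f) LinearMap.id)
        (l.toLin_β_eq_sum b A a x)).trans ?_
      rw [map_sum]
      rfl
    refine e₁.trans (Eq.trans ?_ (m.toLin_β_eq_sum b A a (toLin f x)).symm)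
    exact Finset.sum_congr rfl fun i _ =>
      congrArg (· ⊗ₜ[k] A.ρ (b i) a) (LinearMap.congr_fun (h (b.coord i)) x)

variable [QuasiTriangular k H]

/-- The action of the elliptic double on an object of the elliptic center. -/
def centerAct (X : EllipticCenter (FDMod k H)) : EllipticDouble k H →ₐ[k] Module.End k X.obj.V :=
  EllipticDouble.lift X.obj.ρ (dualAct X.hb₁) (dualAct X.hb₂) X.hb₁.isDoubleHom_dualAct
    X.hb₂.isDoubleHom_dualAct fun f g _ _ _ hR =>
      (LeftHalfBraiding.comm_iff_dualAct X.hb₁ X.hb₂ hR).1 X.comm f g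

theorem centerAct_ι₀ (X : EllipticCenter (FDMod k H)) (h : H) :
    centerAct X (EllipticDouble.ι₀ k H h) = X.obj.ρ h := EllipticDouble.lift_ι₀ _ _ _ h

theorem centerAct_ι₁ (X : EllipticCenter (FDMod k H)) (f : Module.Dual k H) :
    centerAct X (EllipticDouble.ι₁ k H f) = dualAct X.hb₁ f := EllipticDouble.lift_ι₁ _ _ _ f

theorem centerAct_ι₂ (X : EllipticCenter (FDMod k H)) (f : Module.Dual k H) :
    centerAct X (EllipticDouble.ι₂ k H f) = dualAct X.hb₂ f := EllipticDouble.lift_ι₂ _ _ _ f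

/-- An object of the elliptic center as a module over the elliptic double. -/
def centerModule (X : EllipticCenter (FDMod k H)) : FDMod k (EllipticDouble k H) where
  V := X.obj.V
  ρ := centerAct X

variable (k H) in
/-- The functor from the elliptic center to modules over the elliptic double. -/
def centerToModules : EllipticCenter (FDMod k H) ⥤ FDMod k (EllipticDouble k H) where
  obj X := centerModule X
  map {X Y} f := FDMod.Hom.mk (X := centerModule X) (Y := centerModule Y)
    (toLin (X := X.obj) (Y := Y.obj) (EllipticCenter.Hom.f f)) <| EllipticDouble.comp_eq_comp
      (fun h => by
        change _ ∘ₗ centerAct X _ = centerAct Y _ ∘ₗ _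
        rw [centerAct_ι₀, centerAct_ι₀]
        exact FDMod.Hom.comm (EllipticCenter.Hom.f f) h)
      (fun g => by
        change _ ∘ₗ centerAct X _ = centerAct Y _ ∘ₗ _
        rw [centerAct_ι₁, centerAct_ι₁]
        exact (intertwines_iff _ _ _).1 (EllipticCenter.Hom.comm₁ f) g)
      (fun g => by
        change _ ∘ₗ centerAct X _ = centerAct Y _ ∘ₗ _
        rw [centerAct_ι₂, centerAct_ι₂]
        exact (intertwines_iff _ _ _).1 (EllipticCenter.Hom.comm₂ f) g)

instance : (centerToModules k H).Faithful where
  map_injective {X Y _ _} h :=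
    EllipticCenter.Hom.ext <| toLin_injective (X := X.obj) (Y := Y.obj) <|
    congrArg (toLin (X := centerModule X) (Y := centerModule Y)) h

instance : (centerToModules k H).Full where
  map_surjective {X Y} f := by
    let φ : X.obj.V →ₗ[k] Y.obj.V := toLin (X := centerModule X) (Y := centerModule Y) f
    have hφ : ∀ a, φ ∘ₗ centerAct X a = centerAct Y a ∘ₗ φ := fun a =>
      FDMod.Hom.comm (X := centerModule X) (Y := centerModule Y) f a
    have h₀ : ∀ h, φ ∘ₗ X.obj.ρ h = Y.obj.ρ h ∘ₗ φ := fun h => by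
      rw [← centerAct_ι₀, ← centerAct_ι₀, hφ]
    have h₁ : ∀ g, φ ∘ₗ dualAct X.hb₁ g = dualAct Y.hb₁ g ∘ₗ φ := fun g => by
      rw [← centerAct_ι₁, ← centerAct_ι₁, hφ]
    have h₂ : ∀ g, φ ∘ₗ dualAct X.hb₂ g = dualAct Y.hb₂ g ∘ₗ φ := fun g => by
      rw [← centerAct_ι₂, ← centerAct_ι₂, hφ]
    exact ⟨EllipticCenter.Hom.mk (FDMod.Hom.mk φ h₀) ((intertwines_iff _ _ _).2 h₁)
      ((intertwines_iff _ _ _).2 h₂), rfl⟩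

instance : (centerToModules k H).EssSurj where
  mem_essImage M := by
    let X : FDMod k H := (restrict (EllipticDouble.ι₀ k H)).obj M
    have h₁ := isYD_ofDual (EllipticDouble.isDoubleHom_ι₁ (k := k) (H := H) |>.comp M.ρ)
    have h₂ := isYD_ofDual (EllipticDouble.isDoubleHom_ι₂ (k := k) (H := H) |>.comp M.ρ)
    let l₁ : LeftHalfBraiding X := halfBraidingOf (X := X) h₁
    let l₂ : LeftHalfBraiding X := halfBraidingOf (X := X) h₂
    have e₁ : dualAct l₁ = M.ρ.toLinearMap ∘ₗ EllipticDouble.ι₁ k H :=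
      (dualAct_halfBraidingOf (X := X) h₁).trans (contractMap_ofDual _)
    have e₂ : dualAct l₂ = M.ρ.toLinearMap ∘ₗ EllipticDouble.ι₂ k H :=
      (dualAct_halfBraidingOf (X := X) h₂).trans (contractMap_ofDual _)
    have hc : Comm l₁ l₂ := by
      obtain ⟨n, s, t, hR⟩ := TensorProduct.exists_sum_tmul_eq (Rmat k H)
      rw [LeftHalfBraiding.comm_iff_dualAct l₁ l₂ hR]
      intro f g
      have := congrArg M.ρ (EllipticDouble.ι₂_mul_ι₁ f g hR)
      simp only [map_mul, map_sum] at this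
      rw [e₁, e₂]
      exact this
    let Z : EllipticCenter (FDMod k H) := ⟨X, l₁, l₂, hc⟩
    have hρ : centerAct Z = M.ρ := EllipticDouble.algHom_ext (fun h => centerAct_ι₀ Z h)
      (fun f => (centerAct_ι₁ Z f).trans (LinearMap.congr_fun e₁ f))
      (fun f => (centerAct_ι₂ Z f).trans (LinearMap.congr_fun e₂ f))
    refine ⟨Z, ⟨isoMk (X := centerModule Z) (Y := M) (LinearEquiv.refl k M.V) fun a => ?_⟩⟩
    exact LinearMap.ext fun x => LinearMap.congr_fun (DFunLike.congr_fun hρ a) x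

instance : (centerToModules k H).IsEquivalence where

instance : (centerToModules k H).Additive where
  map_add {X Y _ _} := toLin_injective (X := centerModule X) (Y := centerModule Y) rfl

instance : (centerToModules k H).Linear k where
  map_smul {X Y} _ _ := toLin_injective (X := centerModule X) (Y := centerModule Y) rfl

variable (k H) in
/-- Restricting the module attached to an object of the elliptic center to `H` gives the underlying
`H`-module. -/
def centerToModulesRestrict : centerToModules k H ⋙ restrict (EllipticDouble.ι₀ k H) ≅
    EllipticCenter.forget (FDMod k H) :=
  NatIso.ofComponents (fun X => isoMk
      (X := (restrict (EllipticDouble.ι₀ k H)).obj (centerModule X)) (Y := X.obj)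
      (LinearEquiv.refl k X.obj.V) fun h => LinearMap.ext fun x =>
        LinearMap.congr_fun (centerAct_ι₀ X h) x)
    fun {X Y} _ => toLin_injective
      (X := (restrict (EllipticDouble.ι₀ k H)).obj (centerModule X)) (Y := Y.obj) rfl

end CenterEquivalence

section Abelian

open Limits

variable {k A : Type u} [Field k] [Ring A] [Algebra k A]

/-- The vector space of a module, as a type on which `A` acts. -/
def FDMod.Carrier (X : FDMod k A) : Type u := X.V

namespace FDMod

instance (X : FDMod k A) : AddCommGroup X.Carrier := inferInstanceAs (AddCommGroup X.V)

instance (X : FDMod k A) : Module k X.Carrier := inferInstanceAs (Module k X.V)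

instance (X : FDMod k A) : Module.Finite k X.Carrier := inferInstanceAs (Module.Finite k X.V)

instance (X : FDMod k A) : Module A X.Carrier :=
  letI : Module (Module.End k X.V) X.Carrier := Module.End.applyModule
  Module.compHom X.Carrier X.ρ.toRingHom

theorem smul_carrier (X : FDMod k A) (a : A) (x : X.Carrier) : a • x = X.ρ a x := rfl

instance (X : FDMod k A) : IsScalarTower k A X.Carrier where
  smul_assoc c a x := by
    rw [smul_carrier, smul_carrier, map_smul]
    rfl

instance (X : FDMod k A) : Module.Finite A X.Carrier :=
  Module.Finite.of_restrictScalars_finite k A _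

variable (k A) in
/-- Finite-dimensional modules as finitely generated modules. -/
def toFGModuleCat : FDMod k A ⥤ FGModuleCat.{u} A where
  obj X := FGModuleCat.of A X.Carrier
  map {X Y} f := FGModuleCat.ofHom (V := X.Carrier) (W := Y.Carrier)
    { toFun := toLin f
      map_add' := (toLin f).map_add
      map_smul' := fun a x => LinearMap.congr_fun (Hom.comm f a) x }

instance : (toFGModuleCat k A).Faithful where
  map_injective {X _ _ _} h := toLin_injective <| LinearMap.ext fun x =>
    DFunLike.congr_fun (congrArg (fun φ => φ.hom.hom) h) (x : X.Carrier)

instance : (toFGModuleCat k A).Full where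
  map_surjective {X Y} f :=
    let φ : X.Carrier →ₗ[A] Y.Carrier := f.hom.hom
    ⟨Hom.mk (φ.restrictScalars k : X.Carrier →ₗ[k] Y.Carrier) fun a =>
      LinearMap.ext fun x => φ.map_smul a (x : X.Carrier), rfl⟩

instance [Module.Finite k A] : (toFGModuleCat k A).EssSurj where
  mem_essImage M := by
    let : Module k M := Module.compHom M (algebraMap k A)
    have : IsScalarTower k A M := ⟨fun c a x => by
      rw [Algebra.smul_def, mul_smul]
      rfl⟩
    have : Module.Finite k M := Module.Finite.trans A M
    let X : FDMod k A := { V := M, ρ := Algebra.lsmul k k M }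
    let e : X.Carrier ≃ₗ[A] M :=
      { AddEquiv.refl M with map_smul' := fun _ _ => rfl }
    exact ⟨X, ⟨e.toFGModuleCatIso⟩⟩

instance [Module.Finite k A] : (toFGModuleCat k A).IsEquivalence where

theorem exists_abelian [Module.Finite k A] : ∃ 𝒜 : Abelian (FDMod k A),
    𝒜.toPreadditive = (inferInstance : Preadditive (FDMod k A)) := by
  have : IsNoetherianRing A := IsNoetherianRing.of_finite k A
  have : HasFiniteLimits (FDMod k A) :=
    ⟨fun J _ _ => Adjunction.hasLimitsOfShape_of_equivalence (toFGModuleCat k A)⟩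
  exact ⟨abelianOfEquivalence (toFGModuleCat k A), rfl⟩

end FDMod

variable {H : Type u} [Ring H] [HopfAlgebra k H] [Module.Finite k H] [QuasiTriangular k H]

instance : Module.Finite k (EllipticDouble k H) :=
  Module.Finite.of_surjective (EllipticDouble.mulMap k H) EllipticDouble.mulMap_surjective

theorem EllipticCenter.exists_abelian : ∃ 𝒜 : Abelian (EllipticCenter (FDMod k H)),
    𝒜.toPreadditive = (inferInstance : Preadditive (EllipticCenter (FDMod k H))) := by
  obtain ⟨𝒜, h𝒜⟩ := FDMod.exists_abelian (k := k) (A := EllipticDouble k H)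
  have : HasFiniteLimits (EllipticCenter (FDMod k H)) :=
    ⟨fun J _ _ => Adjunction.hasLimitsOfShape_of_equivalence (centerToModules k H)⟩
  exact ⟨abelianOfEquivalence (centerToModules k H), rfl⟩

end Abelian

end EllipticDrinfeld

end

theorem mainTheorem2 {k H : Type u} [Field k] [Ring H] [HopfAlgebra k H] [Module.Finite k H]
    [QuasiTriangular k H] :
    -- the elliptic double is `H ⊗ H^* ⊗ H^*` as a vector space
    Function.Bijective (EllipticDouble.mulMap k H) ∧
    -- both categories are abelian
    (∃ 𝒜 : Abelian (EllipticCenter (FDMod k H)),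
      𝒜.toPreadditive = (inferInstance : Preadditive (EllipticCenter (FDMod k H)))) ∧
    (∃ 𝒜 : Abelian (FDMod k (EllipticDouble k H)),
      𝒜.toPreadditive = (inferInstance : Preadditive (FDMod k (EllipticDouble k H)))) ∧
    -- they are equivalent, by a linear equivalence that preserves the underlying `H`-module and
    -- turns the two half-braidings into the actions of the two copies of `H^*`
    (∃ E : EllipticCenter (FDMod k H) ≌ FDMod k (EllipticDouble k H),
      E.functor.Additive ∧ E.functor.Linear k ∧
      ∃ θ : E.functor ⋙ FDMod.restrict (EllipticDouble.ι₀ k H) ≅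
          EllipticCenter.forget (FDMod k H),
        ∀ (X : EllipticCenter (FDMod k H)) (f : Module.Dual k H) (x : (E.functor.obj X).V),
          FDMod.toLin (θ.hom.app X) ((E.functor.obj X).ρ (EllipticDouble.ι₁ k H f) x) =
            dualAct X.hb₁ f (FDMod.toLin (θ.hom.app X) x) ∧
          FDMod.toLin (θ.hom.app X) ((E.functor.obj X).ρ (EllipticDouble.ι₂ k H f) x) =
            dualAct X.hb₂ f (FDMod.toLin (θ.hom.app X) x)) ∧
    -- half-braidings on an `H`-module correspond to actions of `H^*`
    (∀ X : FDMod k H,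
      Set.BijOn (fun l : LeftHalfBraiding X => dualAct l) Set.univ {s | IsDoubleAction X s}) ∧
    -- a half-braiding is recovered from the action by acting with `∑ h_i ⊗ h_i^*` and swapping
    (∀ (X A : FDMod k H) (l : LeftHalfBraiding X) {n : ℕ} (b : Module.Basis (Fin n) k H)
        (a : A.V) (x : X.V),
      FDMod.toLin (l.β A).hom (a ⊗ₜ[k] x : A.V ⊗[k] X.V) =
        (∑ i, dualAct l (b.coord i) x ⊗ₜ[k] A.ρ (b i) a : X.V ⊗[k] A.V)) ∧
    -- COMM corresponds to the commutation relation between the two copies of `H^*`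
    (∀ (X : FDMod k H) (l₁ l₂ : LeftHalfBraiding X) (n : ℕ) (s t : Fin n → H),
      Rmat k H = ∑ i, s i ⊗ₜ[k] t i →
      (Comm l₁ l₂ ↔ ∀ f g : Module.Dual k H,
        dualAct l₂ g * dualAct l₁ f =
          ∑ i, ∑ j, dualAct l₁ (sandwich (s i) (t j) f) * dualAct l₂ (sandwich (t i) (s j) g))) := by
  exact ⟨⟨EllipticDouble.mulMap_injective, EllipticDouble.mulMap_surjective⟩,
    EllipticCenter.exists_abelian, FDMod.exists_abelian,
    ⟨(centerToModules k H).asEquivalence, (inferInstance : (centerToModules k H).Additive),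
      (inferInstance : (centerToModules k H).Linear k), centerToModulesRestrict k H,
      fun X f x => ⟨LinearMap.congr_fun (centerAct_ι₁ X f) x,
        LinearMap.congr_fun (centerAct_ι₂ X f) x⟩⟩,
    dualAct_bijOn, fun _ A l _ b a x => l.toLin_β_eq_sum b A a x,
    fun _ l₁ l₂ _ _ _ hR => LeftHalfBraiding.comm_iff_dualAct l₁ l₂ hR⟩
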